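/- **Theorem 1.** Let $1/2\le\alpha\le 1$, $2\le p\le\infty$, $R\ge 1$. Let $\mathcal P=\{(\xi,\xi^2):|\xi|\le 1\}$ be the unit parabola and $N_{R^{-1}}(\mathcal P)\subset\mathbb R^2$ its closed $R^{-1}$-neighborhood. Partition $[-1,1]$ into consecutive intervals $I$ of length between $\frac12R^{-\alpha}$ and $2R^{-\alpha}$; the small caps are $\gamma=(I\times\mathbb R)\cap N_{R^{-1}}(\mathcal P)$, of dimensions about $R^{-\alpha}\times R^{-1}$. Let $(\psi_\gamma)_\gamma$ be real-valued functions with $\sum_\gamma\psi_\gamma=1$ on $N_{R^{-1}}(\mathcal P)$, each $\psi_\gamma$ being a smooth bump function adapted to $\gamma$ with constants $M$ and $(B_k)_{k\ge0}$: if $c$ is the midpoint of $I$, then the function $(s,t)\mapsto\psi_\gamma\big(c+R^{-\alpha}s,\;c^2+2cR^{-\alpha}s+R^{-1}t\big)$ is smooth, vanishes for $|(s,t)|>M$, and has all derivatives of order $k$ bounded by $B_k$. For a Schwartz function $f$ on $\mathbb R^2$ put $f_\gamma=(\psi_\gamma\widehat f)^\vee$. Let $$C_{\alpha,p}(R)=\begin{cases}R^{\alpha(\frac12-\frac2p)},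 & p\ge 4\alpha+2,\\ R^{(\alpha-\frac12)(\frac12-\frac1p)}, & 2\le p<4\alpha+2\end{cases}$$ (the two expressions agree at $p=4\alpha+2$, and $1/\infty=0$). (i) For every $\epsilon>0$ there is a constant $C$, depending only on $\epsilon$, $M$ and $(B_k)$, such that for all $\alpha,p,R$, all such partitions and families $(\psi_\gamma)$, and every Schwartz function $f$ with $\operatorname{supp}\widehat f\subset N_{R^{-1}}(\mathcal P)$, $$\|f\|_{L^p(\mathbb R^2)}\le C\,R^{\epsilon}\,C_{\alpha,p}(R)\,\Big\|\Big(\sum_\gamma|f_\gamma|^2\Big)^{1/2}\Big\|_{L^p(\mathbb R^2)}.$$ (ii) The constant is sharp up to $R^\epsilon$: for every $\epsilon>0$ there is $c>0$, depending only on $\epsilon$, $M$ and $(B_k)$, such that for all $\alpha,p,R$ there is a Schwartz function $f\ne0$ with $\operatorname{supp}\widehat f\subset N_{R^{-1}}(\mathcal P)$ for which, for all such partitions and families $(\psi_\gamma)$, $$\|f\|_{L^p(\mathbb R^2)}\ge c\,R^{-\epsilon}\,C_{\alpha,p}(R)\,\Big\|\Big(\sum_\gamma|f_\gamma|^2\Big)^{1/2}\Big\|_{L^p(\mathbb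 R^2)}.$$ -/

import Mathlib

open MeasureTheory SchwartzMap FourierTransform
open scoped ENNReal ContDiff

namespace SmallCap

/-- The Euclidean plane. -/
abbrev Plane : Type := EuclideanSpace ℝ (Fin 2)

/-- The unit parabola `{(ξ, ξ²) : |ξ| ≤ 1}`. -/
def unitParabola : Set Plane := {ξ | |ξ 0| ≤ 1 ∧ ξ 1 = ξ 0 ^ 2}

/-- The (closed) `R⁻¹`-neighborhood of the unit parabola. -/
def parabolaNhd (R : ℝ) : Set Plane := Metric.cthickening R⁻¹ unitParabola

/-- A partition of `[-1, 1]` into finitely many consecutive intervals `I i = [t i, t (i + 1)]`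
of length `R ^ (-α)` up to a factor `2` (an exact length is not possible when `2 * R ^ α` is not
an integer). The small caps are the sets `γ i = (I i × ℝ) ∩ parabolaNhd R`. -/
structure CapPartition (α R : ℝ) where
  n : ℕ
  t : Fin (n + 1) → ℝ
  t_first : t 0 = -1
  t_last : t (Fin.last n) = 1
  le_length : ∀ i : Fin n, R ^ (-α) / 2 ≤ t i.succ - t i.castSucc
  length_le : ∀ i : Fin n, t i.succ - t i.castSucc ≤ 2 * R ^ (-α)

/-- The midpoint of the interval `I i`. -/
noncomputable def CapPartition.center {α R : ℝ} (P : CapPartition α R) (i : Fin P.n) : ℝ :=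
  (P.t i.castSucc + P.t i.succ) / 2

/-- The affine map that takes a box of size about `1` centered at `0` to a parallelogram of size
about `R ^ (-α) × R⁻¹`, centered at the point `(c, c²)` of the parabola, whose long side is tangent
to the parabola there. For `c` the midpoint of `I i` this is the small cap `γ i`, up to a dilation
by a constant about its center. -/
noncomputable def capFrame (α R c : ℝ) (y : Plane) : Plane :=
  !₂[c + R ^ (-α) * y 0, c ^ 2 + 2 * c * (R ^ (-α) * y 0) + R⁻¹ * y 1]

/-- `ψ` is a smooth bump function adapted to the cap centered at `(c, c²)`, with constants
`M` and `B`: rescaled to unit size it is smooth, supported in the ball of radius `M`, and all its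
derivatives of order `k` are bounded by `B k`. -/
structure IsAdaptedBump (α R c M : ℝ) (B : ℕ → ℝ) (ψ : Plane → ℝ) : Prop where
  contDiff : ContDiff ℝ ∞ (ψ ∘ capFrame α R c)
  support : ∀ y, ψ (capFrame α R c y) ≠ 0 → ‖y‖ ≤ M
  bound : ∀ k y, ‖iteratedFDeriv ℝ k (ψ ∘ capFrame α R c) y‖ ≤ B k

/-- A smooth partition of unity on the neighborhood of the parabola, consisting of one bump
function adapted to each small cap. -/
structure IsCapPartitionOfUnity {α R : ℝ} (P : CapPartition α R) (M : ℝ) (B : ℕ → ℝ)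
    (ψ : Fin P.n → Plane → ℝ) : Prop where
  adapted : ∀ i, IsAdaptedBump α R (P.center i) M B (ψ i)
  sum_eq_one : ∀ ξ ∈ parabolaNhd R, ∑ i, ψ i ξ = 1

/-- The frequency piece `f_γ = (ψ_γ f̂)^∨`. -/
noncomputable def capPiece (ψ : Plane → ℝ) (f : 𝓢(Plane, ℂ)) : Plane → ℂ :=
  𝓕⁻ (fun ξ : Plane => (ψ ξ : ℂ) * 𝓕 (f : Plane → ℂ) ξ)

/-- The square function `(∑ |f_γ|²)^(1/2)`. -/
noncomputable def squareFunction {n : ℕ} (ψ : Fin n → Plane → ℝ) (f : 𝓢(Plane, ℂ)) :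
    Plane → ℝ :=
  fun x => Real.sqrt (∑ i, ‖capPiece (ψ i) f x‖ ^ 2)

open Classical in
/-- The constant `C_{α,p}(R)`; here `1 / ∞ = 0`. -/
noncomputable def capConstant (α : ℝ) (p : ℝ≥0∞) (R : ℝ) : ℝ :=
  if ENNReal.ofReal (4 * α + 2) ≤ p then
    R ^ (α * (1 / 2 - 2 * (p⁻¹).toReal))
  else
    R ^ ((α - 1 / 2) * (1 / 2 - (p⁻¹).toReal))

end SmallCap

/-!
# The small cap square function estimate for the parabola

Write `K = R ^ α` and `q = p / 2`, and let `f_i` be the pieces of `f`.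

**Upper bound.** The proof is a broad–narrow argument over the scales `s = 2 / K₀ ^ j` between `1`
and `R ^ (-1 / 2)`, with `K₀` a small power of `R`. A cap of length `s` is a union of `K₀` caps of
length `s / K₀`; by `sum_rpow_le_broad_narrow`, at each point its contribution is dominated either
by one of these caps, which is passed on to the next scale, or by a product of two which are not
adjacent. For such a product, let `ρ = max R⁻¹ (s / K)`. After a linear change of variables
(`freqMap`) the pieces belonging to the cap have Fourier support in boxes of size `1` instead of
`K⁻¹ × ρ`, so that their square function `S` is essentially constant at unit scale
(`IsCutoff.sqSum_mul_weight_le`), and it suffices to bound the product `u` locally, in `L¹`, `L²`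
and `L^∞`, by powers of the local value of `S` (`lintegral_rpow_le_of_local`). The `L¹` bound is
`L²` orthogonality of the pieces and the `L^∞` bound is Cauchy–Schwarz. The `L²` bound is a bilinear
`L⁴` estimate: since the two caps are transversal, the sum of two frequencies determines the
summands up to an error `ρ / s` along the parabola (`abs_sub_le_of_transversal`), so products of
blocks of that length are almost orthogonal, and within a block Cauchy–Schwarz costs only the number
`blockSize` of its small caps (`IsCutoff.lintegral_bilinear_le`). Interpolating, the exponents of
`R` that come up at all scales are bounded by that of the constant `C_{α,p}(R) ^ p`
(`rpow_blockSize_le`, `blockSize_mul_rpow_le`). At the last scale `R ^ (-1 / 2)` the number of small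
caps is about `R ^ (α - 1 / 2)`, and Cauchy–Schwarz together with orthogonality is enough
(`rpow_linear_le`). The number of scales is bounded in terms of `ε`, so that the total
loss is a constant times a fixed power of `K₀`.
For `p = ∞` the pointwise Cauchy–Schwarz inequality gives the claim.

**Sharpness.** The Fourier transform of the example is a smooth version of the indicator function
of the part of the neighborhood of the parabola over `[-θ⁻¹, θ⁻¹]`, with `θ = 1` for
`p ≥ 4 α + 2` and `θ = R ^ (1 / 2)` otherwise. There is no cancellation in the Fourier integral on
a box of dimensions about `θ × θ ^ 2`, which bounds the norm of `f` from below
(`exists_bump_near_parabola`). The square function is bounded from above by interpolating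
its supremum with its `L²` norm if `θ = R ^ (1 / 2)`, and with its `L⁴` norm if `θ = 1`
(`SpreadPieces`). The latter is a sum over pairs of pieces of `L²` norms of
products, which decay with the distance of the pieces by transversality; the sum over pairs
costs a logarithm of `R`.
-/

namespace SmallCap

/-! ### Fourier supports and orthogonality for Schwartz functions on the plane -/

/-- The pointwise product of two Schwartz functions. -/
noncomputable def schwartzMul (f g : 𝓢(Plane, ℂ)) : 𝓢(Plane, ℂ) :=
  pairing (ContinuousLinearMap.mul ℂ ℂ) f g

@[simp] lemma schwartzMul_apply (f g : 𝓢(Plane, ℂ)) (x : Plane) :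
    schwartzMul f g x = f x * g x := rfl

lemma fourier_schwartzMul (f g : 𝓢(Plane, ℂ)) (ξ : Plane) :
    𝓕 (schwartzMul f g) ξ = ∫ t, 𝓕 f t * 𝓕 g (ξ - t) := by
  have h1 : schwartzMul f g =
      𝓕 (SchwartzMap.convolution (ContinuousLinearMap.mul ℂ ℂ) (𝓕⁻ f) (𝓕⁻ g)) := by
    rw [fourier_convolution]; simp [schwartzMul]
  have h2 : ∀ (u : 𝓢(Plane, ℂ)) (x : Plane), 𝓕 u x = 𝓕⁻ u (-x) := by
    intro u x
    rw [fourier_coe, fourierInv_coe, Real.fourierInv_eq_fourier_neg, neg_neg]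
  rw [h2, h1, FourierTransform.fourierInv_fourier_eq, convolution_apply, convolution_def,
    ← integral_neg_eq_self]
  congr 1
  ext t
  rw [h2 f, h2 g]
  simp only [ContinuousLinearMap.mul_apply']
  congr 2
  abel

/-- The Fourier transform of a product is supported in the sum of the Fourier supports. -/
lemma exists_of_fourier_schwartzMul_ne_zero {f g : 𝓢(Plane, ℂ)} {ξ : Plane}
    (h : 𝓕 (schwartzMul f g) ξ ≠ 0) : ∃ t, 𝓕 f t ≠ 0 ∧ 𝓕 g (ξ - t) ≠ 0 := by
  by_contra! hc
  apply h
  rw [fourier_schwartzMul]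
  refine integral_eq_zero_of_ae (Filter.Eventually.of_forall fun t => ?_)
  by_cases ht : 𝓕 f t = 0
  · simp [ht]
  · simp [hc t ht]

/-- The translate `y ↦ φ (y - x)`. -/
noncomputable def translate (φ : 𝓢(Plane, ℂ)) (x : Plane) : 𝓢(Plane, ℂ) :=
  compSubConstCLM ℂ x φ

@[simp] lemma translate_apply (φ : 𝓢(Plane, ℂ)) (x y : Plane) :
    translate φ x y = φ (y - x) := rfl

lemma fourier_ne_zero_of_translate {φ : 𝓢(Plane, ℂ)} {x ξ : Plane}
    (h : 𝓕 (translate φ x) ξ ≠ 0) : 𝓕 φ ξ ≠ 0 := by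
  intro h0
  apply h
  have := congrFun (VectorFourier.fourierIntegral_comp_add_right Real.fourierChar
    (volume : Measure Plane) (innerₗ Plane) φ (-x)) ξ
  have h1 : 𝓕 (translate φ x) ξ = VectorFourier.fourierIntegral Real.fourierChar
    (volume : Measure Plane) (innerₗ Plane) (φ ∘ fun v ↦ v + -x) ξ := by
    rw [fourier_coe]; rfl
  have h2 : VectorFourier.fourierIntegral Real.fourierChar
    (volume : Measure Plane) (innerₗ Plane) φ ξ = 𝓕 φ ξ := by
    rw [fourier_coe]; rfl
  rw [h1, this, h2, h0, smul_zero]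

lemma lintegral_enorm_sq_eq (f : 𝓢(Plane, ℂ)) :
    ∫⁻ x, ‖f x‖ₑ ^ 2 = ENNReal.ofReal (∫ x, ‖f x‖ ^ 2) := by
  rw [ofReal_integral_eq_lintegral_ofReal]
  · congr 1; ext x
    rw [← ofReal_norm, ENNReal.ofReal_pow (norm_nonneg _)]
  · have := (f.memLp 2 (μ := volume)).integrable_norm_pow (by norm_num)
    simpa using this
  · exact Filter.Eventually.of_forall fun x => by positivity

/-- Plancherel. -/
lemma lintegral_enorm_sq_fourier (f : 𝓢(Plane, ℂ)) :
    ∫⁻ ξ, ‖𝓕 f ξ‖ₑ ^ 2 = ∫⁻ x, ‖f x‖ₑ ^ 2 := by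
  rw [lintegral_enorm_sq_eq, lintegral_enorm_sq_eq, integral_norm_sq_fourier]

lemma measurable_enorm_schwartz (f : 𝓢(Plane, ℂ)) : Measurable fun x => ‖f x‖ₑ :=
  f.continuous.enorm.measurable

lemma enorm_sum_sq_le {ι : Type*} (s : Finset ι) (z : ι → ℂ) (D : ℕ)
    (hD : (s.filter fun j => z j ≠ 0).card ≤ D) :
    ‖∑ j ∈ s, z j‖ₑ ^ 2 ≤ D * ∑ j ∈ s, ‖z j‖ₑ ^ 2 := by
  rw [← Finset.sum_filter_ne_zero]
  have h1 : ‖∑ j ∈ s with z j ≠ 0, z j‖ ^ 2 ≤ D * ∑ j ∈ s, ‖z j‖ ^ 2 := by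
    calc ‖∑ j ∈ s with z j ≠ 0, z j‖ ^ 2
        ≤ (∑ j ∈ s with z j ≠ 0, ‖z j‖) ^ 2 := by gcongr; exact norm_sum_le _ _
      _ ≤ (s.filter fun j => z j ≠ 0).card * ∑ j ∈ s with z j ≠ 0, ‖z j‖ ^ 2 :=
          sq_sum_le_card_mul_sum_sq
      _ ≤ D * ∑ j ∈ s, ‖z j‖ ^ 2 := by
          gcongr
          exact Finset.filter_subset _ _
  have h2 := ENNReal.ofReal_le_ofReal h1
  rw [ENNReal.ofReal_pow (norm_nonneg _), ENNReal.ofReal_mul (by positivity),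
    ENNReal.ofReal_sum_of_nonneg (fun _ _ => by positivity), ofReal_norm,
    ENNReal.ofReal_natCast] at h2
  simpa [ENNReal.ofReal_pow (norm_nonneg _), ofReal_norm] using h2

/-- Almost orthogonality: if no frequency lies in more than `D` of the Fourier supports, the square
of the `L²` norm of a sum is at most `D` times the sum of the squares. -/
lemma lintegral_enorm_sq_sum_le {ι : Type*} (s : Finset ι) (F : ι → 𝓢(Plane, ℂ)) (D : ℕ)
    (hD : ∀ ξ, (s.filter fun j => 𝓕 (F j) ξ ≠ 0).card ≤ D) :
    ∫⁻ x, ‖∑ j ∈ s, F j x‖ₑ ^ 2 ≤ D * ∑ j ∈ s, ∫⁻ x, ‖F j x‖ₑ ^ 2 := by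
  have h1 : ∀ x, ∑ j ∈ s, F j x = (∑ j ∈ s, F j) x := fun x => by simp
  simp_rw [h1]
  rw [← lintegral_enorm_sq_fourier]
  have h2 : 𝓕 (∑ j ∈ s, F j) = ∑ j ∈ s, 𝓕 (F j) := by
    exact map_sum (fourierCLM ℂ 𝓢(Plane, ℂ)) F s
  calc ∫⁻ ξ, ‖𝓕 (∑ j ∈ s, F j) ξ‖ₑ ^ 2
      ≤ ∫⁻ ξ, D * ∑ j ∈ s, ‖𝓕 (F j) ξ‖ₑ ^ 2 := by
        refine lintegral_mono fun ξ => ?_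
        rw [h2]
        simpa using enorm_sum_sq_le s (fun j => 𝓕 (F j) ξ) D (hD ξ)
    _ = D * ∑ j ∈ s, ∫⁻ x, ‖F j x‖ₑ ^ 2 := by
        rw [lintegral_const_mul, lintegral_finsetSum]
        · simp_rw [lintegral_enorm_sq_fourier]
        · exact fun j _ => (measurable_enorm_schwartz _).pow_const _
        · exact Finset.measurable_fun_sum _
            fun j _ => (measurable_enorm_schwartz _).pow_const _

/-- There is a Schwartz function that is bounded below on a neighborhood of the origin and whose
Fourier transform is supported in the unit ball. -/
lemma exists_bandlimited_cutoff : ∃ φ : 𝓢(Plane, ℂ), (∀ ξ, 𝓕 φ ξ ≠ 0 → ‖ξ‖ ≤ 1) ∧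
    ∃ r > 0, ∀ y, ‖y‖ ≤ r → 1 ≤ ‖φ y‖ := by
  let χ : ContDiffBump (0 : Plane) := ⟨1 / 2, 1, by norm_num, by norm_num⟩
  have hc : HasCompactSupport fun ξ => ((χ ξ : ℝ) : ℂ) :=
    χ.hasCompactSupport.comp_left (g := fun r : ℝ => (r : ℂ)) (by simp)
  have hs : ContDiff ℝ ∞ fun ξ => ((χ ξ : ℝ) : ℂ) :=
    Complex.ofRealCLM.contDiff.comp χ.contDiff
  let u : 𝓢(Plane, ℂ) := hc.toSchwartzMap hs
  have hu : ∀ ξ, u ξ = ((χ ξ : ℝ) : ℂ) := fun ξ => rfl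
  have h0 : 𝓕⁻ u 0 = ((∫ ξ, χ ξ : ℝ) : ℂ) := by
    rw [fourierInv_coe, Real.fourierInv_eq]
    simp only [inner_zero_right, hu]
    rw [← integral_complex_ofReal]
    simp
  have hpos : 0 < ∫ ξ, χ ξ := χ.integral_pos
  have hne : 𝓕⁻ u 0 ≠ 0 := by rw [h0]; exact_mod_cast hpos.ne'
  let a : ℂ := 2 * (𝓕⁻ u 0)⁻¹
  have ha : a * 𝓕⁻ u 0 = 2 := by simp [a, hne]
  have hcont : ContinuousAt (fun y => ‖(a • 𝓕⁻ u : 𝓢(Plane, ℂ)) y‖) 0 :=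
    (a • 𝓕⁻ u : 𝓢(Plane, ℂ)).continuous.norm.continuousAt
  have hev := hcont.eventually (lt_mem_nhds (a := 1) (by simp [ha]))
  obtain ⟨r, hr, hball⟩ := Metric.eventually_nhds_iff.1 hev
  refine ⟨a • 𝓕⁻ u, fun ξ hξ => ?_, r / 2, by positivity, fun y hy => ?_⟩
  · have h3 : 𝓕 (a • 𝓕⁻ u : 𝓢(Plane, ℂ)) = a • u := by
      have := map_smul (fourierCLM ℂ 𝓢(Plane, ℂ)) a (𝓕⁻ u)
      rw [fourierCLM_apply, fourierCLM_apply, FourierTransform.fourier_fourierInv_eq] at this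
      exact this
    rw [h3] at hξ
    have : χ ξ ≠ 0 := by
      intro h
      apply hξ
      simp [hu, h]
    have h4 : ξ ∈ Function.support χ := this
    rw [χ.support_eq] at h4
    simpa using (Metric.mem_ball.1 h4).le
  · refine (hball ?_).le
    rw [dist_zero_right]
    linarith

/-! ### Local estimates at unit scale -/

/-- Cauchy–Schwarz for the Lebesgue integral. -/
lemma lintegral_mul_sq_le {α : Type*} [MeasurableSpace α] {μ : Measure α} {f g : α → ℝ≥0∞}
    (hf : AEMeasurable f μ) (hg : AEMeasurable g μ) :
    (∫⁻ a, f a * g a ∂μ) ^ 2 ≤ (∫⁻ a, f a ^ 2 ∂μ) * ∫⁻ a, g a ^ 2 ∂μ := by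
  have h := ENNReal.lintegral_mul_norm_pow_le (μ := μ) (hf.pow_const 2) (hg.pow_const 2)
    (p := 1 / 2) (q := 1 / 2) (by norm_num) (by norm_num) (by norm_num)
  have e : ∀ t : ℝ≥0∞, (t ^ 2) ^ (1 / 2 : ℝ) = t := fun t => by
    rw [← ENNReal.rpow_natCast, ← ENNReal.rpow_mul]; norm_num
  have e' : ∀ t : ℝ≥0∞, (t ^ (1 / 2 : ℝ)) ^ 2 = t := fun t => by
    rw [← ENNReal.rpow_natCast, ← ENNReal.rpow_mul]; norm_num
  simp only [e] at h
  calc _ ≤ _ := pow_le_pow_left' h 2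
    _ = _ := by rw [mul_pow, e', e']

/-- The integrable weight `(1 + |z|)⁻⁴`. -/
noncomputable def weight (z : Plane) : ℝ≥0∞ := ENNReal.ofReal (((1 + ‖z‖) ^ 4)⁻¹)

lemma measurable_weight : Measurable weight := by
  unfold weight; fun_prop

lemma weight_mul_weight_le (a b : Plane) : weight a * weight b ≤ weight (a + b) := by
  unfold weight
  rw [← ENNReal.ofReal_mul (by positivity), ← mul_inv, ← mul_pow]
  apply ENNReal.ofReal_le_ofReal
  gcongr
  nlinarith [norm_add_le a b, norm_nonneg a, norm_nonneg b,
    mul_nonneg (norm_nonneg a) (norm_nonneg b)]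

lemma lintegral_weight_ne_top : ∫⁻ z, weight z ≠ ⊤ := by
  have h : Integrable (fun z : Plane => (1 + ‖z‖) ^ (-4 : ℝ)) :=
    integrable_one_add_norm (by norm_num [finrank_euclideanSpace])
  have h2 := h.lintegral_lt_top
  refine (lt_of_le_of_lt (lintegral_mono fun z => ?_) h2).ne
  rw [weight, Real.rpow_neg (by positivity)]
  norm_cast

/-- The average of `h` about `x` against the weight. -/
noncomputable def smear (h : Plane → ℝ≥0∞) (x : Plane) : ℝ≥0∞ := ∫⁻ z, h z * weight (z - x)

/-- The square `∑ |g_i|²` of the square function of a finite family. -/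
noncomputable def sqSum {ι : Type*} (I : Finset ι) (g : ι → 𝓢(Plane, ℂ)) (z : Plane) : ℝ≥0∞ :=
  ∑ i ∈ I, ‖g i z‖ₑ ^ 2

lemma measurable_sqSum {ι : Type*} (I : Finset ι) (g : ι → 𝓢(Plane, ℂ)) :
    Measurable (sqSum I g) :=
  Finset.measurable_fun_sum _ fun _ _ => (measurable_enorm_schwartz _).pow_const _

lemma measurable_mul_weight {h : Plane → ℝ≥0∞} (hh : Measurable h) (x : Plane) :
    Measurable fun z => h z * weight (z - x) :=
  hh.mul (measurable_weight.comp (measurable_id.sub_const x))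

lemma measurable_smear {h : Plane → ℝ≥0∞} (hh : Measurable h) : Measurable (smear h) := by
  unfold smear
  apply Measurable.lintegral_prod_right'
    (f := fun p : Plane × Plane => h p.2 * weight (p.2 - p.1))
  exact (hh.comp measurable_snd).mul (measurable_weight.comp (measurable_snd.sub measurable_fst))

lemma smear_mono {h h' : Plane → ℝ≥0∞} (hh : ∀ z, h z ≤ h' z) (x : Plane) :
    smear h x ≤ smear h' x :=
  lintegral_mono fun z => mul_le_mul_left (hh z) _

lemma sqSum_mono {ι : Type*} {J I : Finset ι} (h : J ⊆ I) (g : ι → 𝓢(Plane, ℂ)) (z : Plane) :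
    sqSum J g z ≤ sqSum I g z :=
  Finset.sum_le_sum_of_subset h

/-- By Jensen, averaging against the weight does not increase `L^q` norms, up to a constant. -/
lemma lintegral_smear_rpow_le {h : Plane → ℝ≥0∞} (hh : Measurable h) {q : ℝ} (hq : 1 ≤ q) :
    ∫⁻ x, smear h x ^ q ≤ (∫⁻ z, weight z) ^ q * ∫⁻ x, h x ^ q := by
  have hq0 : 0 < q := by linarith
  have key : ∀ x, smear h x ^ q ≤
      (∫⁻ z, h z ^ q * weight (z - x)) * (∫⁻ z, weight z) ^ (q - 1) := by
    intro x
    have hw : Measurable fun z => weight (z - x) :=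
      measurable_weight.comp (measurable_id.sub_const x)
    have h1 := ENNReal.lintegral_mul_norm_pow_le (μ := volume)
      (f := fun z => h z ^ q * weight (z - x)) (g := fun z => weight (z - x))
      ((hh.pow_const q).mul hw).aemeasurable hw.aemeasurable
      (p := 1 / q) (q := 1 - 1 / q) (by positivity)
      (by rw [sub_nonneg, div_le_one hq0]; exact hq) (by ring)
    have h2 : smear h x ≤ (∫⁻ z, h z ^ q * weight (z - x)) ^ (1 / q) *
        (∫⁻ z, weight z) ^ (1 - 1 / q) := by
      rw [lintegral_sub_right_eq_self weight x] at h1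
      refine le_trans (le_of_eq ?_) h1
      unfold smear
      congr 1; ext z
      rw [ENNReal.mul_rpow_of_nonneg _ _ (by positivity), ← ENNReal.rpow_mul, mul_assoc,
        ← ENNReal.rpow_add_of_nonneg _ _ (by positivity)
          (by rw [sub_nonneg, div_le_one hq0]; exact hq)]
      have : q * (1 / q) = 1 := by field_simp
      rw [this]
      simp
    calc smear h x ^ q ≤ _ := ENNReal.rpow_le_rpow h2 hq0.le
      _ = _ := by
        rw [ENNReal.mul_rpow_of_nonneg _ _ hq0.le, ← ENNReal.rpow_mul, ← ENNReal.rpow_mul]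
        have e1 : 1 / q * q = 1 := by field_simp
        have e2 : (1 - 1 / q) * q = q - 1 := by field_simp
        rw [e1, e2, ENNReal.rpow_one]
  calc ∫⁻ x, smear h x ^ q
      ≤ ∫⁻ x, (∫⁻ z, h z ^ q * weight (z - x)) * (∫⁻ z, weight z) ^ (q - 1) :=
        lintegral_mono key
    _ = (∫⁻ x, ∫⁻ z, h z ^ q * weight (z - x)) * (∫⁻ z, weight z) ^ (q - 1) := by
        rw [lintegral_mul_const]
        exact measurable_smear (hh.pow_const q)
    _ = (∫⁻ z, ∫⁻ x, h z ^ q * weight (z - x)) * (∫⁻ z, weight z) ^ (q - 1) := by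
        rw [lintegral_lintegral_swap]
        apply Measurable.aemeasurable
        exact ((hh.pow_const q).comp measurable_snd).mul
          (measurable_weight.comp (measurable_snd.sub measurable_fst))
    _ = ((∫⁻ z, h z ^ q) * ∫⁻ z, weight z) * (∫⁻ z, weight z) ^ (q - 1) := by
        congr 1
        rw [← lintegral_mul_const _ (hh.pow_const q)]
        congr 1; ext z
        rw [lintegral_const_mul]
        · rw [lintegral_sub_left_eq_self weight z]
        · exact measurable_weight.comp (measurable_const.sub measurable_id)
    _ = (∫⁻ z, weight z) ^ q * ∫⁻ x, h x ^ q := by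
        have : (∫⁻ z, weight z) ^ q = (∫⁻ z, weight z) * (∫⁻ z, weight z) ^ (q - 1) := by
          conv_lhs => rw [show q = 1 + (q - 1) by ring]
          rw [ENNReal.rpow_add_of_nonneg _ _ zero_le_one (by linarith), ENNReal.rpow_one]
        rw [this]; ring

/-- A band-limited function that is at least `1` on the ball of radius `r` about the origin,
together with a decay constant. -/
structure IsCutoff (φ : 𝓢(Plane, ℂ)) (r : ℝ) (κ : ℝ≥0∞) : Prop where
  band : ∀ ξ, 𝓕 φ ξ ≠ 0 → ‖ξ‖ ≤ 1
  radius_pos : 0 < r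
  one_le : ∀ y, ‖y‖ ≤ r → 1 ≤ ‖φ y‖ₑ
  decay : ∀ y, ‖φ y‖ₑ ^ 2 ≤ κ * weight y
  const_ne_top : κ ≠ ⊤

lemma exists_isCutoff : ∃ φ r κ, IsCutoff φ r κ := by
  obtain ⟨φ, h1, r, hr, h2⟩ := exists_bandlimited_cutoff
  obtain ⟨C, hC⟩ : ∃ C : ℝ, ∀ y, (1 + ‖y‖) ^ 2 * ‖φ y‖ ≤ C := by
    refine ⟨2 ^ 2 * (Finset.Iic (2, 0)).sup (fun m => SchwartzMap.seminorm ℝ m.1 m.2) φ,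
      fun y => ?_⟩
    have := one_add_le_sup_seminorm_apply (𝕜 := ℝ) (m := (2, 0)) (k := 2) (n := 0) le_rfl le_rfl
      φ y
    rwa [norm_iteratedFDeriv_zero] at this
  refine ⟨φ, r, ENNReal.ofReal (C ^ 2), h1, hr, fun y hy => ?_, fun y => ?_, ENNReal.ofReal_ne_top⟩
  · rw [← ofReal_norm, ENNReal.one_le_ofReal]; exact h2 y hy
  · rw [← ofReal_norm, ← ENNReal.ofReal_pow (norm_nonneg _), weight,
      ← ENNReal.ofReal_mul (by positivity)]
    apply ENNReal.ofReal_le_ofReal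
    rw [← div_eq_mul_inv, le_div_iff₀ (by positivity)]
    calc ‖φ y‖ ^ 2 * (1 + ‖y‖) ^ 4 = ((1 + ‖y‖) ^ 2 * ‖φ y‖) ^ 2 := by ring
      _ ≤ C ^ 2 := by gcongr; exact hC y

section Local

variable {φ : 𝓢(Plane, ℂ)} {r : ℝ} {κ : ℝ≥0∞}

/-- The Fourier support of `g φ(· - x)` lies in the unit neighborhood of that of `g`. -/
lemma IsCutoff.exists_near (hφ : IsCutoff φ r κ) {g : 𝓢(Plane, ℂ)} {x ξ : Plane}
    (h : 𝓕 (schwartzMul g (translate φ x)) ξ ≠ 0) : ∃ t, 𝓕 g t ≠ 0 ∧ ‖ξ - t‖ ≤ 1 := by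
  obtain ⟨t, h1, h2⟩ := exists_of_fourier_schwartzMul_ne_zero h
  exact ⟨t, h1, hφ.band _ (fourier_ne_zero_of_translate h2)⟩

lemma IsCutoff.norm_sub_le (hφ : IsCutoff φ r κ) {g : 𝓢(Plane, ℂ)} {θ : Plane} {L : ℝ}
    (hg : ∀ ξ, 𝓕 g ξ ≠ 0 → ‖ξ - θ‖ ≤ L) {x ξ : Plane}
    (h : 𝓕 (schwartzMul g (translate φ x)) ξ ≠ 0) : ‖ξ - θ‖ ≤ L + 1 := by
  obtain ⟨t, h1, h2⟩ := hφ.exists_near h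
  calc ‖ξ - θ‖ = ‖(t - θ) + (ξ - t)‖ := by congr 1; abel
    _ ≤ L + 1 := (norm_add_le _ _).trans (add_le_add (hg t h1) h2)

/-- Bernstein's inequality: a function with Fourier support in a ball of radius `L` is controlled
pointwise by its local `L²` averages. -/
lemma IsCutoff.enorm_sq_le (hφ : IsCutoff φ r κ) {g : 𝓢(Plane, ℂ)} {θ : Plane} {L : ℝ}
    (hg : ∀ ξ, 𝓕 g ξ ≠ 0 → ‖ξ - θ‖ ≤ L) (y : Plane) :
    ‖g y‖ₑ ^ 2 ≤ volume (Metric.closedBall (0 : Plane) (L + 1)) *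
      ∫⁻ z, ‖g z‖ₑ ^ 2 * ‖φ (z - y)‖ₑ ^ 2 := by
  set F := schwartzMul g (translate φ y) with hF
  set s := Metric.closedBall θ (L + 1)
  have h1 : ‖g y‖ₑ ≤ ‖F y‖ₑ := by
    have : 1 ≤ ‖φ 0‖ₑ := hφ.one_le 0 (by simpa using hφ.radius_pos.le)
    simp only [hF, schwartzMul_apply, translate_apply, sub_self, enorm_mul]
    exact le_mul_of_one_le_right' this
  have h2 : ‖F y‖ₑ ≤ ∫⁻ ξ, s.indicator 1 ξ * ‖𝓕 F ξ‖ₑ := by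
    have e : F y = 𝓕⁻ (𝓕 F) y := by simp
    rw [e, fourierInv_coe, Real.fourierInv_eq]
    refine (enorm_integral_le_lintegral_enorm _).trans (lintegral_mono fun ξ => ?_)
    by_cases h : 𝓕 F ξ = 0
    · simp [h]
    · have : ξ ∈ s := by
        rw [mem_closedBall_iff_norm]
        exact hφ.norm_sub_le hg h
      have hu : ‖((Real.fourierChar (inner ℝ ξ y) : Circle) : ℂ)‖ₑ = 1 := by
        rw [← ofReal_norm, Circle.norm_coe, ENNReal.ofReal_one]
      rw [Circle.smul_def, smul_eq_mul, enorm_mul, hu]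
      simp [this]
  have h3 : (∫⁻ ξ, s.indicator 1 ξ * ‖𝓕 F ξ‖ₑ) ^ 2 ≤ volume s * ∫⁻ ξ, ‖𝓕 F ξ‖ₑ ^ 2 := by
    have hs : MeasurableSet s := Metric.isClosed_closedBall.measurableSet
    refine (lintegral_mul_sq_le (measurable_one.indicator hs).aemeasurable
      (measurable_enorm_schwartz _).aemeasurable).trans (le_of_eq ?_)
    congr 1
    have : ∀ a, (s.indicator (1 : Plane → ℝ≥0∞) a) ^ 2 = s.indicator 1 a := fun a => by
      by_cases h : a ∈ s <;> simp [h]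
    simp_rw [this]
    rw [lintegral_indicator_one hs]
  calc ‖g y‖ₑ ^ 2 ≤ (∫⁻ ξ, s.indicator 1 ξ * ‖𝓕 F ξ‖ₑ) ^ 2 :=
        pow_le_pow_left' (h1.trans h2) 2
    _ ≤ volume s * ∫⁻ ξ, ‖𝓕 F ξ‖ₑ ^ 2 := h3
    _ = _ := by
        rw [lintegral_enorm_sq_fourier, Measure.addHaar_closedBall_center]
        simp [hF, enorm_mul, mul_pow]

variable {ι : Type*} {I : Finset ι} {g : ι → 𝓢(Plane, ℂ)} {θ : ι → Plane} {L : ℝ}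

lemma IsCutoff.lintegral_sqSum_mul_le (hφ : IsCutoff φ r κ) (J : Finset ι) (x : Plane) :
    ∫⁻ z, sqSum J g z * ‖φ (z - x)‖ₑ ^ 2 ≤ κ * smear (sqSum J g) x := by
  unfold smear
  rw [← lintegral_const_mul _ (measurable_mul_weight (measurable_sqSum J g) x)]
  refine lintegral_mono fun z => ?_
  calc sqSum J g z * ‖φ (z - x)‖ₑ ^ 2 ≤ sqSum J g z * (κ * weight (z - x)) := by
        gcongr; exact hφ.decay _
    _ = _ := by ring

/-- The square function of a family with unit-scale Fourier supports is essentially constant at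
unit scale. -/
lemma IsCutoff.sqSum_mul_weight_le (hφ : IsCutoff φ r κ)
    (hg : ∀ i ∈ I, ∀ ξ, 𝓕 (g i) ξ ≠ 0 → ‖ξ - θ i‖ ≤ L) (x y : Plane) :
    sqSum I g y * weight (y - x) ≤
      volume (Metric.closedBall (0 : Plane) (L + 1)) * κ * smear (sqSum I g) x := by
  set V := volume (Metric.closedBall (0 : Plane) (L + 1))
  have h1 : sqSum I g y ≤ V * ∫⁻ z, sqSum I g z * ‖φ (z - y)‖ₑ ^ 2 := by
    calc sqSum I g y ≤ ∑ i ∈ I, V * ∫⁻ z, ‖g i z‖ₑ ^ 2 * ‖φ (z - y)‖ₑ ^ 2 :=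
          Finset.sum_le_sum fun i hi => hφ.enorm_sq_le (hg i hi) y
      _ = V * ∫⁻ z, sqSum I g z * ‖φ (z - y)‖ₑ ^ 2 := by
          rw [← Finset.mul_sum, ← lintegral_finsetSum]
          · simp_rw [sqSum, Finset.sum_mul]
          · exact fun i _ => ((measurable_enorm_schwartz _).pow_const _).mul
              (((measurable_enorm_schwartz φ).comp (measurable_id.sub_const y)).pow_const _)
  calc sqSum I g y * weight (y - x)
      ≤ V * (κ * smear (sqSum I g) y) * weight (y - x) := by
        gcongr
        exact h1.trans (by gcongr; exact hφ.lintegral_sqSum_mul_le I y)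
    _ = V * κ * (smear (sqSum I g) y * weight (y - x)) := by ring
    _ ≤ V * κ * smear (sqSum I g) x := by
        gcongr
        unfold smear
        rw [← lintegral_mul_const _ (measurable_mul_weight (measurable_sqSum I g) y)]
        refine lintegral_mono fun z => ?_
        rw [mul_assoc]
        gcongr
        calc weight (z - y) * weight (y - x) ≤ weight ((z - y) + (y - x)) :=
              weight_mul_weight_le _ _
          _ = weight (z - x) := by congr 1; abel

/-- Local `L²` orthogonality at unit scale. -/
lemma IsCutoff.lintegral_sum_sq_le (hφ : IsCutoff φ r κ) {D : ℕ}
    (hg : ∀ i ∈ I, ∀ ξ, 𝓕 (g i) ξ ≠ 0 → ‖ξ - θ i‖ ≤ L)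
    (hD : ∀ ξ, (I.filter fun i => ‖ξ - θ i‖ ≤ L + 1).card ≤ D) (x : Plane) :
    ∫⁻ y, ‖∑ i ∈ I, g i y‖ₑ ^ 2 * ‖φ (y - x)‖ₑ ^ 2 ≤
      D * ∫⁻ y, sqSum I g y * ‖φ (y - x)‖ₑ ^ 2 := by
  have h := lintegral_enorm_sq_sum_le I (fun i => schwartzMul (g i) (translate φ x)) D
    (fun ξ => ?_)
  · calc _ = ∫⁻ y, ‖∑ i ∈ I, schwartzMul (g i) (translate φ x) y‖ₑ ^ 2 := by
          congr 1; ext y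
          simp [← Finset.sum_mul, enorm_mul, mul_pow]
      _ ≤ _ := h
      _ = _ := by
          rw [← lintegral_finsetSum]
          · simp [sqSum, Finset.sum_mul, enorm_mul, mul_pow]
          · exact fun i _ => (measurable_enorm_schwartz _).pow_const _
  · refine (Finset.card_le_card ?_).trans (hD ξ)
    intro i hi
    rw [Finset.mem_filter] at hi ⊢
    exact ⟨hi.1, hφ.norm_sub_le (hg i hi.1) hi.2⟩

end Local

/-- An integral over the plane is the average of the integrals over the balls of radius `r`. -/
lemma lintegral_eq_average {u : Plane → ℝ≥0∞} (hu : Measurable u) (r : ℝ) :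
    volume (Metric.closedBall (0 : Plane) r) * ∫⁻ y, u y =
      ∫⁻ x, ∫⁻ y in Metric.closedBall x r, u y := by
  have hm : MeasurableSet {p : Plane × Plane | ‖p.2 - p.1‖ ≤ r} :=
    (isClosed_le (by fun_prop) continuous_const).measurableSet
  have e1 : ∀ x, ∫⁻ y in Metric.closedBall x r, u y =
      ∫⁻ y, {p : Plane × Plane | ‖p.2 - p.1‖ ≤ r}.indicator (fun p => u p.2) (x, y) := by
    intro x
    rw [← lintegral_indicator Metric.isClosed_closedBall.measurableSet]
    congr 1
  simp_rw [e1]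
  have hum : Measurable ({p : Plane × Plane | ‖p.2 - p.1‖ ≤ r}.indicator fun p => u p.2) :=
    (hu.comp measurable_snd).indicator hm
  rw [lintegral_lintegral_swap (f := fun x y => {p : Plane × Plane | ‖p.2 - p.1‖ ≤ r}.indicator
    (fun p => u p.2) (x, y)) hum.aemeasurable, ← lintegral_const_mul _ hu]
  congr 1; ext y
  have e2 : ∀ x, {p : Plane × Plane | ‖p.2 - p.1‖ ≤ r}.indicator (fun p => u p.2) (x, y) =
      (Metric.closedBall y r).indicator (fun _ => u y) x := by
    intro x
    simp only [Set.indicator, mem_closedBall_iff_norm, Set.mem_ofPred_eq, norm_sub_rev x y]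
  simp_rw [e2]
  rw [lintegral_indicator Metric.isClosed_closedBall.measurableSet, setLIntegral_const,
    Measure.addHaar_closedBall_center volume y, mul_comm]

/-- Local `L¹`, `L²` and `L^∞` bounds for `u` in terms of the averages of `h` give an `L^q` bound.
The exponents below `2` come from interpolating `L¹` and `L²`, those above from `L²` and `L^∞`. -/
lemma lintegral_rpow_le_of_local {u h : Plane → ℝ≥0∞} (hu : Measurable u) (hh : Measurable h)
    {r : ℝ} {Q A N : ℝ≥0∞} (hr : 0 < r) (hQ : 1 ≤ Q)
    (h1 : ∀ x, ∫⁻ y in Metric.closedBall x r, u y ≤ Q * smear h x)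
    (h2 : ∀ x, ∫⁻ y in Metric.closedBall x r, u y ^ 2 ≤ Q * A * smear h x ^ 2)
    (h3 : ∀ x, ∀ y ∈ Metric.closedBall x r, u y ≤ Q * N * smear h x)
    {q : ℝ} (hq : 1 ≤ q) {Ψ : ℝ≥0∞} (hΨ1 : q ≤ 2 → A ^ (q - 1) ≤ Ψ)
    (hΨ2 : 2 ≤ q → A * N ^ (q - 2) ≤ Ψ) :
    ∫⁻ y, u y ^ q ≤
      (max 1 (volume (Metric.closedBall (0 : Plane) r))⁻¹ * Q * ∫⁻ z, weight z) ^ q * Ψ *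
        ∫⁻ y, h y ^ q := by
  have hq0 : 0 ≤ q := by linarith
  have key : ∀ x, ∫⁻ y in Metric.closedBall x r, u y ^ q ≤ Q ^ q * Ψ * smear h x ^ q := by
    intro x
    set G := smear h x
    rcases le_total q 2 with hq2 | hq2
    · have i1 := ENNReal.lintegral_mul_norm_pow_le
        (μ := volume.restrict (Metric.closedBall x r)) hu.aemeasurable
        (hu.pow_const 2).aemeasurable (p := 2 - q) (q := q - 1) (by linarith) (by linarith)
        (by ring)
      have e : ∀ y, u y ^ (2 - q) * (u y ^ 2) ^ (q - 1) = u y ^ q := fun y => by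
        rw [← ENNReal.rpow_natCast (u y) 2, ← ENNReal.rpow_mul,
          ← ENNReal.rpow_add_of_nonneg _ _ (by linarith)
            (mul_nonneg (Nat.cast_nonneg _) (by linarith))]
        congr 1; push_cast; ring
      simp_rw [e] at i1
      calc _ ≤ _ := i1
        _ ≤ (Q * G) ^ (2 - q) * (Q * A * G ^ 2) ^ (q - 1) := by
            gcongr
            · exact h1 x
            · exact h2 x
        _ = (Q ^ (2 - q) * Q ^ (q - 1)) * A ^ (q - 1) * (G ^ (2 - q) * (G ^ 2) ^ (q - 1)) := by
            rw [ENNReal.mul_rpow_of_nonneg _ _ (by linarith : 0 ≤ 2 - q),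
              ENNReal.mul_rpow_of_nonneg _ _ (by linarith : 0 ≤ q - 1),
              ENNReal.mul_rpow_of_nonneg _ _ (by linarith : 0 ≤ q - 1)]
            ring
        _ = Q ^ (1 : ℝ) * A ^ (q - 1) * G ^ q := by
            rw [← ENNReal.rpow_natCast G 2, ← ENNReal.rpow_mul,
              ← ENNReal.rpow_add_of_nonneg _ _ (by linarith)
                (mul_nonneg (Nat.cast_nonneg _) (by linarith)),
              ← ENNReal.rpow_add_of_nonneg _ _ (by linarith) (by linarith)]
            congr 2
            · congr 2; ring
            · push_cast; ring
        _ ≤ Q ^ q * Ψ * G ^ q := by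
            gcongr
            exact hΨ1 hq2
    · calc ∫⁻ y in Metric.closedBall x r, u y ^ q
          ≤ ∫⁻ y in Metric.closedBall x r, (Q * N * G) ^ (q - 2) * u y ^ 2 := by
            refine setLIntegral_mono ((hu.pow_const 2).const_mul _) fun y hy => ?_
            have e : u y ^ q = u y ^ (q - 2) * u y ^ 2 := by
              rw [← ENNReal.rpow_natCast (u y) 2,
                ← ENNReal.rpow_add_of_nonneg _ _ (by linarith) (by norm_num)]
              congr 1; push_cast; ring
            rw [e]
            gcongr
            exact h3 x y hy
        _ ≤ (Q * N * G) ^ (q - 2) * (Q * A * G ^ 2) := by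
            rw [lintegral_const_mul _ (hu.pow_const 2)]
            gcongr
            exact h2 x
        _ = (Q ^ (q - 2) * Q) * (A * N ^ (q - 2)) * (G ^ (q - 2) * G ^ 2) := by
            rw [ENNReal.mul_rpow_of_nonneg _ _ (by linarith : 0 ≤ q - 2),
              ENNReal.mul_rpow_of_nonneg _ _ (by linarith : 0 ≤ q - 2)]
            ring
        _ = Q ^ (q - 1) * (A * N ^ (q - 2)) * G ^ q := by
            rw [← ENNReal.rpow_natCast G 2,
              ← ENNReal.rpow_add_of_nonneg _ _ (by linarith) (by norm_num)]
            congr 2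
            · conv_lhs => rw [← ENNReal.rpow_one Q, ← ENNReal.rpow_mul, one_mul]
              rw [← ENNReal.rpow_add_of_nonneg _ _ (by linarith) (by norm_num)]
              congr 1; ring
            · push_cast; ring
        _ ≤ Q ^ q * Ψ * G ^ q := by
            gcongr
            · linarith
            · exact hΨ2 hq2
  set V := volume (Metric.closedBall (0 : Plane) r) with hV
  have hV0 : V ≠ 0 := (Metric.measure_closedBall_pos volume 0 hr).ne'
  have hVt : V ≠ ⊤ := measure_closedBall_lt_top.ne
  calc ∫⁻ y, u y ^ q = V⁻¹ * (V * ∫⁻ y, u y ^ q) := by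
        rw [← mul_assoc, ENNReal.inv_mul_cancel hV0 hVt, one_mul]
    _ = V⁻¹ * ∫⁻ x, ∫⁻ y in Metric.closedBall x r, u y ^ q := by
        rw [lintegral_eq_average (hu.pow_const q)]
    _ ≤ V⁻¹ * ∫⁻ x, Q ^ q * Ψ * smear h x ^ q := by
        gcongr with x
        exact key x
    _ = V⁻¹ * (Q ^ q * Ψ * ∫⁻ x, smear h x ^ q) := by
        rw [lintegral_const_mul _ ((measurable_smear hh).pow_const q)]
    _ ≤ max 1 V⁻¹ ^ q * (Q ^ q * Ψ * ((∫⁻ z, weight z) ^ q * ∫⁻ y, h y ^ q)) := by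
        gcongr
        · calc V⁻¹ ≤ max 1 V⁻¹ := le_max_right _ _
            _ = max 1 V⁻¹ ^ (1 : ℝ) := by simp
            _ ≤ max 1 V⁻¹ ^ q := ENNReal.rpow_le_rpow_of_exponent_le (le_max_left _ _) hq
        · exact lintegral_smear_rpow_le hh hq
    _ = _ := by
        rw [ENNReal.mul_rpow_of_nonneg _ _ hq0, ENNReal.mul_rpow_of_nonneg _ _ hq0]
        ring

/-- The sum of a subfamily of Schwartz functions. -/
noncomputable def capSum {ι : Type*} (J : Finset ι) (g : ι → 𝓢(Plane, ℂ)) : 𝓢(Plane, ℂ) :=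
  ∑ i ∈ J, g i

lemma capSum_apply {ι : Type*} (J : Finset ι) (g : ι → 𝓢(Plane, ℂ)) (x : Plane) :
    capSum J g x = ∑ i ∈ J, g i x := by
  simp [capSum]

lemma exists_of_fourier_capSum_ne_zero {ι : Type*} {J : Finset ι} {g : ι → 𝓢(Plane, ℂ)}
    {ξ : Plane} (h : 𝓕 (capSum J g) ξ ≠ 0) : ∃ i ∈ J, 𝓕 (g i) ξ ≠ 0 := by
  have e : 𝓕 (capSum J g) = ∑ i ∈ J, 𝓕 (g i) := map_sum (fourierCLM ℂ 𝓢(Plane, ℂ)) g J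
  by_contra! hc
  apply h
  rw [e]
  simpa using Finset.sum_eq_zero hc

lemma enorm_capSum_sq_le {ι : Type*} {J I : Finset ι} (hJ : J ⊆ I) (g : ι → 𝓢(Plane, ℂ))
    (x : Plane) : ‖capSum J g x‖ₑ ^ 2 ≤ (J.card : ℝ≥0∞) * sqSum I g x := by
  rw [capSum_apply]
  exact (enorm_sum_sq_le J _ J.card (Finset.card_filter_le _ _)).trans
    (by gcongr; exact sqSum_mono hJ g x)

section Local

variable {φ : 𝓢(Plane, ℂ)} {r : ℝ} {κ : ℝ≥0∞}
variable {ι : Type*} {I J₁ J₂ : Finset ι} {g : ι → 𝓢(Plane, ℂ)} {θ : ι → Plane} {L : ℝ}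

lemma IsCutoff.lintegral_capSum_sq_le (hφ : IsCutoff φ r κ) {D : ℕ} {J : Finset ι} (hJ : J ⊆ I)
    (hg : ∀ i ∈ I, ∀ ξ, 𝓕 (g i) ξ ≠ 0 → ‖ξ - θ i‖ ≤ L)
    (hD : ∀ ξ, (I.filter fun i => ‖ξ - θ i‖ ≤ L + 1).card ≤ D) (x : Plane) :
    ∫⁻ y, ‖capSum J g y‖ₑ ^ 2 * ‖φ (y - x)‖ₑ ^ 2 ≤
      D * ∫⁻ y, sqSum J g y * ‖φ (y - x)‖ₑ ^ 2 := by
  simp_rw [capSum_apply]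
  exact hφ.lintegral_sum_sq_le (fun i hi => hg i (hJ hi))
    (fun ξ => (Finset.card_le_card (Finset.filter_subset_filter _ hJ)).trans (hD ξ)) x

open Classical in
/-- Bilinear local `L⁴` estimate. The families `J₁`, `J₂` are grouped into blocks by `β`; if the
sumsets of Fourier supports of pairs of blocks overlap at most `D₂` times, then the products of
blocks are almost orthogonal. One factor is then bounded by Cauchy–Schwarz within each block, the
other by local `L²` orthogonality. -/
lemma IsCutoff.lintegral_bilinear_le (hφ : IsCutoff φ r κ) {D₁ D₂ : ℕ} {A : ℝ≥0∞} (β : ι → ℤ)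
    (hJ₁ : J₁ ⊆ I) (hJ₂ : J₂ ⊆ I)
    (hg : ∀ i ∈ I, ∀ ξ, 𝓕 (g i) ξ ≠ 0 → ‖ξ - θ i‖ ≤ L)
    (hA : ∀ b, ((I.filter fun i => β i = b).card : ℝ≥0∞) ≤ A)
    (hD₁ : ∀ ξ, (I.filter fun i => ‖ξ - θ i‖ ≤ L + 1).card ≤ D₁)
    (hD₂ : ∀ ξ, ((J₁.image β ×ˢ J₂.image β).filter fun b => ∃ i ∈ J₁, ∃ j ∈ J₂,
      β i = b.1 ∧ β j = b.2 ∧ ‖ξ - (θ i + θ j)‖ ≤ 2 * (L + 1)).card ≤ D₂) (x : Plane) :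
    ∫⁻ y, (‖capSum J₁ g y‖ₑ * ‖capSum J₂ g y‖ₑ) ^ 2 * ‖φ (y - x)‖ₑ ^ 4 ≤
      D₂ * (A * D₁ * (volume (Metric.closedBall (0 : Plane) (L + 1)) * κ ^ 3)) *
        smear (sqSum I g) x ^ 2 := by
  set G := smear (sqSum I g) x with hG
  set V := volume (Metric.closedBall (0 : Plane) (L + 1))
  let B₁ : ℤ → Finset ι := fun b => J₁.filter fun i => β i = b
  let B₂ : ℤ → Finset ι := fun b => J₂.filter fun i => β i = b
  let F : ℤ × ℤ → 𝓢(Plane, ℂ) := fun b =>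
    schwartzMul (schwartzMul (capSum (B₁ b.1) g) (translate φ x))
      (schwartzMul (capSum (B₂ b.2) g) (translate φ x))
  have hs₁ : ∀ y, ∑ b ∈ J₁.image β, capSum (B₁ b) g y = capSum J₁ g y := fun y => by
    simp_rw [capSum_apply, B₁]
    exact Finset.sum_fiberwise_of_maps_to (fun i hi => Finset.mem_image_of_mem β hi) _
  have hs₂ : ∀ y, ∑ b ∈ J₂.image β, capSum (B₂ b) g y = capSum J₂ g y := fun y => by
    simp_rw [capSum_apply, B₂]
    exact Finset.sum_fiberwise_of_maps_to (fun i hi => Finset.mem_image_of_mem β hi) _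
  have hsum : ∀ y, ∑ b ∈ J₁.image β ×ˢ J₂.image β, F b y =
      capSum J₁ g y * capSum J₂ g y * φ (y - x) ^ 2 := fun y => by
    rw [← hs₁, ← hs₂, Finset.sum_mul_sum, ← Finset.sum_product', Finset.sum_mul]
    refine Finset.sum_congr rfl fun b _ => ?_
    simp only [F, schwartzMul_apply, translate_apply]
    ring
  have horth := lintegral_enorm_sq_sum_le (J₁.image β ×ˢ J₂.image β) F D₂ (fun ξ => by
    refine (Finset.card_le_card ?_).trans (hD₂ ξ)
    intro b hb
    rw [Finset.mem_filter] at hb ⊢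
    refine ⟨hb.1, ?_⟩
    obtain ⟨t, h1, h2⟩ := exists_of_fourier_schwartzMul_ne_zero hb.2
    obtain ⟨t₁, h3, h4⟩ := hφ.exists_near h1
    obtain ⟨t₂, h5, h6⟩ := hφ.exists_near h2
    obtain ⟨i, hi, hi'⟩ := exists_of_fourier_capSum_ne_zero h3
    obtain ⟨j, hj, hj'⟩ := exists_of_fourier_capSum_ne_zero h5
    rw [Finset.mem_filter] at hi hj
    refine ⟨i, hi.1, j, hj.1, hi.2, hj.2, ?_⟩
    have h7 := hg i (hJ₁ hi.1) _ hi'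
    have h8 := hg j (hJ₂ hj.1) _ hj'
    calc ‖ξ - (θ i + θ j)‖ = ‖((t - t₁) + (t₁ - θ i)) + ((ξ - t - t₂) + (t₂ - θ j))‖ := by
          congr 1; abel
      _ ≤ (1 + L) + (1 + L) := (norm_add_le _ _).trans (add_le_add
          ((norm_add_le _ _).trans (add_le_add h4 h7))
          ((norm_add_le _ _).trans (add_le_add h6 h8)))
      _ = _ := by ring)
  have hblock : ∀ y, (∑ b ∈ J₁.image β, ‖capSum (B₁ b) g y‖ₑ ^ 2) * ‖φ (y - x)‖ₑ ^ 2 ≤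
      A * (V * κ ^ 2) * G := fun y => by
    have h1 : ∑ b ∈ J₁.image β, ‖capSum (B₁ b) g y‖ₑ ^ 2 ≤ A * sqSum I g y := by
      calc _ ≤ ∑ b ∈ J₁.image β, A * sqSum (B₁ b) g y := by
            refine Finset.sum_le_sum fun b _ => ?_
            refine (enorm_capSum_sq_le le_rfl g y).trans ?_
            gcongr
            refine le_trans ?_ (hA b)
            exact_mod_cast Finset.card_le_card (Finset.filter_subset_filter _ hJ₁)
        _ = A * sqSum J₁ g y := by
            rw [← Finset.mul_sum]
            congr 1
            exact Finset.sum_fiberwise_of_maps_to (fun i hi => Finset.mem_image_of_mem β hi) _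
        _ ≤ _ := by gcongr; exact sqSum_mono hJ₁ g y
    calc _ ≤ A * sqSum I g y * (κ * weight (y - x)) := by
          gcongr
          exact hφ.decay _
      _ = A * κ * (sqSum I g y * weight (y - x)) := by ring
      _ ≤ A * κ * (V * κ * G) := mul_le_mul_right (hφ.sqSum_mul_weight_le hg x y) _
      _ = _ := by ring
  have hφm : Measurable fun y => ‖φ (y - x)‖ₑ ^ 2 :=
    (((measurable_enorm_schwartz φ).comp (measurable_id.sub_const x)).pow_const _)
  have hl2 : ∫⁻ y, (∑ b ∈ J₂.image β, ‖capSum (B₂ b) g y‖ₑ ^ 2) * ‖φ (y - x)‖ₑ ^ 2 ≤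
      D₁ * (κ * G) := by
    calc _ = ∑ b ∈ J₂.image β, ∫⁻ y, ‖capSum (B₂ b) g y‖ₑ ^ 2 * ‖φ (y - x)‖ₑ ^ 2 := by
          rw [← lintegral_finsetSum]
          · simp_rw [Finset.sum_mul]
          · exact fun b _ => ((measurable_enorm_schwartz _).pow_const _).mul hφm
      _ ≤ ∑ b ∈ J₂.image β, D₁ * ∫⁻ y, sqSum (B₂ b) g y * ‖φ (y - x)‖ₑ ^ 2 :=
          Finset.sum_le_sum fun b _ => hφ.lintegral_capSum_sq_le
            ((Finset.filter_subset _ _).trans hJ₂) hg hD₁ x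
      _ = D₁ * ∫⁻ y, sqSum J₂ g y * ‖φ (y - x)‖ₑ ^ 2 := by
          rw [← Finset.mul_sum, ← lintegral_finsetSum]
          · congr 2; ext y
            rw [← Finset.sum_mul]
            congr 1
            exact Finset.sum_fiberwise_of_maps_to (fun i hi => Finset.mem_image_of_mem β hi) _
          · exact fun b _ => (measurable_sqSum _ _).mul hφm
      _ ≤ D₁ * (κ * G) := by
          gcongr
          exact (hφ.lintegral_sqSum_mul_le J₂ x).trans
            (by gcongr; exact smear_mono (sqSum_mono hJ₂ g) x)
  have e1 : ∀ y, (‖capSum J₁ g y‖ₑ * ‖capSum J₂ g y‖ₑ) ^ 2 * ‖φ (y - x)‖ₑ ^ 4 =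
      ‖∑ b ∈ J₁.image β ×ˢ J₂.image β, F b y‖ₑ ^ 2 := fun y => by
    rw [hsum, enorm_mul, enorm_mul, enorm_pow]; ring
  have e2 : ∑ b ∈ J₁.image β ×ˢ J₂.image β, ∫⁻ y, ‖F b y‖ₑ ^ 2 =
      ∫⁻ y, ((∑ b ∈ J₁.image β, ‖capSum (B₁ b) g y‖ₑ ^ 2) * ‖φ (y - x)‖ₑ ^ 2) *
        ((∑ b ∈ J₂.image β, ‖capSum (B₂ b) g y‖ₑ ^ 2) * ‖φ (y - x)‖ₑ ^ 2) := by
    rw [← lintegral_finsetSum]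
    · congr 1; ext y
      rw [mul_mul_mul_comm, Finset.sum_mul_sum, ← Finset.sum_product', Finset.sum_mul]
      refine Finset.sum_congr rfl fun b _ => ?_
      simp only [F, schwartzMul_apply, translate_apply, enorm_mul]
      ring
    · exact fun b _ => (measurable_enorm_schwartz _).pow_const _
  simp_rw [e1]
  refine horth.trans ?_
  rw [e2]
  calc _ ≤ (D₂ : ℝ≥0∞) * ∫⁻ y, (A * (V * κ ^ 2) * G) *
        ((∑ b ∈ J₂.image β, ‖capSum (B₂ b) g y‖ₑ ^ 2) * ‖φ (y - x)‖ₑ ^ 2) := by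
        refine mul_le_mul_right (lintegral_mono fun y => ?_) _
        exact mul_le_mul_left (hblock y) _
    _ ≤ D₂ * ((A * (V * κ ^ 2) * G) * (D₁ * (κ * G))) := by
        rw [lintegral_const_mul]
        · gcongr
        · exact (Finset.measurable_fun_sum _
            fun _ _ => (measurable_enorm_schwartz _).pow_const _).mul hφm
    _ = _ := by ring

end Local

lemma mul_le_sq_add_sq (a b : ℝ≥0∞) : a * b ≤ a ^ 2 + b ^ 2 := by
  rcases le_total a b with h | h
  · calc a * b ≤ b * b := by gcongr
      _ = b ^ 2 := by ring
      _ ≤ _ := le_add_self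
  · calc a * b ≤ a * a := by gcongr
      _ = a ^ 2 := by ring
      _ ≤ _ := le_self_add

section Local

variable {φ : 𝓢(Plane, ℂ)} {r : ℝ} {κ : ℝ≥0∞}
variable {ι : Type*} {I : Finset ι} {g : ι → 𝓢(Plane, ℂ)} {θ : ι → Plane} {L : ℝ}

lemma IsCutoff.one_le_of_mem (hφ : IsCutoff φ r κ) {x y : Plane}
    (hy : y ∈ Metric.closedBall x r) : 1 ≤ ‖φ (y - x)‖ₑ :=
  hφ.one_le _ (by rwa [mem_closedBall_iff_norm] at hy)

lemma IsCutoff.setLIntegral_le (hφ : IsCutoff φ r κ) (u : Plane → ℝ≥0∞) (x : Plane) (k : ℕ) :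
    ∫⁻ y in Metric.closedBall x r, u y ≤ ∫⁻ y, u y * ‖φ (y - x)‖ₑ ^ k := by
  rw [← lintegral_indicator Metric.isClosed_closedBall.measurableSet]
  refine lintegral_mono fun y => ?_
  by_cases hy : y ∈ Metric.closedBall x r
  · simp only [Set.indicator_of_mem hy]
    exact le_mul_of_one_le_right' (one_le_pow_of_one_le' (hφ.one_le_of_mem hy) k)
  · simp [Set.indicator_of_notMem hy]

lemma IsCutoff.sqSum_le (hφ : IsCutoff φ r κ)
    (hg : ∀ i ∈ I, ∀ ξ, 𝓕 (g i) ξ ≠ 0 → ‖ξ - θ i‖ ≤ L) {x y : Plane}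
    (hy : y ∈ Metric.closedBall x r) :
    sqSum I g y ≤ ENNReal.ofReal ((1 + r) ^ 4) *
      (volume (Metric.closedBall (0 : Plane) (L + 1)) * κ) * smear (sqSum I g) x := by
  have hr := hφ.radius_pos
  have h1 : 1 ≤ ENNReal.ofReal ((1 + r) ^ 4) * weight (y - x) := by
    rw [weight, ← ENNReal.ofReal_mul (by positivity), ENNReal.one_le_ofReal,
      ← div_eq_mul_inv, one_le_div (by positivity)]
    rw [mem_closedBall_iff_norm] at hy
    gcongr
  calc sqSum I g y ≤ sqSum I g y * (ENNReal.ofReal ((1 + r) ^ 4) * weight (y - x)) :=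
        le_mul_of_one_le_right' h1
    _ = ENNReal.ofReal ((1 + r) ^ 4) * (sqSum I g y * weight (y - x)) := by ring
    _ ≤ ENNReal.ofReal ((1 + r) ^ 4) * (volume (Metric.closedBall (0 : Plane) (L + 1)) * κ *
          smear (sqSum I g) x) := mul_le_mul_right (hφ.sqSum_mul_weight_le hg x y) _
    _ = _ := by ring

lemma IsCutoff.setLIntegral_capSum_le (hφ : IsCutoff φ r κ) {D : ℕ} {J : Finset ι} (hJ : J ⊆ I)
    (hg : ∀ i ∈ I, ∀ ξ, 𝓕 (g i) ξ ≠ 0 → ‖ξ - θ i‖ ≤ L)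
    (hD : ∀ ξ, (I.filter fun i => ‖ξ - θ i‖ ≤ L + 1).card ≤ D) (x : Plane) :
    ∫⁻ y in Metric.closedBall x r, ‖capSum J g y‖ₑ ^ 2 ≤ D * κ * smear (sqSum I g) x := by
  calc _ ≤ _ := hφ.setLIntegral_le _ x 2
    _ ≤ _ := hφ.lintegral_capSum_sq_le hJ hg hD x
    _ ≤ D * (κ * smear (sqSum I g) x) := by
        gcongr
        exact (hφ.lintegral_sqSum_mul_le J x).trans
          (by gcongr; exact smear_mono (sqSum_mono hJ g) x)
    _ = _ := by ring

end Local

lemma volume_closedBall_ne_top (L : ℝ) : volume (Metric.closedBall (0 : Plane) L) ≠ ⊤ :=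
  measure_closedBall_lt_top.ne

open Classical in
/-- The bilinear estimate at unit scale. `A` bounds the size of the blocks and `N` that of the
whole family. -/
lemma exists_bilinear_unit_scale (L : ℝ) : ∃ C : ℝ≥0∞, C ≠ ⊤ ∧ 1 ≤ C ∧
    ∀ {ι : Type} (I J₁ J₂ : Finset ι) (g : ι → 𝓢(Plane, ℂ)) (θ : ι → Plane) (β : ι → ℤ)
      (D₁ D₂ : ℕ) (A N : ℝ≥0∞), 1 ≤ D₁ → 1 ≤ D₂ → J₁ ⊆ I → J₂ ⊆ I →
      (∀ i ∈ I, ∀ ξ, 𝓕 (g i) ξ ≠ 0 → ‖ξ - θ i‖ ≤ L) →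
      (I.card : ℝ≥0∞) ≤ N →
      (∀ b, ((I.filter fun i => β i = b).card : ℝ≥0∞) ≤ A) →
      (∀ ξ, (I.filter fun i => ‖ξ - θ i‖ ≤ L + 1).card ≤ D₁) →
      (∀ ξ, ((J₁.image β ×ˢ J₂.image β).filter fun b => ∃ i ∈ J₁, ∃ j ∈ J₂,
        β i = b.1 ∧ β j = b.2 ∧ ‖ξ - (θ i + θ j)‖ ≤ 2 * (L + 1)).card ≤ D₂) →
      ∀ (q : ℝ) (Ψ : ℝ≥0∞), 1 ≤ q → (q ≤ 2 → A ^ (q - 1) ≤ Ψ) → (2 ≤ q → A * N ^ (q - 2) ≤ Ψ) →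
      ∫⁻ y, (‖capSum J₁ g y‖ₑ * ‖capSum J₂ g y‖ₑ) ^ q ≤
        (C * (D₁ * D₂)) ^ q * Ψ * ∫⁻ y, sqSum I g y ^ q := by
  obtain ⟨φ, r, κ, hφ⟩ := exists_isCutoff
  set V := volume (Metric.closedBall (0 : Plane) (L + 1))
  set W := ENNReal.ofReal ((1 + r) ^ 4)
  set C₀ : ℝ≥0∞ := 1 + 2 * κ + V * κ ^ 3 + 2 * (W * (V * κ)) with hC₀
  have hκ := hφ.const_ne_top
  have hV : V ≠ ⊤ := volume_closedBall_ne_top _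
  have hC₀t : C₀ ≠ ⊤ := by
    have : W ≠ ⊤ := ENNReal.ofReal_ne_top
    simp [hC₀, ENNReal.mul_eq_top, hκ, hV, this]
  have hball : volume (Metric.closedBall (0 : Plane) r) ≠ 0 :=
    (Metric.measure_closedBall_pos volume 0 hφ.radius_pos).ne'
  refine ⟨max 1 ((max 1 (volume (Metric.closedBall (0 : Plane) r))⁻¹) * C₀ * ∫⁻ z, weight z),
    ?_, le_max_left _ _, ?_⟩
  · exact (max_lt ENNReal.one_lt_top (ENNReal.mul_lt_top (ENNReal.mul_lt_top
      (max_lt ENNReal.one_lt_top (ENNReal.inv_lt_top.2 hball.bot_lt)) hC₀t.lt_top)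
      lintegral_weight_ne_top.lt_top)).ne
  intro ι I J₁ J₂ g θ β D₁ D₂ A N hD₁1 hD₂1 hJ₁ hJ₂ hg hN hA hD₁ hD₂ q Ψ hq hΨ1 hΨ2
  have hD₁' : (1 : ℝ≥0∞) ≤ D₁ := by exact_mod_cast hD₁1
  have hD₂' : (1 : ℝ≥0∞) ≤ D₂ := by exact_mod_cast hD₂1
  set DD : ℝ≥0∞ := (D₁ : ℝ≥0∞) * D₂ with hDD
  have hDD1 : 1 ≤ DD := one_le_mul hD₁' hD₂'
  have hDDl : (D₁ : ℝ≥0∞) ≤ DD := le_mul_of_one_le_right' hD₂'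
  have main := lintegral_rpow_le_of_local (u := fun y => ‖capSum J₁ g y‖ₑ * ‖capSum J₂ g y‖ₑ)
    (h := sqSum I g) (Q := C₀ * DD) (A := A) (N := N)
    ((measurable_enorm_schwartz _).mul (measurable_enorm_schwartz _)) (measurable_sqSum I g)
    hφ.radius_pos (one_le_mul (by rw [hC₀, add_assoc, add_assoc]; exact le_self_add) hDD1)
    (fun x => ?_) (fun x => ?_) (fun x y hy => ?_) hq hΨ1 hΨ2
  · have hC : max 1 (volume (Metric.closedBall (0 : Plane) r))⁻¹ * (C₀ * DD) * ∫⁻ z, weight z ≤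
        max 1 (max 1 (volume (Metric.closedBall (0 : Plane) r))⁻¹ * C₀ * ∫⁻ z, weight z) * DD := by
      calc _ = (max 1 (volume (Metric.closedBall (0 : Plane) r))⁻¹ * C₀ * ∫⁻ z, weight z) * DD := by
            ring
        _ ≤ _ := mul_le_mul_left (le_max_right _ _) _
    exact main.trans (mul_le_mul_left (mul_le_mul_left
      (ENNReal.rpow_le_rpow hC (by linarith)) _) _)
  · calc ∫⁻ y in Metric.closedBall x r, ‖capSum J₁ g y‖ₑ * ‖capSum J₂ g y‖ₑ
        ≤ ∫⁻ y in Metric.closedBall x r, (‖capSum J₁ g y‖ₑ ^ 2 + ‖capSum J₂ g y‖ₑ ^ 2) :=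
          lintegral_mono fun y => mul_le_sq_add_sq _ _
      _ ≤ D₁ * κ * smear (sqSum I g) x + D₁ * κ * smear (sqSum I g) x := by
          rw [lintegral_add_left ((measurable_enorm_schwartz _).pow_const _)]
          exact add_le_add (hφ.setLIntegral_capSum_le hJ₁ hg hD₁ x)
            (hφ.setLIntegral_capSum_le hJ₂ hg hD₁ x)
      _ = (2 * κ) * D₁ * smear (sqSum I g) x := by ring
      _ ≤ _ := by
          gcongr
          calc 2 * κ ≤ 1 + 2 * κ := le_add_self
            _ ≤ _ := by rw [hC₀, add_assoc _ (V * κ ^ 3)]; exact le_self_add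
  · calc ∫⁻ y in Metric.closedBall x r, (‖capSum J₁ g y‖ₑ * ‖capSum J₂ g y‖ₑ) ^ 2 ≤ _ :=
          hφ.setLIntegral_le _ x 4
      _ ≤ _ := hφ.lintegral_bilinear_le β hJ₁ hJ₂ hg hA hD₁ hD₂ x
      _ = (V * κ ^ 3) * DD * A * smear (sqSum I g) x ^ 2 := by rw [hDD]; ring
      _ ≤ _ := by
          gcongr
          calc V * κ ^ 3 ≤ (1 + 2 * κ) + V * κ ^ 3 := le_add_self
            _ ≤ _ := by rw [hC₀]; exact le_self_add
  · have h1 : ∀ J ⊆ I, ‖capSum J g y‖ₑ ^ 2 ≤ N * sqSum I g y := fun J hJ =>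
      (enorm_capSum_sq_le hJ g y).trans (by
        gcongr
        refine le_trans ?_ hN
        exact_mod_cast Finset.card_le_card hJ)
    calc ‖capSum J₁ g y‖ₑ * ‖capSum J₂ g y‖ₑ
        ≤ N * sqSum I g y + N * sqSum I g y :=
          (mul_le_sq_add_sq _ _).trans (add_le_add (h1 J₁ hJ₁) (h1 J₂ hJ₂))
      _ = 2 * N * sqSum I g y := by ring
      _ ≤ 2 * N * (W * (V * κ) * smear (sqSum I g) x) := mul_le_mul_right (hφ.sqSum_le hg hy) _
      _ = (2 * (W * (V * κ))) * 1 * N * smear (sqSum I g) x := by ring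
      _ ≤ _ := by
          gcongr
          exact le_add_self

/-- The linear estimate at unit scale: Cauchy–Schwarz for the supremum, and orthogonality. -/
lemma exists_linear_unit_scale (L : ℝ) : ∃ C : ℝ≥0∞, C ≠ ⊤ ∧ 1 ≤ C ∧
    ∀ {ι : Type} (I : Finset ι) (g : ι → 𝓢(Plane, ℂ)) (θ : ι → Plane)
      (D₁ : ℕ) (N : ℝ≥0∞), 1 ≤ D₁ →
      (∀ i ∈ I, ∀ ξ, 𝓕 (g i) ξ ≠ 0 → ‖ξ - θ i‖ ≤ L) →
      (I.card : ℝ≥0∞) ≤ N →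
      (∀ ξ, (I.filter fun i => ‖ξ - θ i‖ ≤ L + 1).card ≤ D₁) →
      ∀ q : ℝ, 1 ≤ q →
      ∫⁻ y, (‖capSum I g y‖ₑ ^ 2) ^ q ≤ (C * D₁) ^ q * N ^ (q - 1) * ∫⁻ y, sqSum I g y ^ q := by
  obtain ⟨φ, r, κ, hφ⟩ := exists_isCutoff
  set V := volume (Metric.closedBall (0 : Plane) (L + 1))
  set W := ENNReal.ofReal ((1 + r) ^ 4)
  set C₀ : ℝ≥0∞ := (1 + κ) * (1 + W * (V * κ)) with hC₀
  have hκ := hφ.const_ne_top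
  have hV : V ≠ ⊤ := volume_closedBall_ne_top _
  have hC₀t : C₀ ≠ ⊤ := by
    have : W ≠ ⊤ := ENNReal.ofReal_ne_top
    simp [hC₀, ENNReal.mul_eq_top, hκ, hV, this]
  have hball : volume (Metric.closedBall (0 : Plane) r) ≠ 0 :=
    (Metric.measure_closedBall_pos volume 0 hφ.radius_pos).ne'
  refine ⟨max 1 ((max 1 (volume (Metric.closedBall (0 : Plane) r))⁻¹) * C₀ * ∫⁻ z, weight z),
    ?_, le_max_left _ _, ?_⟩
  · exact (max_lt ENNReal.one_lt_top (ENNReal.mul_lt_top (ENNReal.mul_lt_top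
      (max_lt ENNReal.one_lt_top (ENNReal.inv_lt_top.2 hball.bot_lt)) hC₀t.lt_top)
      lintegral_weight_ne_top.lt_top)).ne
  intro ι I g θ D₁ N hD₁1 hg hN hD₁ q hq
  have hD₁' : (1 : ℝ≥0∞) ≤ D₁ := by exact_mod_cast hD₁1
  have hl1 : ∀ x, ∫⁻ y in Metric.closedBall x r, ‖capSum I g y‖ₑ ^ 2 ≤
      D₁ * κ * smear (sqSum I g) x := fun x => hφ.setLIntegral_capSum_le le_rfl hg hD₁ x
  have hsup : ∀ x, ∀ y ∈ Metric.closedBall x r, ‖capSum I g y‖ₑ ^ 2 ≤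
      W * (V * κ) * N * smear (sqSum I g) x := fun x y hy => by
    calc ‖capSum I g y‖ₑ ^ 2 ≤ N * sqSum I g y :=
          (enorm_capSum_sq_le le_rfl g y).trans (by gcongr)
      _ ≤ N * (W * (V * κ) * smear (sqSum I g) x) := mul_le_mul_right (hφ.sqSum_le hg hy) _
      _ = _ := by ring
  have main := lintegral_rpow_le_of_local (u := fun y => ‖capSum I g y‖ₑ ^ 2)
    (h := sqSum I g) (Q := C₀ * D₁) (A := N) (N := N) (Ψ := N ^ (q - 1))
    ((measurable_enorm_schwartz _).pow_const _) (measurable_sqSum I g)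
    hφ.radius_pos (one_le_mul (one_le_mul le_self_add le_self_add) hD₁')
    (fun x => ?_) (fun x => ?_) (fun x y hy => ?_) hq (fun _ => le_rfl) (fun h2 => ?_)
  · have hC : max 1 (volume (Metric.closedBall (0 : Plane) r))⁻¹ * (C₀ * D₁) * ∫⁻ z, weight z ≤
        max 1 (max 1 (volume (Metric.closedBall (0 : Plane) r))⁻¹ * C₀ * ∫⁻ z, weight z) * D₁ := by
      calc _ = (max 1 (volume (Metric.closedBall (0 : Plane) r))⁻¹ * C₀ * ∫⁻ z, weight z) * D₁ := by
            ring
        _ ≤ _ := mul_le_mul_left (le_max_right _ _) _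
    exact main.trans (mul_le_mul_left (mul_le_mul_left
      (ENNReal.rpow_le_rpow hC (by linarith)) _) _)
  · calc _ ≤ _ := hl1 x
      _ = κ * 1 * D₁ * smear (sqSum I g) x := by ring
      _ ≤ _ := by
          gcongr
          exact mul_le_mul' le_add_self le_self_add
  · calc ∫⁻ y in Metric.closedBall x r, (‖capSum I g y‖ₑ ^ 2) ^ 2
        ≤ ∫⁻ y in Metric.closedBall x r,
            (W * (V * κ) * N * smear (sqSum I g) x) * ‖capSum I g y‖ₑ ^ 2 := by
          refine setLIntegral_mono
            (((measurable_enorm_schwartz _).pow_const _).const_mul _) fun y hy => ?_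
          rw [sq (‖capSum I g y‖ₑ ^ 2)]
          exact mul_le_mul_left (hsup x y hy) _
      _ ≤ (W * (V * κ) * N * smear (sqSum I g) x) * (D₁ * κ * smear (sqSum I g) x) := by
          rw [lintegral_const_mul _ ((measurable_enorm_schwartz _).pow_const _)]
          exact mul_le_mul_right (hl1 x) _
      _ = κ * (W * (V * κ)) * D₁ * N * smear (sqSum I g) x ^ 2 := by ring
      _ ≤ _ := by
          gcongr
          exact mul_le_mul' le_add_self le_add_self
  · calc _ ≤ _ := hsup x y hy
      _ = 1 * (W * (V * κ)) * 1 * N * smear (sqSum I g) x := by ring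
      _ ≤ _ := by
          refine mul_le_mul_left (mul_le_mul_left ?_ _) _
          exact mul_le_mul' (mul_le_mul' le_self_add le_add_self) hD₁'
  · conv_lhs => rw [← ENNReal.rpow_one N, ← ENNReal.rpow_mul, one_mul]
    rw [← ENNReal.rpow_add_of_nonneg _ _ zero_le_one (by linarith)]
    apply le_of_eq; congr 1; ring

/-! ### Parabolic rescaling -/

section Rescale

variable (A T : Plane ≃L[ℝ] Plane)

/-- The composition of a Schwartz function with an invertible linear map. -/
noncomputable def schwartzComp (f : 𝓢(Plane, ℂ)) : 𝓢(Plane, ℂ) :=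
  compCLMOfContinuousLinearEquiv ℂ A f

@[simp] lemma schwartzComp_apply (f : 𝓢(Plane, ℂ)) (x : Plane) :
    schwartzComp A f x = f (A x) := rfl

lemma exists_map_volume_eq : ∃ c : ℝ≥0∞, c ≠ 0 ∧ c ≠ ⊤ ∧
    Measure.map A (volume : Measure Plane) = c • volume := by
  have h : LinearMap.det (A : Plane →ₗ[ℝ] Plane) ≠ 0 :=
    (LinearEquiv.isUnit_det' A.toLinearEquiv).ne_zero
  refine ⟨ENNReal.ofReal |(LinearMap.det (A : Plane →ₗ[ℝ] Plane))⁻¹|, ?_, ENNReal.ofReal_ne_top, ?_⟩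
  · simpa using h
  · exact Measure.map_linearMap_addHaar_eq_smul_addHaar volume h

lemma exists_lintegral_comp_eq : ∃ c : ℝ≥0∞, c ≠ 0 ∧ c ≠ ⊤ ∧
    ∀ h : Plane → ℝ≥0∞, ∫⁻ x, h (A x) = c * ∫⁻ x, h x := by
  obtain ⟨c, h0, ht, hc⟩ := exists_map_volume_eq A
  refine ⟨c, h0, ht, fun h => ?_⟩
  have := lintegral_map_equiv (μ := (volume : Measure Plane)) h A.toHomeomorph.toMeasurableEquiv
  rw [← smul_eq_mul, ← lintegral_smul_measure, ← hc]
  exact this.symm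

variable {A T}

/-- The transpose `T` of a linear map `A` transports Fourier supports under composition with `A`. -/
lemma fourier_schwartzComp_ne_zero (hAT : ∀ x ξ, inner ℝ (A x) ξ = inner ℝ x (T ξ))
    {f : 𝓢(Plane, ℂ)} {η : Plane} (h : 𝓕 (schwartzComp A f) η ≠ 0) : 𝓕 f (T.symm η) ≠ 0 := by
  obtain ⟨c, -, -, hc⟩ := exists_map_volume_eq A
  intro h0
  apply h
  rw [fourier_coe, Real.fourier_eq] at h0 ⊢
  have e : ∀ x, Real.fourierChar (-inner ℝ x η) • schwartzComp A f x =
      (fun y => Real.fourierChar (-inner ℝ y (T.symm η)) • f y) (A x) := fun x => by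
    simp [hAT]
  simp_rw [e]
  have := integral_map_equiv (μ := (volume : Measure Plane)) A.toHomeomorph.toMeasurableEquiv
    (fun y => Real.fourierChar (-inner ℝ y (T.symm η)) • f y)
  have h2 : (Measure.map A.toHomeomorph.toMeasurableEquiv (volume : Measure Plane)) =
    c • volume := hc
  rw [h2, integral_smul_measure, h0, smul_zero] at this
  exact this.symm

lemma capSum_schwartzComp {ι : Type*} (J : Finset ι) (f : ι → 𝓢(Plane, ℂ)) (x : Plane) :
    capSum J (fun i => schwartzComp A (f i)) x = capSum J f (A x) := by
  simp [capSum_apply]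

lemma sqSum_schwartzComp {ι : Type*} (J : Finset ι) (f : ι → 𝓢(Plane, ℂ)) (x : Plane) :
    sqSum J (fun i => schwartzComp A (f i)) x = sqSum J f (A x) := by
  simp [sqSum]

open Classical in
/-- The bilinear estimate for Fourier supports that a linear map `T` brings to unit scale. -/
lemma exists_bilinear (L : ℝ) : ∃ C : ℝ≥0∞, C ≠ ⊤ ∧ 1 ≤ C ∧
    ∀ (A T : Plane ≃L[ℝ] Plane), (∀ x ξ, inner ℝ (A x) ξ = inner ℝ x (T ξ)) →
    ∀ {ι : Type} (I J₁ J₂ : Finset ι) (f : ι → 𝓢(Plane, ℂ)) (θ : ι → Plane) (β : ι → ℤ)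
      (D₁ D₂ : ℕ) (a N : ℝ≥0∞), 1 ≤ D₁ → 1 ≤ D₂ → J₁ ⊆ I → J₂ ⊆ I →
      (∀ i ∈ I, ∀ ξ, 𝓕 (f i) ξ ≠ 0 → ‖T ξ - θ i‖ ≤ L) →
      (I.card : ℝ≥0∞) ≤ N →
      (∀ b, ((I.filter fun i => β i = b).card : ℝ≥0∞) ≤ a) →
      (∀ ξ, (I.filter fun i => ‖ξ - θ i‖ ≤ L + 1).card ≤ D₁) →
      (∀ ξ, ((J₁.image β ×ˢ J₂.image β).filter fun b => ∃ i ∈ J₁, ∃ j ∈ J₂,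
        β i = b.1 ∧ β j = b.2 ∧ ‖ξ - (θ i + θ j)‖ ≤ 2 * (L + 1)).card ≤ D₂) →
      ∀ (q : ℝ) (Ψ : ℝ≥0∞), 1 ≤ q → (q ≤ 2 → a ^ (q - 1) ≤ Ψ) → (2 ≤ q → a * N ^ (q - 2) ≤ Ψ) →
      ∫⁻ y, (‖capSum J₁ f y‖ₑ * ‖capSum J₂ f y‖ₑ) ^ q ≤
        (C * (D₁ * D₂)) ^ q * Ψ * ∫⁻ y, sqSum I f y ^ q := by
  obtain ⟨C, hCt, hC1, hC⟩ := exists_bilinear_unit_scale L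
  refine ⟨C, hCt, hC1, ?_⟩
  intro A T hAT ι I J₁ J₂ f θ β D₁ D₂ a N hD₁1 hD₂1 hJ₁ hJ₂ hf hN ha hD₁ hD₂ q Ψ hq hΨ1 hΨ2
  have key := hC I J₁ J₂ (fun i => schwartzComp A (f i)) θ β D₁ D₂ a N hD₁1 hD₂1 hJ₁ hJ₂
    (fun i hi η hη => by simpa using hf i hi _ (fourier_schwartzComp_ne_zero hAT hη))
    hN ha hD₁ hD₂ q Ψ hq hΨ1 hΨ2
  simp_rw [capSum_schwartzComp, sqSum_schwartzComp] at key
  obtain ⟨c, hc0, hct, hc⟩ := exists_lintegral_comp_eq A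
  rw [hc fun y => (‖capSum J₁ f y‖ₑ * ‖capSum J₂ f y‖ₑ) ^ q, hc fun y => sqSum I f y ^ q,
    mul_left_comm] at key
  exact (ENNReal.mul_le_mul_iff_right hc0 hct).1 key

/-- The linear estimate for Fourier supports that a linear map `T` brings to unit scale. -/
lemma exists_linear (L : ℝ) : ∃ C : ℝ≥0∞, C ≠ ⊤ ∧ 1 ≤ C ∧
    ∀ (A T : Plane ≃L[ℝ] Plane), (∀ x ξ, inner ℝ (A x) ξ = inner ℝ x (T ξ)) →
    ∀ {ι : Type} (I : Finset ι) (f : ι → 𝓢(Plane, ℂ)) (θ : ι → Plane)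
      (D₁ : ℕ) (N : ℝ≥0∞), 1 ≤ D₁ →
      (∀ i ∈ I, ∀ ξ, 𝓕 (f i) ξ ≠ 0 → ‖T ξ - θ i‖ ≤ L) →
      (I.card : ℝ≥0∞) ≤ N →
      (∀ ξ, (I.filter fun i => ‖ξ - θ i‖ ≤ L + 1).card ≤ D₁) →
      ∀ q : ℝ, 1 ≤ q →
      ∫⁻ y, (‖capSum I f y‖ₑ ^ 2) ^ q ≤ (C * D₁) ^ q * N ^ (q - 1) * ∫⁻ y, sqSum I f y ^ q := by
  obtain ⟨C, hCt, hC1, hC⟩ := exists_linear_unit_scale L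
  refine ⟨C, hCt, hC1, ?_⟩
  intro A T hAT ι I f θ D₁ N hD₁1 hf hN hD₁ q hq
  have key := hC I (fun i => schwartzComp A (f i)) θ D₁ N hD₁1
    (fun i hi η hη => by simpa using hf i hi _ (fourier_schwartzComp_ne_zero hAT hη))
    hN hD₁ q hq
  simp_rw [capSum_schwartzComp, sqSum_schwartzComp] at key
  obtain ⟨c, hc0, hct, hc⟩ := exists_lintegral_comp_eq A
  rw [hc fun y => (‖capSum I f y‖ₑ ^ 2) ^ q, hc fun y => sqSum I f y ^ q, mul_left_comm] at key
  exact (ENNReal.mul_le_mul_iff_right hc0 hct).1 key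

end Rescale

/-! ### Counting separated centers -/

lemma card_le_of_forall_sub_le {T : Finset ℤ} {X : ℝ} (hX : 0 ≤ X)
    (h : ∀ a ∈ T, ∀ b ∈ T, (a : ℝ) - b ≤ X) : (T.card : ℝ) ≤ X + 1 := by
  rcases T.eq_empty_or_nonempty with rfl | hT
  · simp; linarith
  have h1 : T ⊆ Finset.Icc (T.min' hT) (T.max' hT) := fun a ha =>
    Finset.mem_Icc.2 ⟨T.min'_le a ha, T.le_max' a ha⟩
  have h2 := Finset.card_le_card h1
  rw [Int.card_Icc] at h2
  have h3 := h _ (T.max'_mem hT) _ (T.min'_mem hT)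
  have h4 : T.min' hT ≤ T.max' hT := T.min'_le _ (T.max'_mem hT)
  have h5 : (T.card : ℤ) ≤ T.max' hT + 1 - T.min' hT := by omega
  have h6 : (T.card : ℝ) ≤ T.max' hT + 1 - T.min' hT := by exact_mod_cast h5
  linarith

/-- The points `a i` are separated like points in increasing order with consecutive gaps at least
`1 / (2 K)`. -/
def IsSeparated {n : ℕ} (a : Fin n → ℝ) (K : ℝ) : Prop :=
  ∀ i j : Fin n, ((i : ℕ) : ℝ) - (j : ℕ) ≤ 2 * K * |a i - a j|

lemma IsSeparated.card_le {n : ℕ} {a : Fin n → ℝ} {K : ℝ} (ha : IsSeparated a K) (hK : 0 < K)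
    {S : Finset (Fin n)} {d : ℝ} (hd : 0 ≤ d) (h : ∀ i ∈ S, ∀ j ∈ S, |a i - a j| ≤ d) :
    (S.card : ℝ) ≤ 2 * K * d + 1 := by
  have h1 : (S.map ⟨fun i : Fin n => ((i : ℕ) : ℤ), fun i j h =>
      Fin.ext (Int.ofNat_inj.1 h)⟩).card = S.card := Finset.card_map _
  rw [← h1]
  refine card_le_of_forall_sub_le (by positivity) ?_
  intro x hx y hy
  simp only [Finset.mem_map] at hx hy
  obtain ⟨i, hi, rfl⟩ := hx
  obtain ⟨j, hj, rfl⟩ := hy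
  refine (ha i j).trans ?_
  gcongr
  exact h i hi j hj

lemma abs_le_div_of_abs_mul_le {K x y : ℝ} (hK : 0 < K) (h : |K * x| ≤ y) : |x| ≤ y / K := by
  rw [abs_mul, abs_of_pos hK] at h
  rwa [le_div_iff₀' hK]

lemma abs_apply_le_norm (v : Plane) (k : Fin 2) : |v k| ≤ ‖v‖ := by
  simpa using PiLp.norm_apply_le v k

lemma norm_le_abs_add_abs (v : Plane) : ‖v‖ ≤ |v 0| + |v 1| := by
  rw [EuclideanSpace.norm_eq, Fin.sum_univ_two]
  apply Real.sqrt_le_iff.2 ⟨by positivity, ?_⟩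
  simp only [Real.norm_eq_abs]
  nlinarith [abs_nonneg (v 0), abs_nonneg (v 1)]

lemma abs_floor_sub_floor_le {x y d : ℝ} (h : x - y ≤ d) : ((⌊x⌋ : ℝ) - ⌊y⌋) ≤ d + 1 := by
  linarith [Int.floor_le x, Int.lt_floor_add_one y]

/-! ### Parabolic rescaling of a cap -/

/-- The linear map `ξ ↦ (K ξ₀, ρ⁻¹ (ξ₁ - 2 c ξ₀))`, which brings a box of dimensions `K⁻¹ × ρ` in
the direction tangent to the parabola at `c` to unit size. -/
noncomputable def freqMap (K ρ c : ℝ) (hK : 0 < K) (hρ : 0 < ρ) : Plane ≃L[ℝ] Plane :=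
  LinearEquiv.toContinuousLinearEquiv
    { toFun := fun ξ => !₂[K * ξ 0, ρ⁻¹ * (ξ 1 - 2 * c * ξ 0)]
      invFun := fun η => !₂[K⁻¹ * η 0, ρ * η 1 + 2 * c * (K⁻¹ * η 0)]
      map_add' := fun x y => by ext i; fin_cases i <;> simp <;> ring
      map_smul' := fun x y => by ext i; fin_cases i <;> simp <;> ring
      left_inv := fun x => by ext i; fin_cases i <;> simp [hK.ne', hρ.ne']
      right_inv := fun x => by ext i; fin_cases i <;> simp [hK.ne', hρ.ne'] }

/-- The transpose of `freqMap`. -/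
noncomputable def spaceMap (K ρ c : ℝ) (hK : 0 < K) (hρ : 0 < ρ) : Plane ≃L[ℝ] Plane :=
  LinearEquiv.toContinuousLinearEquiv
    { toFun := fun x => !₂[K * x 0 - 2 * c * (ρ⁻¹ * x 1), ρ⁻¹ * x 1]
      invFun := fun y => !₂[K⁻¹ * (y 0 + 2 * c * y 1), ρ * y 1]
      map_add' := fun x y => by ext i; fin_cases i <;> simp <;> ring
      map_smul' := fun x y => by ext i; fin_cases i <;> simp <;> ring
      left_inv := fun x => by ext i; fin_cases i <;> simp [hK.ne', hρ.ne']
      right_inv := fun x => by ext i; fin_cases i <;> simp [hK.ne', hρ.ne'] }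

lemma freqMap_apply (K ρ c : ℝ) (hK : 0 < K) (hρ : 0 < ρ) (ξ : Plane) :
    freqMap K ρ c hK hρ ξ = !₂[K * ξ 0, ρ⁻¹ * (ξ 1 - 2 * c * ξ 0)] := rfl

lemma spaceMap_apply (K ρ c : ℝ) (hK : 0 < K) (hρ : 0 < ρ) (x : Plane) :
    spaceMap K ρ c hK hρ x = !₂[K * x 0 - 2 * c * (ρ⁻¹ * x 1), ρ⁻¹ * x 1] := rfl

lemma inner_spaceMap (K ρ c : ℝ) (hK : 0 < K) (hρ : 0 < ρ) (x ξ : Plane) :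
    inner ℝ (spaceMap K ρ c hK hρ x) ξ = inner ℝ x (freqMap K ρ c hK hρ ξ) := by
  simp [spaceMap_apply, freqMap_apply, PiLp.inner_apply, Fin.sum_univ_two]
  ring

/-- A family of Schwartz functions whose Fourier transforms are supported in the dilates by `M` of
boxes of dimensions `K⁻¹ × R⁻¹`, tangent to the parabola above the points `a i`. -/
def HasCapSupport {n : ℕ} (f : Fin n → 𝓢(Plane, ℂ)) (a : Fin n → ℝ) (K R M : ℝ) : Prop :=
  ∀ i ξ, 𝓕 (f i) ξ ≠ 0 → |ξ 0 - a i| ≤ M * K⁻¹ ∧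
    |ξ 1 - a i ^ 2 - 2 * a i * (ξ 0 - a i)| ≤ M * R⁻¹

/-- The pieces that make up a cap of length about `s`: the indices in `I` have centers `a i` within
`s` of `c`. The cap is at least as long as the small caps, `1 ≤ K * s`. -/
structure CapData {n : ℕ} (f : Fin n → 𝓢(Plane, ℂ)) (a : Fin n → ℝ) (K R M s c : ℝ)
    (I : Finset (Fin n)) : Prop where
  K_pos : 0 < K
  R_pos : 0 < R
  s_pos : 0 < s
  M_nonneg : 0 ≤ M
  sep : IsSeparated a K
  supp : HasCapSupport f a K R M
  near : ∀ i ∈ I, |a i - c| ≤ s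
  one_le : 1 ≤ K * s

section Cap

variable {n : ℕ} {f : Fin n → 𝓢(Plane, ℂ)} {a : Fin n → ℝ} {K R M s c : ℝ} {I : Finset (Fin n)}

/-- The image under `freqMap` of the point of the parabola above `a`. -/
noncomputable def capPoint (K ρ c a : ℝ) : Plane := !₂[K * a, ρ⁻¹ * (a ^ 2 - 2 * c * a)]

/-- The linear map `freqMap` brings the Fourier support of each piece of a cap of length `s` to unit
size. The condition `s / K ≤ ρ` makes up for the difference between the directions of the tangents
at `a i` and at `c`. -/
lemma CapData.norm_sub_le (h : CapData f a K R M s c I) {ρ : ℝ} (hρ : 0 < ρ) (hρR : R⁻¹ ≤ ρ)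
    (hρs : s / K ≤ ρ) {i : Fin n} (hi : i ∈ I) {ξ : Plane} (hξ : 𝓕 (f i) ξ ≠ 0) :
    ‖freqMap K ρ c h.K_pos hρ ξ - capPoint K ρ c (a i)‖ ≤ 4 * M := by
  obtain ⟨h0, h1⟩ := h.supp i ξ hξ
  have hK := h.K_pos
  have hM := h.M_nonneg
  have e0 : (freqMap K ρ c h.K_pos hρ ξ - capPoint K ρ c (a i)) 0 = K * (ξ 0 - a i) := by
    simp [freqMap_apply, capPoint]; ring
  have e1 : (freqMap K ρ c h.K_pos hρ ξ - capPoint K ρ c (a i)) 1 =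
      ρ⁻¹ * ((ξ 1 - a i ^ 2 - 2 * a i * (ξ 0 - a i)) + 2 * (a i - c) * (ξ 0 - a i)) := by
    simp [freqMap_apply, capPoint]; ring
  have b0 : |K * (ξ 0 - a i)| ≤ M := by
    rw [abs_mul, abs_of_pos hK]
    calc K * |ξ 0 - a i| ≤ K * (M * K⁻¹) := by gcongr
      _ = M := by field_simp
  have b1 : |ρ⁻¹ * ((ξ 1 - a i ^ 2 - 2 * a i * (ξ 0 - a i)) + 2 * (a i - c) * (ξ 0 - a i))| ≤
      3 * M := by
    rw [abs_mul, abs_of_pos (inv_pos.2 hρ), inv_mul_le_iff₀ hρ]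
    calc _ ≤ |ξ 1 - a i ^ 2 - 2 * a i * (ξ 0 - a i)| + |2 * (a i - c) * (ξ 0 - a i)| :=
          abs_add_le _ _
      _ ≤ M * R⁻¹ + 2 * s * (M * K⁻¹) := by
          rw [abs_mul, abs_mul, abs_two]
          have := h.near i hi
          have := h.s_pos
          gcongr
      _ = M * R⁻¹ + 2 * M * (s / K) := by ring
      _ ≤ M * ρ + 2 * M * ρ := by gcongr
      _ = ρ * (3 * M) := by ring
  refine (norm_le_abs_add_abs _).trans ?_
  rw [e0, e1]
  linarith

lemma CapData.card_le (h : CapData f a K R M s c I) : (I.card : ℝ) ≤ 5 * (K * s) := by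
  have := h.sep.card_le h.K_pos (S := I) (d := 2 * s) (by linarith [h.s_pos]) (fun i hi j hj => by
    have h1 := abs_le.1 (h.near i hi)
    have h2 := abs_le.1 (h.near j hj)
    rw [abs_le]; constructor <;> linarith)
  linarith [h.one_le]

/-- The rescaled Fourier supports of the pieces have bounded overlap. -/
lemma CapData.card_filter_le (h : CapData f a K R M s c I) {ρ L : ℝ} (hL : 0 ≤ L) (ξ : Plane) :
    (I.filter fun i => ‖ξ - capPoint K ρ c (a i)‖ ≤ L).card ≤ ⌈4 * L + 1⌉₊ := by
  have hK := h.K_pos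
  rw [← Nat.cast_le (α := ℝ)]
  refine le_trans ?_ (Nat.le_ceil _)
  have h0 : ∀ i ∈ I.filter fun i => ‖ξ - capPoint K ρ c (a i)‖ ≤ L, |ξ 0 - K * a i| ≤ L :=
    fun i hi => by
    have := (abs_apply_le_norm _ 0).trans (Finset.mem_filter.1 hi).2
    simpa [capPoint] using this
  refine (h.sep.card_le h.K_pos (d := 2 * L / K) (by positivity) fun i hi j hj => ?_).trans ?_
  · have h1 := abs_le.1 (h0 i hi)
    have h2 := abs_le.1 (h0 j hj)
    apply abs_le_div_of_abs_mul_le hK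
    rw [abs_le]
    constructor <;> linarith
  · apply le_of_eq; field_simp; ring

lemma CapData.card_block_le (h : CapData f a K R M s c I) {ℓ : ℝ} (hℓ : 0 < ℓ) (hKℓ : 1 ≤ K * ℓ)
    (b : ℤ) : ((I.filter fun i => ⌊a i / ℓ⌋ = b).card : ℝ) ≤ 3 * (K * ℓ) := by
  have := h.sep.card_le h.K_pos (S := I.filter fun i => ⌊a i / ℓ⌋ = b) (d := ℓ) hℓ.le
    (fun i hi j hj => by
      have h1 := (Finset.mem_filter.1 hi).2
      have h2 := (Finset.mem_filter.1 hj).2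
      have h3 := (Int.abs_sub_lt_one_of_floor_eq_floor (h1.trans h2.symm)).le
      rw [← sub_div, abs_div, abs_of_pos hℓ, div_le_one hℓ] at h3
      exact h3)
  linarith

/-- Transversality: if `x₁ + x₂` and `x₁² + x₂²` are known up to errors `K⁻¹` and `ρ`, and
`x₁ - x₂ ≥ σ`, then `x₁` is known up to an error `ρ / σ`. -/
lemma abs_sub_le_of_transversal {x₁ x₂ y₁ y₂ c K ρ s σ E : ℝ} (hK : 0 < K) (hσ : 0 < σ)
    (hE : 0 ≤ E) (hρs : s / K ≤ ρ) (hx₂ : |x₂ - c| ≤ s) (hy₂ : |y₂ - c| ≤ s)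
    (hx : σ ≤ x₁ - x₂) (hy : σ ≤ y₁ - y₂)
    (h0 : |K * (x₁ + x₂) - K * (y₁ + y₂)| ≤ 2 * E)
    (h1 : |(x₁ ^ 2 - 2 * c * x₁ + (x₂ ^ 2 - 2 * c * x₂)) -
      (y₁ ^ 2 - 2 * c * y₁ + (y₂ ^ 2 - 2 * c * y₂))| ≤ 2 * E * ρ) :
    |x₁ - y₁| ≤ 3 * E * ρ / σ := by
  set u := x₁ - y₁ with hu
  set w := x₁ + x₂ - (y₁ + y₂) with hw
  have hs : 0 ≤ s := (abs_nonneg _).trans hx₂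
  have hw' : |w| ≤ 2 * E / K := by
    apply abs_le_div_of_abs_mul_le hK
    convert h0 using 2
    rw [hw]; ring
  have e : u * (x₁ + y₁ - x₂ - y₂) = ((x₁ ^ 2 - 2 * c * x₁ + (x₂ ^ 2 - 2 * c * x₂)) -
      (y₁ ^ 2 - 2 * c * y₁ + (y₂ ^ 2 - 2 * c * y₂))) - w * ((x₂ - c) + (y₂ - c)) := by
    rw [hu, hw]; ring
  have h2 : |u * (x₁ + y₁ - x₂ - y₂)| ≤ 2 * E * ρ + 2 * E / K * (2 * s) := by
    rw [e]
    refine (abs_sub _ _).trans (add_le_add h1 ?_)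
    rw [abs_mul]
    gcongr
    exact (abs_add_le _ _).trans (by linarith)
  have h3 : 2 * E / K * (2 * s) = 4 * E * (s / K) := by ring
  have h4 : |u| * (2 * σ) ≤ 6 * E * ρ := by
    calc |u| * (2 * σ) ≤ |u| * |x₁ + y₁ - x₂ - y₂| := by
          gcongr
          exact le_trans (by linarith) (le_abs_self _)
      _ = |u * (x₁ + y₁ - x₂ - y₂)| := (abs_mul _ _).symm
      _ ≤ 2 * E * ρ + 4 * E * (s / K) := by rw [← h3]; exact h2
      _ ≤ 2 * E * ρ + 4 * E * ρ := by gcongr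
      _ = 6 * E * ρ := by ring
  rw [le_div_iff₀ hσ]
  linarith

open Classical in
/-- The sumsets of pairs of blocks of length `ρ / s` from two transversal subcaps have bounded
overlap. -/
lemma CapData.card_pairs_le (h : CapData f a K R M s c I) {J₁ J₂ : Finset (Fin n)} (hJ₂ : J₂ ⊆ I)
    {ρ σ E : ℝ} {K₀ : ℕ} (hK₀ : 1 ≤ K₀) (hρ : 0 < ρ) (hρs : s / K ≤ ρ) (hσ : 0 < σ)
    (hσs : s ≤ K₀ * σ) (hE : 0 ≤ E) (hJ : ∀ i ∈ J₁, ∀ j ∈ J₂, σ ≤ a i - a j) (ξ : Plane) :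
    ((J₁.image (fun i => ⌊a i / (ρ / s)⌋) ×ˢ J₂.image (fun i => ⌊a i / (ρ / s)⌋)).filter
      fun b => ∃ i ∈ J₁, ∃ j ∈ J₂, ⌊a i / (ρ / s)⌋ = b.1 ∧ ⌊a j / (ρ / s)⌋ = b.2 ∧
        ‖ξ - (capPoint K ρ c (a i) + capPoint K ρ c (a j))‖ ≤ E).card ≤
      (⌈5 * E + 2⌉₊ * K₀) ^ 2 := by
  set ℓ := ρ / s with hℓ
  have hs := h.s_pos
  have hK := h.K_pos
  have hℓ0 : 0 < ℓ := by positivity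
  have hK₀' : (1 : ℝ) ≤ K₀ := by exact_mod_cast hK₀
  set P := (J₁.image (fun i => ⌊a i / ℓ⌋) ×ˢ J₂.image (fun i => ⌊a i / ℓ⌋)).filter
      fun b => ∃ i ∈ J₁, ∃ j ∈ J₂, ⌊a i / ℓ⌋ = b.1 ∧ ⌊a j / ℓ⌋ = b.2 ∧
        ‖ξ - (capPoint K ρ c (a i) + capPoint K ρ c (a j))‖ ≤ E with hP
  have key : ∀ b ∈ P, ∀ b' ∈ P, (b.1 : ℝ) - b'.1 ≤ 5 * E * K₀ + 1 ∧
      (b.2 : ℝ) - b'.2 ≤ 5 * E * K₀ + 1 := by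
    intro b hb b' hb'
    obtain ⟨-, i, hi, j, hj, e1, e2, hij⟩ := Finset.mem_filter.1 hb
    obtain ⟨-, i', hi', j', hj', e1', e2', hij'⟩ := Finset.mem_filter.1 hb'
    have c0 := abs_le.1 ((abs_apply_le_norm _ 0).trans hij)
    have c1 := abs_le.1 ((abs_apply_le_norm _ 1).trans hij)
    have c0' := abs_le.1 ((abs_apply_le_norm _ 0).trans hij')
    have c1' := abs_le.1 ((abs_apply_le_norm _ 1).trans hij')
    simp only [capPoint, PiLp.sub_apply, PiLp.add_apply, Matrix.cons_val_zero,
      Matrix.cons_val_one, Matrix.cons_val_fin_one] at c0 c1 c0' c1'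
    have d0 : |K * (a i + a j) - K * (a i' + a j')| ≤ 2 * E := by
      rw [abs_le]; constructor <;> linarith
    have d1 : |(a i ^ 2 - 2 * c * a i + (a j ^ 2 - 2 * c * a j)) -
      (a i' ^ 2 - 2 * c * a i' + (a j' ^ 2 - 2 * c * a j'))| ≤ 2 * E * ρ := by
      have e : 2 * E * ρ = 2 * E / ρ⁻¹ := by field_simp
      rw [e]
      apply abs_le_div_of_abs_mul_le (inv_pos.2 hρ)
      rw [abs_le]
      constructor <;> linarith
    have t1 := abs_sub_le_of_transversal hK hσ hE hρs (h.near j (hJ₂ hj)) (h.near j' (hJ₂ hj'))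
      (hJ i hi j hj) (hJ i' hi' j' hj') d0 d1
    have t1' : |a i - a i'| ≤ 3 * E * K₀ * ℓ := by
      refine t1.trans ?_
      rw [div_le_iff₀ hσ, hℓ]
      calc 3 * E * ρ = 3 * E * (ρ / s) * s := by field_simp
        _ ≤ 3 * E * (ρ / s) * (K₀ * σ) := by gcongr
        _ = _ := by ring
    have hKℓ : K⁻¹ ≤ ℓ := by
      rw [hℓ, le_div_iff₀ hs]
      calc K⁻¹ * s = s / K := by ring
        _ ≤ ρ := hρs
    have t2 : |a j - a j'| ≤ 5 * E * K₀ * ℓ := by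
      have d0' : |(a i + a j) - (a i' + a j')| ≤ 2 * E * K⁻¹ := by
        rw [← div_eq_mul_inv]
        apply abs_le_div_of_abs_mul_le hK
        convert d0 using 2; ring
      have : 2 * E * K⁻¹ ≤ 2 * E * K₀ * ℓ := by
        calc 2 * E * K⁻¹ ≤ 2 * E * (1 * ℓ) := by rw [one_mul]; gcongr
          _ ≤ 2 * E * (K₀ * ℓ) := by gcongr
          _ = _ := by ring
      have x1 := abs_le.1 d0'
      have x2 := abs_le.1 t1'
      rw [abs_le]; constructor <;> linarith
    rw [← e1, ← e2, ← e1', ← e2']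
    have hEK : 0 ≤ E * K₀ * ℓ := by positivity
    constructor
    · apply abs_floor_sub_floor_le
      rw [← sub_div, div_le_iff₀ hℓ0]
      linarith [le_abs_self (a i - a i')]
    · apply abs_floor_sub_floor_le
      rw [← sub_div, div_le_iff₀ hℓ0]
      linarith [le_abs_self (a j - a j')]
  have hbound : ∀ T : Finset ℤ, (∀ x ∈ T, ∀ y ∈ T, (x : ℝ) - y ≤ 5 * E * K₀ + 1) →
      T.card ≤ ⌈5 * E + 2⌉₊ * K₀ := by
    intro T hT
    have h1 := card_le_of_forall_sub_le (by positivity) hT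
    rw [← Nat.cast_le (α := ℝ)]
    calc (T.card : ℝ) ≤ 5 * E * K₀ + 1 + 1 := h1
      _ ≤ (5 * E + 2) * K₀ := by nlinarith
      _ ≤ _ := by push_cast; gcongr; exact Nat.le_ceil _
  calc P.card ≤ (P.image Prod.fst ×ˢ P.image Prod.snd).card := by
        refine Finset.card_le_card fun b hb => ?_
        exact Finset.mem_product.2 ⟨Finset.mem_image_of_mem _ hb, Finset.mem_image_of_mem _ hb⟩
    _ = (P.image Prod.fst).card * (P.image Prod.snd).card := Finset.card_product _ _
    _ ≤ (⌈5 * E + 2⌉₊ * K₀) * (⌈5 * E + 2⌉₊ * K₀) := by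
        refine Nat.mul_le_mul (hbound _ ?_) (hbound _ ?_)
        · intro x hx y hy
          obtain ⟨b, hb, rfl⟩ := Finset.mem_image.1 hx
          obtain ⟨b', hb', rfl⟩ := Finset.mem_image.1 hy
          exact (key b hb b' hb').1
        · intro x hx y hy
          obtain ⟨b, hb, rfl⟩ := Finset.mem_image.1 hx
          obtain ⟨b', hb', rfl⟩ := Finset.mem_image.1 hy
          exact (key b hb b' hb').2
    _ = _ := by ring

end Cap

/-- The bilinear estimate for two `σ`-separated subcaps of a cap of length `s`. -/
lemma exists_bilinear_cap (M : ℝ) (hM : 0 ≤ M) : ∃ C : ℝ≥0∞, C ≠ ⊤ ∧ 1 ≤ C ∧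
    ∀ {n : ℕ} {f : Fin n → 𝓢(Plane, ℂ)} {a : Fin n → ℝ} {K R s c : ℝ} {I : Finset (Fin n)},
      CapData f a K R M s c I → ∀ (J₁ J₂ : Finset (Fin n)) (σ : ℝ) (K₀ : ℕ), J₁ ⊆ I → J₂ ⊆ I →
      1 ≤ K₀ → 0 < σ → s ≤ K₀ * σ → (∀ i ∈ J₁, ∀ j ∈ J₂, σ ≤ a i - a j) →
      ∀ q Ψ : ℝ, 1 ≤ q →
      (q ≤ 2 → (3 * (K * (max R⁻¹ (s / K) / s))) ^ (q - 1) ≤ Ψ) →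
      (2 ≤ q → 3 * (K * (max R⁻¹ (s / K) / s)) * (5 * (K * s)) ^ (q - 2) ≤ Ψ) →
      ∫⁻ y, (‖capSum J₁ f y‖ₑ * ‖capSum J₂ f y‖ₑ) ^ q ≤
        (C * K₀ ^ 2) ^ q * ENNReal.ofReal Ψ * ∫⁻ y, sqSum I f y ^ q := by
  obtain ⟨C, hCt, hC1, hC⟩ := exists_bilinear (4 * M)
  obtain ⟨D, hD⟩ : ∃ D, D = ⌈4 * (4 * M + 1) + 1⌉₊ := ⟨_, rfl⟩
  obtain ⟨E, hE⟩ : ∃ E, E = ⌈5 * (2 * (4 * M + 1)) + 2⌉₊ := ⟨_, rfl⟩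
  have hD1 : 1 ≤ D := hD ▸ Nat.one_le_ceil_iff.2 (by positivity)
  have hE1 : 1 ≤ E := hE ▸ Nat.one_le_ceil_iff.2 (by positivity)
  refine ⟨C * (D * (E : ℝ≥0∞) ^ 2), by finiteness, one_le_mul hC1 (one_le_mul
    (by exact_mod_cast hD1) (one_le_pow_of_one_le' (by exact_mod_cast hE1) 2)), ?_⟩
  intro n f a K R s c I h J₁ J₂ σ K₀ hJ₁ hJ₂ hK₀ hσ hσs hJ q Ψ hq hΨ1 hΨ2
  set ρ := max R⁻¹ (s / K) with hρ
  have hK := h.K_pos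
  have hs := h.s_pos
  have hρ0 : 0 < ρ := lt_of_lt_of_le (by positivity) (le_max_right _ _)
  have hℓ : 1 ≤ K * (ρ / s) := by
    rw [← mul_div_assoc, one_le_div hs, mul_comm, ← div_le_iff₀ hK]
    exact le_max_right _ _
  have hA0 : 0 ≤ 3 * (K * (ρ / s)) := by linarith
  have hN0 : 0 ≤ 5 * (K * s) := by linarith [h.one_le]
  have hR : R⁻¹ ≤ ρ := le_max_left _ _
  have hsK : s / K ≤ ρ := le_max_right _ _
  have p1 := fun i (hi : i ∈ I) ξ (hξ : 𝓕 (f i) ξ ≠ 0) => h.norm_sub_le hρ0 hR hsK hi hξ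
  have p2 : (I.card : ℝ≥0∞) ≤ ENNReal.ofReal (5 * (K * s)) := by
    rw [← ENNReal.ofReal_natCast]; exact ENNReal.ofReal_le_ofReal h.card_le
  have p3 : ∀ b, ((I.filter fun i => ⌊a i / (ρ / s)⌋ = b).card : ℝ≥0∞) ≤
      ENNReal.ofReal (3 * (K * (ρ / s))) := fun b => by
    rw [← ENNReal.ofReal_natCast]
    exact ENNReal.ofReal_le_ofReal (h.card_block_le (div_pos hρ0 hs) hℓ b)
  have p4 := fun ξ => h.card_filter_le (ρ := ρ) (L := 4 * M + 1) (by linarith) ξ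
  have p5 := fun ξ => h.card_pairs_le (E := 2 * (4 * M + 1)) hJ₂ hK₀ hρ0 hsK hσ hσs (by linarith)
    hJ ξ
  rw [← hD] at p4
  rw [← hE] at p5
  have key := hC (spaceMap K ρ c hK hρ0) (freqMap K ρ c hK hρ0) (inner_spaceMap K ρ c hK hρ0)
    I J₁ J₂ f (fun i => capPoint K ρ c (a i)) (fun i => ⌊a i / (ρ / s)⌋) D ((E * K₀) ^ 2)
    (ENNReal.ofReal (3 * (K * (ρ / s)))) (ENNReal.ofReal (5 * (K * s))) hD1
    (Nat.one_le_pow _ _ (Nat.mul_pos hE1 hK₀)) hJ₁ hJ₂ p1 p2 (fun b => by convert p3 b)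
    p4 (fun ξ => by convert p5 ξ) q (ENNReal.ofReal Ψ) hq
    (fun h2 => by
      rw [ENNReal.ofReal_rpow_of_nonneg hA0 (by linarith)]
      exact ENNReal.ofReal_le_ofReal (hΨ1 h2))
    (fun h2 => by
      rw [ENNReal.ofReal_rpow_of_nonneg hN0 (by linarith), ← ENNReal.ofReal_mul hA0]
      exact ENNReal.ofReal_le_ofReal (hΨ2 h2))
  refine key.trans (le_of_eq ?_)
  congr 3
  push_cast
  ring

/-- The linear estimate for a cap of length `s`. -/
lemma exists_linear_cap (M : ℝ) (hM : 0 ≤ M) : ∃ C : ℝ≥0∞, C ≠ ⊤ ∧ 1 ≤ C ∧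
    ∀ {n : ℕ} {f : Fin n → 𝓢(Plane, ℂ)} {a : Fin n → ℝ} {K R s c : ℝ} {I : Finset (Fin n)},
      CapData f a K R M s c I → ∀ q : ℝ, 1 ≤ q →
      ∫⁻ y, (‖capSum I f y‖ₑ ^ 2) ^ q ≤
        C ^ q * ENNReal.ofReal ((5 * (K * s)) ^ (q - 1)) * ∫⁻ y, sqSum I f y ^ q := by
  obtain ⟨C, hCt, hC1, hC⟩ := exists_linear (4 * M)
  obtain ⟨D, hD⟩ : ∃ D, D = ⌈4 * (4 * M + 1) + 1⌉₊ := ⟨_, rfl⟩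
  have hD1 : 1 ≤ D := hD ▸ Nat.one_le_ceil_iff.2 (by positivity)
  refine ⟨C * D, by finiteness, one_le_mul hC1 (by exact_mod_cast hD1), ?_⟩
  intro n f a K R s c I h q hq
  set ρ := max R⁻¹ (s / K) with hρ
  have hK := h.K_pos
  have hs := h.s_pos
  have hρ0 : 0 < ρ := lt_of_lt_of_le (by positivity) (le_max_right _ _)
  have hN0 : 0 ≤ 5 * (K * s) := by linarith [h.one_le]
  have key := hC (spaceMap K ρ c hK hρ0) (freqMap K ρ c hK hρ0) (inner_spaceMap K ρ c hK hρ0)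
    I f (fun i => capPoint K ρ c (a i)) D (ENNReal.ofReal (5 * (K * s))) hD1
    (fun i hi ξ hξ => h.norm_sub_le hρ0 (le_max_left _ _) (le_max_right _ _) hi hξ)
    (by rw [← ENNReal.ofReal_natCast]; exact ENNReal.ofReal_le_ofReal h.card_le)
    (fun ξ => hD ▸ h.card_filter_le (by linarith) ξ) q hq
  rwa [ENNReal.ofReal_rpow_of_nonneg hN0 (by linarith)] at key

/-! ### The broad–narrow argument -/

lemma sum_rpow_le_rpow_sum {ι : Type*} (s : Finset ι) (x : ι → ℝ≥0∞) {q : ℝ} (hq : 1 ≤ q) :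
    ∑ i ∈ s, x i ^ q ≤ (∑ i ∈ s, x i) ^ q := by
  classical
  induction s using Finset.induction_on with
  | empty => simp
  | insert i s hi ih =>
    rw [Finset.sum_insert hi, Finset.sum_insert hi]
    exact (add_le_add_right ih _).trans (ENNReal.add_rpow_le_rpow_add _ _ hq)

/-- The pairs of indices below `K₀` that are at distance at least `2`, the larger one first. -/
def farPairs (K₀ : ℕ) : Finset (ℕ × ℕ) :=
  (Finset.range K₀ ×ˢ Finset.range K₀).filter fun l => l.2 + 2 ≤ l.1

lemma card_farPairs_le (K₀ : ℕ) : (farPairs K₀).card ≤ K₀ ^ 2 := by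
  refine (Finset.card_filter_le _ _).trans ?_
  rw [Finset.card_product, Finset.card_range, sq]

/-- The broad–narrow dichotomy: a sum of `K₀` terms is controlled by its largest term and its two
neighbors, or by the products of two terms that are not adjacent. -/
lemma sum_rpow_le_broad_narrow (K₀ : ℕ) (w : ℕ → ℝ≥0∞) {q : ℝ} (hq : 1 ≤ q) :
    ((∑ l ∈ Finset.range K₀, w l) ^ 2) ^ q ≤
      36 ^ q * ∑ l ∈ Finset.range K₀, (w l ^ 2) ^ q +
        (4 * (K₀ : ℝ≥0∞) ^ 2) ^ q * ∑ l ∈ farPairs K₀, (w l.1 * w l.2) ^ q := by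
  have hq0 : 0 < q := by linarith
  rcases (Finset.range K₀).eq_empty_or_nonempty with h | h
  · rw [h]
    simp [ENNReal.zero_rpow_of_pos hq0]
  obtain ⟨k, hk, hmax⟩ := Finset.exists_max_image (Finset.range K₀) w h
  set B := ∑ l ∈ farPairs K₀, (w l.1 * w l.2) ^ q with hB
  set b := B ^ (1 / q) with hb
  have hbB : b ^ q = B := by
    rw [hb, ← ENNReal.rpow_mul, one_div_mul_cancel hq0.ne', ENNReal.rpow_one]
  -- the terms that are not adjacent to the largest one
  have hfar : ∀ l ∈ Finset.range K₀, (k + 2 ≤ l ∨ l + 2 ≤ k) → w l ^ 2 ≤ b := by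
    intro l hl hlk
    rw [← ENNReal.rpow_le_rpow_iff hq0, hbB]
    have h1 : (w l ^ 2) ^ q ≤ (w l * w k) ^ q := by
      rw [sq]
      gcongr
      exact hmax l hl
    refine h1.trans ?_
    rcases hlk with hlk | hlk
    · exact Finset.single_le_sum (f := fun l : ℕ × ℕ => (w l.1 * w l.2) ^ q)
        (fun _ _ => zero_le) (Finset.mem_filter.2 ⟨Finset.mk_mem_product hl hk, hlk⟩)
    · rw [mul_comm]
      exact Finset.single_le_sum (f := fun l : ℕ × ℕ => (w l.1 * w l.2) ^ q)
        (fun _ _ => zero_le) (Finset.mem_filter.2 ⟨Finset.mk_mem_product hk hl, hlk⟩)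
  set b' := b ^ (1 / 2 : ℝ) with hb'
  have hb'b : b' ^ 2 = b := by
    rw [hb', ← ENNReal.rpow_natCast, ← ENNReal.rpow_mul]; norm_num
  have hfar' : ∀ l ∈ Finset.range K₀, (k + 2 ≤ l ∨ l + 2 ≤ k) → w l ≤ b' := by
    intro l hl hlk
    have := ENNReal.rpow_le_rpow (hfar l hl hlk) (z := 1 / 2) (by norm_num)
    rwa [← ENNReal.rpow_natCast, ← ENNReal.rpow_mul, Nat.cast_ofNat,
      mul_one_div_cancel two_ne_zero, ENNReal.rpow_one] at this
  have hsum : ∑ l ∈ Finset.range K₀, w l ≤ 3 * w k + K₀ * b' := by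
    rw [← Finset.sum_filter_add_sum_filter_not (Finset.range K₀)
      (fun l => k + 2 ≤ l ∨ l + 2 ≤ k), add_comm]
    gcongr
    · calc _ ≤ ∑ l ∈ Finset.Icc (k - 1) (k + 1), w k := by
            refine (Finset.sum_le_sum fun l hl => hmax l (Finset.mem_filter.1 hl).1).trans ?_
            refine Finset.sum_le_sum_of_subset fun l hl => ?_
            have := (Finset.mem_filter.1 hl).2
            rw [Finset.mem_Icc]
            omega
        _ ≤ 3 * w k := by
            rw [Finset.sum_const, nsmul_eq_mul, Nat.card_Icc]
            gcongr
            have : k + 1 + 1 - (k - 1) ≤ 3 := by omega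
            exact_mod_cast this
    · calc _ ≤ ∑ l ∈ Finset.range K₀ with k + 2 ≤ l ∨ l + 2 ≤ k, b' :=
            Finset.sum_le_sum fun l hl => hfar' l (Finset.mem_filter.1 hl).1
              (Finset.mem_filter.1 hl).2
        _ ≤ K₀ * b' := by
            rw [Finset.sum_const, nsmul_eq_mul]
            gcongr
            exact (Finset.card_filter_le _ _).trans (Finset.card_range _).le
  have hcase : ((∑ l ∈ Finset.range K₀, w l) ^ 2) ^ q ≤
      36 ^ q * (w k ^ 2) ^ q + (4 * (K₀ : ℝ≥0∞) ^ 2) ^ q * B := by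
    rcases le_total (3 * w k) (K₀ * b') with h1 | h1
    · calc _ ≤ ((K₀ * b' + K₀ * b') ^ 2) ^ q := by
            gcongr
            exact hsum.trans (by gcongr)
        _ = (4 * (K₀ : ℝ≥0∞) ^ 2) ^ q * B := by
            rw [← hbB, ← hb'b, ← ENNReal.mul_rpow_of_nonneg _ _ hq0.le]
            congr 1; ring
        _ ≤ _ := le_add_self
    · calc _ ≤ ((3 * w k + 3 * w k) ^ 2) ^ q := by
            gcongr
            exact hsum.trans (by gcongr)
        _ = 36 ^ q * (w k ^ 2) ^ q := by
            rw [← ENNReal.mul_rpow_of_nonneg _ _ hq0.le]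
            congr 1; ring
        _ ≤ _ := le_self_add
  refine hcase.trans ?_
  gcongr
  exact Finset.single_le_sum (f := fun l => (w l ^ 2) ^ q) (fun _ _ => zero_le) hk

/-- The index, among the `K₀ ^ j` intervals of equal length that make up `[-1, 1]`, of the interval
that contains `x`. -/
noncomputable def cellIndex (K₀ j : ℕ) (x : ℝ) : ℕ := ⌊(x + 1) / 2 * (K₀ : ℝ) ^ j⌋₊

/-- The indices whose centers lie in the `k`-th interval of length `2 / K₀ ^ j`. -/
noncomputable def cell {n : ℕ} (a : Fin n → ℝ) (K₀ j k : ℕ) : Finset (Fin n) :=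
  Finset.univ.filter fun i => cellIndex K₀ j (a i) = k

lemma cellIndex_succ_div {K₀ : ℕ} (hK₀ : 1 ≤ K₀) (j : ℕ) (x : ℝ) :
    cellIndex K₀ (j + 1) x / K₀ = cellIndex K₀ j x := by
  have : (K₀ : ℝ) ≠ 0 := by positivity
  unfold cellIndex
  rw [← Nat.floor_div_natCast]
  congr 1
  field_simp
  ring

lemma sum_cell {n : ℕ} (a : Fin n → ℝ) {K₀ : ℕ} (hK₀ : 1 ≤ K₀) (j k : ℕ) {β : Type*}
    [AddCommMonoid β] (g : Fin n → β) :
    ∑ i ∈ cell a K₀ j k, g i =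
      ∑ l ∈ Finset.range K₀, ∑ i ∈ cell a K₀ (j + 1) (K₀ * k + l), g i := by
  rw [← Finset.sum_fiberwise_of_maps_to (s := cell a K₀ j k) (t := Finset.range K₀)
    (g := fun i => cellIndex K₀ (j + 1) (a i) % K₀)
    (fun i _ => Finset.mem_range.2 (Nat.mod_lt _ hK₀))]
  refine Finset.sum_congr rfl fun l hl => ?_
  refine Finset.sum_congr ?_ fun _ _ => rfl
  ext i
  have hl' := Finset.mem_range.1 hl
  simp only [cell, Finset.mem_filter, Finset.mem_univ, true_and]
  rw [← cellIndex_succ_div hK₀]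
  constructor
  · rintro ⟨h1, h2⟩
    rw [← h1, ← h2]
    exact (Nat.div_add_mod _ _).symm
  · intro h
    rw [h, Nat.mul_add_div hK₀, Nat.div_eq_of_lt hl', Nat.mul_add_mod, Nat.mod_eq_of_lt hl']
    simp

section Cells

variable {n : ℕ} {f : Fin n → 𝓢(Plane, ℂ)} {a : Fin n → ℝ} {K R M : ℝ}

lemma cell_bounds (ha : ∀ i, -1 ≤ a i) {K₀ : ℕ} {j k : ℕ} {i : Fin n}
    (hi : i ∈ cell a K₀ j k) :
    (k : ℝ) ≤ (a i + 1) / 2 * (K₀ : ℝ) ^ j ∧ (a i + 1) / 2 * (K₀ : ℝ) ^ j < k + 1 := by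
  have h := (Finset.mem_filter.1 hi).2
  unfold cellIndex at h
  have h0 : 0 ≤ (a i + 1) / 2 * (K₀ : ℝ) ^ j := by
    have := ha i
    have : 0 ≤ (a i + 1) / 2 := by linarith
    positivity
  rw [← h]
  exact ⟨Nat.floor_le h0, Nat.lt_floor_add_one _⟩

lemma capData_cell (hK : 0 < K) (hR : 0 < R) (hM : 0 ≤ M) (hsep : IsSeparated a K)
    (hsupp : HasCapSupport f a K R M) (ha : ∀ i, -1 ≤ a i) {K₀ : ℕ} (hK₀ : 1 ≤ K₀) (j k : ℕ)
    (hKs : 1 ≤ K * (2 / (K₀ : ℝ) ^ j)) :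
    CapData f a K R M (2 / (K₀ : ℝ) ^ j) (2 * k / (K₀ : ℝ) ^ j - 1) (cell a K₀ j k) where
  K_pos := hK
  R_pos := hR
  s_pos := by positivity
  M_nonneg := hM
  sep := hsep
  supp := hsupp
  near := fun i hi => by
    obtain ⟨h1, h2⟩ := cell_bounds ha hi
    have hp : (0 : ℝ) < (K₀ : ℝ) ^ j := by positivity
    have e : a i - (2 * k / (K₀ : ℝ) ^ j - 1) =
        2 * ((a i + 1) / 2 * (K₀ : ℝ) ^ j - k) / (K₀ : ℝ) ^ j := by field_simp; ring
    rw [e, abs_div, abs_of_pos hp]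
    gcongr
    rw [abs_le]; constructor <;> linarith
  one_le := hKs

lemma cell_subset {K₀ : ℕ} (hK₀ : 1 ≤ K₀) {j k l : ℕ} (hl : l < K₀) :
    cell a K₀ (j + 1) (K₀ * k + l) ⊆ cell a K₀ j k := by
  intro i hi
  have h := (Finset.mem_filter.1 hi).2
  refine Finset.mem_filter.2 ⟨Finset.mem_univ _, ?_⟩
  rw [← cellIndex_succ_div hK₀, h, Nat.mul_add_div hK₀, Nat.div_eq_of_lt hl, add_zero]

/-- One step of the broad–narrow argument. -/
lemma lintegral_cell_le {K₀ : ℕ} (hK₀ : 1 ≤ K₀) (j k : ℕ) {q : ℝ} (hq : 1 ≤ q) {X : ℝ≥0∞}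
    (hX : ∀ l ∈ farPairs K₀, ∫⁻ y, (‖capSum (cell a K₀ (j + 1) (K₀ * k + l.1)) f y‖ₑ *
      ‖capSum (cell a K₀ (j + 1) (K₀ * k + l.2)) f y‖ₑ) ^ q ≤
        X * ∫⁻ y, sqSum (cell a K₀ j k) f y ^ q)
    {Y : ℝ≥0∞} (hY : ∀ l ∈ Finset.range K₀,
      ∫⁻ y, (‖capSum (cell a K₀ (j + 1) (K₀ * k + l)) f y‖ₑ ^ 2) ^ q ≤
        Y * ∫⁻ y, sqSum (cell a K₀ (j + 1) (K₀ * k + l)) f y ^ q) :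
    ∫⁻ y, (‖capSum (cell a K₀ j k) f y‖ₑ ^ 2) ^ q ≤
      (36 ^ q * Y + (4 * (K₀ : ℝ≥0∞) ^ 2) ^ q * (K₀ ^ 2 * X)) *
        ∫⁻ y, sqSum (cell a K₀ j k) f y ^ q := by
  have hm : ∀ l, Measurable fun y => ‖capSum (cell a K₀ (j + 1) (K₀ * k + l)) f y‖ₑ :=
    fun l => measurable_enorm_schwartz _
  have hm1 : Measurable fun y => ∑ l ∈ Finset.range K₀,
      (‖capSum (cell a K₀ (j + 1) (K₀ * k + l)) f y‖ₑ ^ 2) ^ q :=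
    Finset.measurable_fun_sum _ fun l _ => ((hm l).pow_const _).pow_const _
  have hm2 : Measurable fun y => ∑ l ∈ farPairs K₀,
      (‖capSum (cell a K₀ (j + 1) (K₀ * k + l.1)) f y‖ₑ *
        ‖capSum (cell a K₀ (j + 1) (K₀ * k + l.2)) f y‖ₑ) ^ q :=
    Finset.measurable_fun_sum _ fun l _ => ((hm l.1).mul (hm l.2)).pow_const _
  calc ∫⁻ y, (‖capSum (cell a K₀ j k) f y‖ₑ ^ 2) ^ q
      ≤ ∫⁻ y, (36 ^ q * ∑ l ∈ Finset.range K₀,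
          (‖capSum (cell a K₀ (j + 1) (K₀ * k + l)) f y‖ₑ ^ 2) ^ q +
        (4 * (K₀ : ℝ≥0∞) ^ 2) ^ q * ∑ l ∈ farPairs K₀,
          (‖capSum (cell a K₀ (j + 1) (K₀ * k + l.1)) f y‖ₑ *
            ‖capSum (cell a K₀ (j + 1) (K₀ * k + l.2)) f y‖ₑ) ^ q) := by
        refine lintegral_mono fun y => le_trans ?_ (sum_rpow_le_broad_narrow K₀
          (fun l => ‖capSum (cell a K₀ (j + 1) (K₀ * k + l)) f y‖ₑ) hq)
        have h1 : ‖capSum (cell a K₀ j k) f y‖ₑ ≤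
            ∑ l ∈ Finset.range K₀, ‖capSum (cell a K₀ (j + 1) (K₀ * k + l)) f y‖ₑ := by
          simp_rw [capSum_apply]
          rw [sum_cell a hK₀]
          exact enorm_sum_le (Finset.range K₀) _
        exact ENNReal.rpow_le_rpow (pow_le_pow_left' h1 2) (by linarith)
    _ = 36 ^ q * (∑ l ∈ Finset.range K₀, ∫⁻ y,
          (‖capSum (cell a K₀ (j + 1) (K₀ * k + l)) f y‖ₑ ^ 2) ^ q) +
        (4 * (K₀ : ℝ≥0∞) ^ 2) ^ q * ∑ l ∈ farPairs K₀, ∫⁻ y,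
          (‖capSum (cell a K₀ (j + 1) (K₀ * k + l.1)) f y‖ₑ *
            ‖capSum (cell a K₀ (j + 1) (K₀ * k + l.2)) f y‖ₑ) ^ q := by
        rw [lintegral_add_left (hm1.const_mul _), lintegral_const_mul _ hm1,
          lintegral_const_mul _ hm2, lintegral_finsetSum, lintegral_finsetSum]
        · exact fun l _ => ((hm l.1).mul (hm l.2)).pow_const _
        · exact fun l _ => ((hm l).pow_const _).pow_const _
    _ ≤ 36 ^ q * (Y * ∫⁻ y, sqSum (cell a K₀ j k) f y ^ q) +
        (4 * (K₀ : ℝ≥0∞) ^ 2) ^ q * (K₀ ^ 2 * (X * ∫⁻ y, sqSum (cell a K₀ j k) f y ^ q)) := by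
        gcongr
        · refine (Finset.sum_le_sum hY).trans ?_
          rw [← Finset.mul_sum, ← lintegral_finsetSum]
          · refine mul_le_mul_right (lintegral_mono fun y => ?_) _
            refine (sum_rpow_le_rpow_sum _ _ hq).trans (le_of_eq ?_)
            congr 1
            exact (sum_cell a hK₀ j k _).symm
          · exact fun l _ => (measurable_sqSum _ _).pow_const _
        · refine (Finset.sum_le_sum hX).trans ?_
          rw [Finset.sum_const, nsmul_eq_mul]
          gcongr
          exact_mod_cast card_farPairs_le K₀
    _ = _ := by ring

/-- Iteration of the broad–narrow step from scale `m` back to scale `m - r`. -/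
lemma lintegral_cell_le_of_steps {K₀ : ℕ} (hK₀ : 1 ≤ K₀) {q : ℝ} (hq : 1 ≤ q) {m : ℕ}
    {X Y : ℝ≥0∞}
    (hX : ∀ j < m, ∀ k, ∀ l ∈ farPairs K₀,
      ∫⁻ y, (‖capSum (cell a K₀ (j + 1) (K₀ * k + l.1)) f y‖ₑ *
      ‖capSum (cell a K₀ (j + 1) (K₀ * k + l.2)) f y‖ₑ) ^ q ≤
        X * ∫⁻ y, sqSum (cell a K₀ j k) f y ^ q)
    (hXY : (4 * (K₀ : ℝ≥0∞) ^ 2) ^ q * (K₀ ^ 2 * X) ≤ Y)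
    (hY : ∀ k, ∫⁻ y, (‖capSum (cell a K₀ m k) f y‖ₑ ^ 2) ^ q ≤
        Y * ∫⁻ y, sqSum (cell a K₀ m k) f y ^ q) (r : ℕ) :
    ∀ j, j + r = m → ∀ k, ∫⁻ y, (‖capSum (cell a K₀ j k) f y‖ₑ ^ 2) ^ q ≤
      (r + 1) * (36 ^ q) ^ r * Y * ∫⁻ y, sqSum (cell a K₀ j k) f y ^ q := by
  induction r with
  | zero =>
    intro j hj k
    simp only [add_zero] at hj
    subst hj
    simpa using hY k
  | succ r ih =>
    intro j hj k
    have hj' : j + 1 + r = m := by omega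
    refine (lintegral_cell_le hK₀ j k hq (hX j (by omega) k)
      (fun l _ => ih (j + 1) hj' (K₀ * k + l))).trans ?_
    gcongr
    have h36 : (1 : ℝ≥0∞) ≤ 36 ^ q := ENNReal.one_le_rpow (by norm_num) (by linarith)
    calc 36 ^ q * ((r + 1) * (36 ^ q) ^ r * Y) + (4 * (K₀ : ℝ≥0∞) ^ 2) ^ q * (K₀ ^ 2 * X)
        ≤ 36 ^ q * ((r + 1) * (36 ^ q) ^ r * Y) + (36 ^ q) ^ (r + 1) * Y := by
          refine add_le_add_right ?_ _
          exact hXY.trans (le_mul_of_one_le_left' (one_le_pow_of_one_le' h36 _))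
      _ = _ := by push_cast; ring

end Cells

/-! ### Exponents -/

section Exponents

variable {R α s q : ℝ}

/-- The number of small caps of length `R ^ (-α)` in a block of length `ρ / s`, where
`ρ = max R⁻¹ (s * R ^ (-α))` is the thickness of the boxes to which the small caps in a cap of
length `s` are enlarged. Sums of frequencies from two transversal subcaps of length about `s`
determine the summands up to such blocks. -/
noncomputable def blockSize (R α s : ℝ) : ℝ := R ^ α * (max R⁻¹ (s / R ^ α) / s)

lemma blockSize_eq (hR : 1 ≤ R) (hs : 0 < s) :
    blockSize R α s = max (R ^ (α - 1) / s) 1 := by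
  have hR0 : 0 < R := by linarith
  have hK : 0 < R ^ α := Real.rpow_pos_of_pos hR0 α
  unfold blockSize
  rw [Real.rpow_sub_one hR0.ne']
  rcases le_total R⁻¹ (s / R ^ α) with h | h
  · rw [max_eq_right h, max_eq_right]
    · field_simp
    · rw [div_le_one hs, div_eq_mul_inv]
      calc R ^ α * R⁻¹ ≤ R ^ α * (s / R ^ α) := by gcongr
        _ = s := by field_simp
  · rw [max_eq_left h, max_eq_left]
    · ring
    · rw [one_le_div hs, div_eq_mul_inv]
      calc s = R ^ α * (s / R ^ α) := by field_simp
        _ ≤ R ^ α * R⁻¹ := by gcongr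

lemma one_le_blockSize (hR : 1 ≤ R) (hs : 0 < s) : 1 ≤ blockSize R α s := by
  rw [blockSize_eq hR hs]; exact le_max_right _ _

lemma blockSize_le (hR : 1 ≤ R) (hα : 1 / 2 ≤ α) (hs : R ^ (-(1 / 2) : ℝ) ≤ s) :
    blockSize R α s ≤ R ^ (α - 1 / 2) := by
  have hR0 : 0 < R := by linarith
  have hs0 : 0 < s := lt_of_lt_of_le (Real.rpow_pos_of_pos hR0 _) hs
  rw [blockSize_eq hR hs0]
  refine max_le ?_ (Real.one_le_rpow hR (by linarith))
  rw [div_le_iff₀ hs0]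
  calc R ^ (α - 1) = R ^ (α - 1 / 2) * R ^ (-(1 / 2) : ℝ) := by
        rw [← Real.rpow_add hR0]; congr 1; ring
    _ ≤ _ := by gcongr

/-- The exponent of `R` in `capConstant α (2 q) R ^ (2 q)`; the case distinction in `capConstant`
selects the larger of two exponents. -/
noncomputable def capExponent (α q : ℝ) : ℝ := max ((α - 1 / 2) * (q - 1)) (α * (q - 2))

/-- The loss in the bilinear estimate for `q ≤ 2`. -/
lemma rpow_blockSize_le (hR : 1 ≤ R) (hα : 1 / 2 ≤ α) (hs : R ^ (-(1 / 2) : ℝ) ≤ s)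
    (hq : 1 ≤ q) : (3 * blockSize R α s) ^ (q - 1) ≤ 30 ^ q * R ^ capExponent α q := by
  have hR0 : 0 < R := by linarith
  have hs0 : 0 < s := lt_of_lt_of_le (Real.rpow_pos_of_pos hR0 _) hs
  have hb := one_le_blockSize (α := α) hR hs0
  calc (3 * blockSize R α s) ^ (q - 1) = 3 ^ (q - 1) * blockSize R α s ^ (q - 1) :=
        Real.mul_rpow (by norm_num) (by linarith)
    _ ≤ 3 ^ (q - 1) * (R ^ (α - 1 / 2)) ^ (q - 1) := by
        have := blockSize_le hR hα hs
        gcongr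
    _ = 3 ^ (q - 1) * R ^ ((α - 1 / 2) * (q - 1)) := by rw [← Real.rpow_mul hR0.le]
    _ ≤ 30 ^ q * R ^ capExponent α q := by
        gcongr
        · calc (3 : ℝ) ^ (q - 1) ≤ 3 ^ q := by
                apply Real.rpow_le_rpow_of_exponent_le <;> linarith
            _ ≤ 30 ^ q := by gcongr; norm_num
        · exact le_max_left _ _

/-- The loss in the linear estimate for a cap of length about `R ^ (-1 / 2)`. -/
lemma rpow_linear_le (hR : 1 ≤ R) (hs0 : 0 < s) {k : ℝ} (hk : 1 ≤ k)
    (hs : s ≤ 2 * k * R ^ (-(1 / 2) : ℝ)) (hq : 1 ≤ q) :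
    (5 * (R ^ α * s)) ^ (q - 1) ≤ (10 * k) ^ q * R ^ capExponent α q := by
  have hR0 : 0 < R := by linarith
  have hRα : 0 < R ^ α := Real.rpow_pos_of_pos hR0 α
  have e : 5 * (R ^ α * (2 * k * R ^ (-(1 / 2) : ℝ))) = 10 * k * R ^ (α - 1 / 2) := by
    rw [sub_eq_add_neg, Real.rpow_add hR0]; ring
  calc (5 * (R ^ α * s)) ^ (q - 1) ≤ (10 * k * R ^ (α - 1 / 2)) ^ (q - 1) := by
        rw [← e]
        gcongr
    _ = (10 * k) ^ (q - 1) * R ^ ((α - 1 / 2) * (q - 1)) := by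
        rw [Real.mul_rpow (by positivity) (by positivity), ← Real.rpow_mul hR0.le]
    _ ≤ (10 * k) ^ q * R ^ capExponent α q := by
        gcongr
        · linarith
        · linarith
        · exact le_max_left _ _

/-- The loss in the bilinear estimate for `q ≥ 2`. The exponents `α * (q - 2)` and
`(α - 1 / 2) * (q - 1)` arise at the scales `s = 1` and `s = R ^ (-1 / 2)`. -/
lemma blockSize_mul_rpow_le (hR : 1 ≤ R) (hα : 1 / 2 ≤ α) (hα1 : α ≤ 1)
    (hs : R ^ (-(1 / 2) : ℝ) ≤ s) (hs2 : s ≤ 2) (hq : 2 ≤ q) :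
    3 * blockSize R α s * (5 * (R ^ α * s)) ^ (q - 2) ≤ 30 ^ q * R ^ capExponent α q := by
  have hR0 : 0 < R := by linarith
  have hs0 : 0 < s := lt_of_lt_of_le (Real.rpow_pos_of_pos hR0 _) hs
  have hRα : 0 < R ^ α := Real.rpow_pos_of_pos hR0 α
  have hb := one_le_blockSize (α := α) hR hs0
  have hq2 : 0 ≤ q - 2 := by linarith
  have h30 : (3 : ℝ) * 10 ^ (q - 2) ≤ 30 ^ q := by
    have : (30 : ℝ) ^ q = 30 ^ (2 : ℝ) * 30 ^ (q - 2) := by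
      rw [← Real.rpow_add (by norm_num)]; congr 1; ring
    rw [this]
    gcongr <;> norm_num
  have h1 : (1 : ℝ) ≤ R ^ capExponent α q / R ^ (α * (q - 2)) := by
    rw [one_le_div (Real.rpow_pos_of_pos hR0 _)]
    exact Real.rpow_le_rpow_of_exponent_le hR (le_max_right _ _)
  have small : (R ^ α * s) ^ (q - 2) ≤ 2 ^ (q - 2) * R ^ (α * (q - 2)) := by
    calc (R ^ α * s) ^ (q - 2) ≤ (R ^ α * 2) ^ (q - 2) := by gcongr
      _ = _ := by
        rw [Real.mul_rpow hRα.le (by norm_num), ← Real.rpow_mul hR0.le, mul_comm]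
  have e5 : (5 * (R ^ α * s)) ^ (q - 2) = 5 ^ (q - 2) * (R ^ α * s) ^ (q - 2) :=
    Real.mul_rpow (by norm_num) (by positivity)
  have e10 : (10 : ℝ) ^ (q - 2) = 5 ^ (q - 2) * 2 ^ (q - 2) := by
    rw [← Real.mul_rpow (by norm_num) (by norm_num)]; norm_num
  have main : blockSize R α s * (R ^ α * s) ^ (q - 2) ≤ 2 ^ (q - 2) * R ^ capExponent α q := by
    rcases le_total (R ^ (α - 1) / s) 1 with h | h
    -- the blocks are single small caps
    · have : blockSize R α s = 1 := by rw [blockSize_eq hR hs0, max_eq_right h]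
      rw [this, one_mul]
      refine small.trans ?_
      gcongr
      · exact le_max_right _ _
    · have eb : blockSize R α s = R ^ (α - 1) / s := by rw [blockSize_eq hR hs0, max_eq_left h]
      have ebs : blockSize R α s * (R ^ α * s) = R ^ (2 * (α - 1 / 2)) := by
        rw [eb]
        have : R ^ (2 * (α - 1 / 2)) = R ^ (α - 1) * R ^ α := by
          rw [← Real.rpow_add hR0]; congr 1; ring
        rw [this]; field_simp
      have hpos : 0 < R ^ α * s := by positivity
      rcases le_total q 3 with hq3 | hq3
      · have e : blockSize R α s * (R ^ α * s) ^ (q - 2) =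
            (R ^ (2 * (α - 1 / 2))) ^ (q - 2) * blockSize R α s ^ (3 - q) := by
          rw [← ebs, Real.mul_rpow (by linarith) hpos.le]
          have : blockSize R α s = blockSize R α s ^ (q - 2) * blockSize R α s ^ (3 - q) := by
            rw [← Real.rpow_add (by linarith)]
            norm_num
          conv_lhs => rw [this]
          ring
        rw [e]
        calc (R ^ (2 * (α - 1 / 2))) ^ (q - 2) * blockSize R α s ^ (3 - q)
            ≤ (R ^ (2 * (α - 1 / 2))) ^ (q - 2) * (R ^ (α - 1 / 2)) ^ (3 - q) := by
              have := blockSize_le hR hα hs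
              gcongr
          _ = R ^ ((α - 1 / 2) * (q - 1)) := by
              rw [← Real.rpow_mul hR0.le, ← Real.rpow_mul hR0.le, ← Real.rpow_add hR0]
              congr 1; ring
          _ ≤ 1 * R ^ capExponent α q := by
              rw [one_mul]
              exact Real.rpow_le_rpow_of_exponent_le hR (le_max_left _ _)
          _ ≤ _ := by
              gcongr
              exact Real.one_le_rpow (by norm_num) hq2
      · have e : blockSize R α s * (R ^ α * s) ^ (q - 2) =
            R ^ (2 * (α - 1 / 2)) * (R ^ α * s) ^ (q - 3) := by
          rw [← ebs, mul_assoc]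
          congr 1
          rw [← Real.rpow_one_add' hpos.le (by linarith)]
          congr 1; ring
        rw [e]
        calc R ^ (2 * (α - 1 / 2)) * (R ^ α * s) ^ (q - 3)
            ≤ R ^ α * (R ^ α * 2) ^ (q - 3) := by
              gcongr
              · linarith
          _ = 2 ^ (q - 3) * R ^ (α * (q - 2)) := by
              rw [Real.mul_rpow hRα.le (by norm_num), ← Real.rpow_mul hR0.le, ← mul_assoc,
                ← Real.rpow_add hR0, mul_comm]
              congr 2; ring
          _ ≤ _ := by
              gcongr
              · norm_num
              · linarith
              · exact le_max_right _ _
  calc 3 * blockSize R α s * (5 * (R ^ α * s)) ^ (q - 2)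
      = 3 * 5 ^ (q - 2) * (blockSize R α s * (R ^ α * s) ^ (q - 2)) := by rw [e5]; ring
    _ ≤ 3 * 5 ^ (q - 2) * (2 ^ (q - 2) * R ^ capExponent α q) := by gcongr
    _ = 3 * 10 ^ (q - 2) * R ^ capExponent α q := by rw [e10]; ring
    _ ≤ _ := by gcongr

lemma capConstant_rpow (hR : 1 ≤ R) (hq : 1 ≤ q) :
    capConstant α (ENNReal.ofReal (2 * q)) R ^ (2 * q) = R ^ capExponent α q := by
  have hR0 : 0 < R := by linarith
  have hp : ((ENNReal.ofReal (2 * q))⁻¹).toReal = (2 * q)⁻¹ := by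
    rw [ENNReal.toReal_inv, ENNReal.toReal_ofReal (by linarith)]
  have hle : ENNReal.ofReal (4 * α + 2) ≤ ENNReal.ofReal (2 * q) ↔ 4 * α + 2 ≤ 2 * q :=
    ENNReal.ofReal_le_ofReal_iff (by linarith)
  unfold capConstant capExponent
  rw [hp]
  split_ifs with h
  · rw [hle] at h
    rw [← Real.rpow_mul hR0.le, max_eq_right (by nlinarith)]
    congr 1; field_simp
  · rw [hle, not_le] at h
    rw [← Real.rpow_mul hR0.le, max_eq_left (by nlinarith)]
    congr 1; field_simp

end Exponents

lemma capConstant_pos {α : ℝ} {p : ℝ≥0∞} {R : ℝ} (hR : 1 ≤ R) : 0 < capConstant α p R := by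
  have hR0 : 0 < R := by linarith
  unfold capConstant
  split_ifs <;> exact Real.rpow_pos_of_pos hR0 _

/-! ### The upper bound for finite exponents -/

/-- The upper bound obtained from `m` broad–narrow steps with parameter `K₀`. -/
lemma exists_upper_steps (M : ℝ) (hM : 0 ≤ M) : ∃ C : ℝ≥0∞, C ≠ ⊤ ∧ 1 ≤ C ∧
    ∀ {n : ℕ} {f : Fin n → 𝓢(Plane, ℂ)} {a : Fin n → ℝ} {α R q : ℝ} {K₀ m : ℕ},
      1 / 2 ≤ α → α ≤ 1 → 1 ≤ R → IsSeparated a (R ^ α) → HasCapSupport f a (R ^ α) R M →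
      (∀ i, -1 ≤ a i) → (∀ i, a i < 1) → 1 ≤ K₀ → (K₀ : ℝ) ^ m ≤ R ^ (1 / 2 : ℝ) →
      R ^ (1 / 2 : ℝ) < (K₀ : ℝ) ^ (m + 1) → 1 ≤ q →
      ∫⁻ y, (‖capSum Finset.univ f y‖ₑ ^ 2) ^ q ≤
        ((m + 1) * 36 ^ m * (C * K₀ ^ 6)) ^ q * ENNReal.ofReal (R ^ capExponent α q) *
          ∫⁻ y, sqSum Finset.univ f y ^ q := by
  obtain ⟨C₁, hC₁t, hC₁1, hC₁⟩ := exists_bilinear_cap M hM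
  obtain ⟨C₂, hC₂t, hC₂1, hC₂⟩ := exists_linear_cap M hM
  refine ⟨4 * 30 * C₁ + 10 * C₂, by finiteness, ?_, ?_⟩
  · calc (1 : ℝ≥0∞) ≤ C₁ := hC₁1
      _ ≤ 4 * 30 * C₁ := le_mul_of_one_le_left' (by norm_num)
      _ ≤ _ := le_self_add
  intro n f a α R q K₀ m hα hα1 hR hsep hsupp ha ha1 hK₀ hm hm' hq
  have hR0 : 0 < R := by linarith
  have hq0 : 0 ≤ q := by linarith
  have hKpos : 0 < R ^ α := Real.rpow_pos_of_pos hR0 _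
  have hK₀' : (1 : ℝ) ≤ K₀ := by exact_mod_cast hK₀
  have hK₀e : (1 : ℝ≥0∞) ≤ K₀ := by exact_mod_cast hK₀
  have hneg : R ^ (-(1 / 2) : ℝ) = (R ^ (1 / 2 : ℝ))⁻¹ := Real.rpow_neg hR0.le _
  have hhalf : 0 < R ^ (1 / 2 : ℝ) := Real.rpow_pos_of_pos hR0 _
  have hsj : ∀ j ≤ m, R ^ (-(1 / 2) : ℝ) ≤ 2 / (K₀ : ℝ) ^ j := fun j hj => by
    have h1 : (K₀ : ℝ) ^ j ≤ R ^ (1 / 2 : ℝ) := (pow_le_pow_right₀ hK₀' hj).trans hm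
    rw [hneg, inv_eq_one_div]
    gcongr
    norm_num
  have hsj2 : ∀ j, 2 / (K₀ : ℝ) ^ j ≤ 2 := fun j =>
    div_le_self (by norm_num) (one_le_pow₀ hK₀')
  have hKs : ∀ j ≤ m, 1 ≤ R ^ α * (2 / (K₀ : ℝ) ^ j) := fun j hj => by
    calc (1 : ℝ) = R ^ (1 / 2 : ℝ) * R ^ (-(1 / 2) : ℝ) := by
          rw [hneg]; field_simp
      _ ≤ R ^ α * (2 / (K₀ : ℝ) ^ j) := by
          gcongr
          · exact hsj j hj
  have hdata : ∀ j ≤ m, ∀ k : ℕ, CapData f a (R ^ α) R M (2 / (K₀ : ℝ) ^ j)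
      (2 * k / (K₀ : ℝ) ^ j - 1) (cell a K₀ j k) := fun j hj k =>
    capData_cell hKpos hR0 hM hsep hsupp ha hK₀ j k (hKs j hj)
  set Ξ := ENNReal.ofReal (R ^ capExponent α q) with hΞ
  set X : ℝ≥0∞ := (C₁ * K₀ ^ 2) ^ q * (30 ^ q * Ξ) with hX
  set Y : ℝ≥0∞ := ((4 * 30 * C₁ + 10 * C₂) * K₀ ^ 6) ^ q * Ξ with hY
  have hbil : ∀ j < m, ∀ k, ∀ l ∈ farPairs K₀,
      ∫⁻ y, (‖capSum (cell a K₀ (j + 1) (K₀ * k + l.1)) f y‖ₑ *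
      ‖capSum (cell a K₀ (j + 1) (K₀ * k + l.2)) f y‖ₑ) ^ q ≤
        X * ∫⁻ y, sqSum (cell a K₀ j k) f y ^ q := by
    intro j hj k l hl
    obtain ⟨hl1, hl2⟩ := Finset.mem_filter.1 hl
    obtain ⟨hl3, hl4⟩ := Finset.mem_product.1 hl1
    have hsep2 : ∀ i ∈ cell a K₀ (j + 1) (K₀ * k + l.1), ∀ i' ∈ cell a K₀ (j + 1) (K₀ * k + l.2),
        2 / (K₀ : ℝ) ^ (j + 1) ≤ a i - a i' := by
      intro i hi i' hi'
      have h1 := (cell_bounds ha hi).1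
      have h2 := (cell_bounds ha hi').2
      have h3 : ((l.2 + 2 : ℕ) : ℝ) ≤ l.1 := by exact_mod_cast hl2
      push_cast at h1 h2 h3
      rw [div_le_iff₀ (by positivity)]
      linarith
    have := hC₁ (hdata j hj.le k) _ _ (2 / (K₀ : ℝ) ^ (j + 1)) K₀
      (cell_subset hK₀ (Finset.mem_range.1 hl3)) (cell_subset hK₀ (Finset.mem_range.1 hl4))
      hK₀ (by positivity) (le_of_eq (by rw [pow_succ]; field_simp)) hsep2 q
      (30 ^ q * R ^ capExponent α q) hq
      (fun _ => rpow_blockSize_le hR hα (hsj j hj.le) hq)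
      (fun h2 => blockSize_mul_rpow_le hR hα hα1 (hsj j hj.le) (hsj2 j) h2)
    rw [ENNReal.ofReal_mul (by positivity), ← ENNReal.ofReal_rpow_of_pos (by norm_num)] at this
    simpa [hX, hΞ] using this
  -- the broad part of each step loses no more than the linear estimate at the last scale
  have hXY : (4 * (K₀ : ℝ≥0∞) ^ 2) ^ q * (K₀ ^ 2 * X) ≤ Y := by
    have h1 : (K₀ : ℝ≥0∞) ^ 2 ≤ ((K₀ : ℝ≥0∞) ^ 2) ^ q := by
      conv_lhs => rw [← ENNReal.rpow_one ((K₀ : ℝ≥0∞) ^ 2)]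
      exact ENNReal.rpow_le_rpow_of_exponent_le (one_le_pow_of_one_le' hK₀e 2) hq
    calc _ ≤ (4 * (K₀ : ℝ≥0∞) ^ 2) ^ q * (((K₀ : ℝ≥0∞) ^ 2) ^ q * X) := by gcongr
      _ = (4 * 30 * C₁ * K₀ ^ 6) ^ q * Ξ := by
          rw [hX]
          have : (4 * 30 * C₁ * (K₀ : ℝ≥0∞) ^ 6) =
            (4 * (K₀ : ℝ≥0∞) ^ 2) * ((K₀ : ℝ≥0∞) ^ 2 * ((C₁ * K₀ ^ 2) * 30)) := by ring
          rw [this, ENNReal.mul_rpow_of_nonneg (4 * (K₀ : ℝ≥0∞) ^ 2) _ hq0,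
            ENNReal.mul_rpow_of_nonneg ((K₀ : ℝ≥0∞) ^ 2) (C₁ * K₀ ^ 2 * 30) hq0,
            ENNReal.mul_rpow_of_nonneg (C₁ * (K₀ : ℝ≥0∞) ^ 2) 30 hq0]
          ring
      _ ≤ Y := by
          rw [hY]
          gcongr
          exact le_self_add
  have hlin : ∀ k, ∫⁻ y, (‖capSum (cell a K₀ m k) f y‖ₑ ^ 2) ^ q ≤
        Y * ∫⁻ y, sqSum (cell a K₀ m k) f y ^ q := by
    intro k
    refine (hC₂ (hdata m le_rfl k) q hq).trans ?_
    gcongr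
    have hs : 2 / (K₀ : ℝ) ^ m ≤ 2 * K₀ * R ^ (-(1 / 2) : ℝ) := by
      rw [hneg, div_le_iff₀ (by positivity)]
      have : R ^ (1 / 2 : ℝ) ≤ K₀ * (K₀ : ℝ) ^ m := by rw [← pow_succ']; exact hm'.le
      calc (2 : ℝ) = 2 * R ^ (1 / 2 : ℝ) * (R ^ (1 / 2 : ℝ))⁻¹ := by field_simp
        _ ≤ 2 * (K₀ * (K₀ : ℝ) ^ m) * (R ^ (1 / 2 : ℝ))⁻¹ := by gcongr
        _ = _ := by ring
    have h1 := ENNReal.ofReal_le_ofReal (rpow_linear_le (α := α) hR (by positivity) hK₀' hs hq)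
    have h10 : ENNReal.ofReal ((10 * (K₀ : ℝ)) ^ q) = (ENNReal.ofReal 10 * K₀) ^ q := by
      rw [← ENNReal.ofReal_rpow_of_pos (by positivity), ENNReal.ofReal_mul (by norm_num),
        ENNReal.ofReal_natCast]
    rw [ENNReal.ofReal_mul (by positivity : 0 ≤ (10 * (K₀ : ℝ)) ^ q), h10, ← hΞ] at h1
    calc _ ≤ C₂ ^ q * ((ENNReal.ofReal 10 * K₀) ^ q * Ξ) := by gcongr
      _ = (10 * C₂ * K₀) ^ q * Ξ := by
          rw [← mul_assoc, ← ENNReal.mul_rpow_of_nonneg _ _ hq0, ENNReal.ofReal_ofNat]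
          congr 2; ring
      _ ≤ Y := by
          rw [hY]
          gcongr
          · exact le_add_self
          · exact le_self_pow hK₀e (by norm_num)
  have key := lintegral_cell_le_of_steps hK₀ hq hbil hXY hlin m 0 (by omega) 0
  have huniv : cell a K₀ 0 0 = Finset.univ := by
    ext i
    simp only [cell, cellIndex, Finset.mem_filter, Finset.mem_univ, true_and, pow_zero, mul_one,
      iff_true, Nat.floor_eq_zero]
    linarith [ha1 i]
  rw [huniv] at key
  refine key.trans ?_
  refine mul_le_mul_left ?_ _
  have h36 : ((36 : ℝ≥0∞) ^ q) ^ m = (36 ^ m) ^ q := by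
    rw [← ENNReal.rpow_natCast, ← ENNReal.rpow_mul, mul_comm, ENNReal.rpow_mul,
      ENNReal.rpow_natCast]
  have hm1 : ((m : ℝ≥0∞) + 1) ≤ ((m : ℝ≥0∞) + 1) ^ q := by
    conv_lhs => rw [← ENNReal.rpow_one ((m : ℝ≥0∞) + 1)]
    exact ENNReal.rpow_le_rpow_of_exponent_le le_add_self hq
  calc (m + 1) * ((36 : ℝ≥0∞) ^ q) ^ m * Y
      = (m + 1) * (((36 : ℝ≥0∞) ^ m) ^ q * ((4 * 30 * C₁ + 10 * C₂) * K₀ ^ 6) ^ q * Ξ) := by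
        rw [h36, hY]; ring
    _ ≤ ((m : ℝ≥0∞) + 1) ^ q *
          (((36 : ℝ≥0∞) ^ m) ^ q * ((4 * 30 * C₁ + 10 * C₂) * K₀ ^ 6) ^ q * Ξ) :=
        mul_le_mul_left hm1 _
    _ = _ := by
        rw [mul_assoc ((m : ℝ≥0∞) + 1), ENNReal.mul_rpow_of_nonneg ((m : ℝ≥0∞) + 1) _ hq0,
          ENNReal.mul_rpow_of_nonneg ((36 : ℝ≥0∞) ^ m) _ hq0]
        ring

/-! ### Small caps and their frequency pieces -/

section Frame

variable {α R c : ℝ}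

lemma capFrame_inv_smul (hR : 0 < R) (ξ : Plane) :
    capFrame α R c !₂[R ^ α * (ξ 0 - c), R * (ξ 1 - c ^ 2 - 2 * c * (ξ 0 - c))] = ξ := by
  have hα : R ^ (-α) * R ^ α = 1 := by rw [← Real.rpow_add hR]; simp
  ext k
  fin_cases k
  · simp [capFrame, ← mul_assoc, hα]
  · simp [capFrame, ← mul_assoc, hα, inv_mul_cancel₀ hR.ne']

lemma continuous_capFrame : Continuous (capFrame α R c) := by
  have : ContDiff ℝ ∞ (capFrame α R c) := by
    refine contDiff_euclidean.2 fun k => ?_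
    fin_cases k <;> simp [capFrame] <;> fun_prop
  exact this.continuous

variable {M : ℝ} {B : ℕ → ℝ} {ψ : Plane → ℝ}

lemma IsAdaptedBump.smooth (h : IsAdaptedBump α R c M B ψ) (hR : 0 < R) : ContDiff ℝ ∞ ψ := by
  have h1 : ContDiff ℝ ∞ (fun ξ : Plane =>
      (!₂[R ^ α * (ξ 0 - c), R * (ξ 1 - c ^ 2 - 2 * c * (ξ 0 - c))] : Plane)) := by
    refine contDiff_euclidean.2 fun k => ?_
    fin_cases k <;> simp <;> fun_prop
  have h2 := h.contDiff.comp h1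
  convert h2 using 1
  ext ξ
  simp only [Function.comp_apply, capFrame_inv_smul hR]

lemma IsAdaptedBump.hasCompactSupport (h : IsAdaptedBump α R c M B ψ) (hR : 0 < R) :
    HasCompactSupport ψ := by
  refine HasCompactSupport.of_support_subset_isCompact
    ((isCompact_closedBall (0 : Plane) M).image (continuous_capFrame (α := α) (R := R) (c := c)))
    fun ξ hξ => ?_
  rw [← capFrame_inv_smul (α := α) (c := c) hR ξ] at hξ ⊢
  exact ⟨_, by simpa using h.support _ hξ, rfl⟩

lemma IsAdaptedBump.abs_le (h : IsAdaptedBump α R c M B ψ) (hR : 0 < R) (ξ : Plane) :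
    |ψ ξ| ≤ B 0 := by
  have := h.bound 0 !₂[R ^ α * (ξ 0 - c), R * (ξ 1 - c ^ 2 - 2 * c * (ξ 0 - c))]
  rwa [norm_iteratedFDeriv_zero, Function.comp_apply, capFrame_inv_smul hR] at this

lemma IsAdaptedBump.abs_sub_le (h : IsAdaptedBump α R c M B ψ) (hR : 0 < R) {ξ : Plane}
    (hξ : ψ ξ ≠ 0) :
    |ξ 0 - c| ≤ M * (R ^ α)⁻¹ ∧ |ξ 1 - c ^ 2 - 2 * c * (ξ 0 - c)| ≤ M * R⁻¹ := by
  have hK : 0 < R ^ α := Real.rpow_pos_of_pos hR α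
  rw [← capFrame_inv_smul (α := α) (c := c) hR ξ] at hξ
  have hy := h.support _ hξ
  constructor
  · have := (abs_apply_le_norm _ 0).trans hy
    simp only [Matrix.cons_val_zero, abs_mul, abs_of_pos hK] at this
    rwa [← div_eq_mul_inv, le_div_iff₀' hK]
  · have := (abs_apply_le_norm _ 1).trans hy
    simp only [Matrix.cons_val_one, Matrix.cons_val_zero, abs_mul,
      abs_of_pos hR] at this
    rwa [← div_eq_mul_inv, le_div_iff₀' hR]

/-- The frequency pieces of a Schwartz function are Schwartz functions. -/
lemma IsAdaptedBump.exists_schwartz (h : IsAdaptedBump α R c M B ψ) (hR : 0 < R)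
    (f : 𝓢(Plane, ℂ)) :
    ∃ g : 𝓢(Plane, ℂ), ⇑g = capPiece ψ f ∧ ∀ ξ, 𝓕 g ξ = ψ ξ * 𝓕 (f : Plane → ℂ) ξ := by
  have hc : HasCompactSupport fun ξ : Plane => (ψ ξ : ℂ) * 𝓕 f ξ := by
    refine HasCompactSupport.mul_right ?_
    exact (h.hasCompactSupport hR).comp_left (g := fun x : ℝ => (x : ℂ)) Complex.ofReal_zero
  have hs : ContDiff ℝ ∞ fun ξ : Plane => (ψ ξ : ℂ) * 𝓕 f ξ :=
    (Complex.ofRealCLM.contDiff.comp (h.smooth hR)).mul ((𝓕 f).smooth _)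
  refine ⟨𝓕⁻ (hc.toSchwartzMap hs), ?_, fun ξ => ?_⟩
  · rw [fourierInv_coe]
    rfl
  · rw [FourierTransform.fourier_fourierInv_eq]
    rfl

end Frame

section Partition

variable {α R : ℝ}

lemma CapPartition.mul_sub_le (P : CapPartition α R) {i j : Fin (P.n + 1)} (h : j ≤ i) :
    (((i : ℕ) : ℝ) - (j : ℕ)) * (R ^ (-α) / 2) ≤ P.t i - P.t j := by
  have hmono : Monotone fun i : Fin (P.n + 1) => P.t i - ((i : ℕ) : ℝ) * (R ^ (-α) / 2) := by
    refine Fin.monotone_iff_le_succ.2 fun i => ?_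
    have := P.le_length i
    simp only [Fin.val_castSucc, Fin.val_succ]
    push_cast
    linarith
  have := hmono h
  simp only at this
  linarith

lemma CapPartition.card_le (P : CapPartition α R) (hR : 0 < R) : (P.n : ℝ) ≤ 4 * R ^ α := by
  have h := P.mul_sub_le (Fin.le_last 0)
  rw [P.t_first, P.t_last, Real.rpow_neg hR.le] at h
  have hK : 0 < R ^ α := Real.rpow_pos_of_pos hR α
  simp only [Fin.val_last, Fin.val_zero, Nat.cast_zero, sub_zero] at h
  field_simp at h
  linarith

lemma CapPartition.monotone (P : CapPartition α R) (hR : 0 < R) : Monotone P.t := fun i j h => by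
  have h1 := P.mul_sub_le h
  have h2 : 0 < R ^ (-α) := Real.rpow_pos_of_pos hR _
  have h3 : ((i : ℕ) : ℝ) ≤ (j : ℕ) := by exact_mod_cast h
  have : 0 ≤ (((j : ℕ) : ℝ) - (i : ℕ)) * (R ^ (-α) / 2) := by
    apply mul_nonneg <;> linarith
  linarith

lemma CapPartition.neg_one_le_center (P : CapPartition α R) (hR : 0 < R) (i : Fin P.n) :
    -1 ≤ P.center i := by
  have h1 := P.monotone hR (Fin.zero_le i.castSucc)
  have h2 := P.monotone hR (Fin.zero_le i.succ)
  rw [P.t_first] at h1 h2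
  unfold CapPartition.center
  linarith

lemma CapPartition.center_lt_one (P : CapPartition α R) (hR : 0 < R) (i : Fin P.n) :
    P.center i < 1 := by
  have h1 := P.monotone hR (Fin.le_last i.succ)
  have h2 := P.le_length i
  have h3 : 0 < R ^ (-α) := Real.rpow_pos_of_pos hR _
  rw [P.t_last] at h1
  unfold CapPartition.center
  linarith

lemma CapPartition.isSeparated_center (P : CapPartition α R) (hR : 0 < R) :
    IsSeparated P.center (R ^ α) := by
  have hK : 0 < R ^ α := Real.rpow_pos_of_pos hR α
  intro i j
  rcases le_total i j with h | h
  · have : ((i : ℕ) : ℝ) ≤ (j : ℕ) := by exact_mod_cast h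
    have : 0 ≤ 2 * R ^ α * |P.center i - P.center j| := by positivity
    linarith
  · have h1 := P.mul_sub_le (Fin.castSucc_le_castSucc_iff.2 h)
    have h2 := P.mul_sub_le (Fin.succ_le_succ_iff.2 h)
    simp only [Fin.val_castSucc, Fin.val_succ, Nat.cast_add, Nat.cast_one] at h1 h2
    have h3 : (((i : ℕ) : ℝ) - (j : ℕ)) * (R ^ (-α) / 2) ≤ P.center i - P.center j := by
      unfold CapPartition.center
      linarith
    rw [Real.rpow_neg hR.le] at h3
    calc ((i : ℕ) : ℝ) - (j : ℕ)
        = 2 * R ^ α * ((((i : ℕ) : ℝ) - (j : ℕ)) * ((R ^ α)⁻¹ / 2)) := by field_simp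
      _ ≤ 2 * R ^ α * |P.center i - P.center j| := by
          gcongr
          exact h3.trans (le_abs_self _)

variable {M : ℝ} {B : ℕ → ℝ} {P : CapPartition α R} {ψ : Fin P.n → Plane → ℝ}

/-- The pieces of a Schwartz function as Schwartz functions. A negative `M` is replaced by `0`. -/
lemma IsCapPartitionOfUnity.exists_pieces (h : IsCapPartitionOfUnity P M B ψ) (hR : 0 < R)
    (f : 𝓢(Plane, ℂ)) :
    ∃ g : Fin P.n → 𝓢(Plane, ℂ), (∀ i, ⇑(g i) = capPiece (ψ i) f) ∧
      (∀ i ξ, 𝓕 (g i) ξ = ψ i ξ * 𝓕 (f : Plane → ℂ) ξ) ∧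
      HasCapSupport g P.center (R ^ α) R (max M 0) := by
  choose g hg1 hg2 using fun i => (h.adapted i).exists_schwartz hR f
  refine ⟨g, hg1, hg2, fun i ξ hξ => ?_⟩
  rw [hg2] at hξ
  have hK : 0 < R ^ α := Real.rpow_pos_of_pos hR α
  have hψ : ψ i ξ ≠ 0 := fun h0 => hξ (by simp [h0])
  obtain ⟨h1, h2⟩ := (h.adapted i).abs_sub_le hR hψ
  exact ⟨h1.trans (by gcongr; exact le_max_left _ _), h2.trans (by gcongr; exact le_max_left _ _)⟩

lemma IsCapPartitionOfUnity.eq_capSum (h : IsCapPartitionOfUnity P M B ψ) {f : 𝓢(Plane, ℂ)}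
    {g : Fin P.n → 𝓢(Plane, ℂ)} (hg : ∀ i ξ, 𝓕 (g i) ξ = ψ i ξ * 𝓕 (f : Plane → ℂ) ξ)
    (hf : tsupport (𝓕 (f : Plane → ℂ)) ⊆ parabolaNhd R) : f = capSum Finset.univ g := by
  have key : 𝓕 f = 𝓕 (capSum Finset.univ g) := by
    ext ξ
    have h1 : 𝓕 (capSum Finset.univ g) = ∑ i, 𝓕 (g i) := by
      unfold capSum
      exact map_sum (fourierCLM ℂ 𝓢(Plane, ℂ)) _ _
    rw [h1, sum_apply, Finset.sum_congr rfl fun i _ => hg i ξ, ← Finset.sum_mul,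
      ← Complex.ofReal_sum]
    by_cases h0 : 𝓕 (f : Plane → ℂ) ξ = 0
    · rw [h0, mul_zero]; exact h0
    · rw [h.sum_eq_one ξ (hf (subset_tsupport _ h0)), Complex.ofReal_one, one_mul]
      rfl
  have := congrArg (fun u : 𝓢(Plane, ℂ) => (𝓕⁻ u : 𝓢(Plane, ℂ))) key
  simpa only [FourierTransform.fourierInv_fourier_eq] using this

lemma enorm_squareFunction_sq {n : ℕ} {ψ : Fin n → Plane → ℝ} {f : 𝓢(Plane, ℂ)}
    {g : Fin n → 𝓢(Plane, ℂ)} (hg : ∀ i, ⇑(g i) = capPiece (ψ i) f) (x : Plane) :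
    ‖squareFunction ψ f x‖ₑ ^ 2 = sqSum Finset.univ g x := by
  unfold squareFunction sqSum
  rw [Real.enorm_of_nonneg (Real.sqrt_nonneg _), ← ENNReal.ofReal_pow (Real.sqrt_nonneg _),
    Real.sq_sqrt (by positivity), ENNReal.ofReal_sum_of_nonneg fun i _ => by positivity]
  refine Finset.sum_congr rfl fun i _ => ?_
  rw [hg, ENNReal.ofReal_pow (norm_nonneg _), ofReal_norm]

end Partition

/-! ### The square function estimate -/

/-- A choice of the number of steps and of the ratio of consecutive scales, for which the loss in
the iteration is a small power of `R`. -/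
lemma exists_steps {δ R : ℝ} (hδ : 0 < δ) (hR : 1 ≤ R) : ∃ K₀ m : ℕ,
    1 ≤ K₀ ∧ (K₀ : ℝ) ^ m ≤ R ^ (1 / 2 : ℝ) ∧ R ^ (1 / 2 : ℝ) < (K₀ : ℝ) ^ (m + 1) ∧
      m ≤ ⌈1 / (2 * δ)⌉₊ ∧ (K₀ : ℝ) ≤ 3 * R ^ δ := by
  have hR0 : 0 < R := by linarith
  have h1 : 1 ≤ R ^ δ := Real.one_le_rpow hR hδ.le
  have hle : R ^ δ ≤ (⌈R ^ δ⌉₊ + 1 : ℕ) := by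
    push_cast
    linarith [Nat.le_ceil (R ^ δ)]
  have h2 : (1 : ℝ) < (⌈R ^ δ⌉₊ + 1 : ℕ) := by
    push_cast
    linarith [Nat.le_ceil (R ^ δ)]
  obtain ⟨m, hm, hm'⟩ := exists_nat_pow_near (Real.one_le_rpow hR (by norm_num : (0:ℝ) ≤ 1 / 2)) h2
  refine ⟨⌈R ^ δ⌉₊ + 1, m, by omega, hm, hm', ?_, ?_⟩
  · rcases hR.eq_or_lt with rfl | hR1
    · rw [Real.one_rpow (1 / 2)] at hm
      have : m = 0 := by
        by_contra h0
        exact absurd hm (not_le.2 (one_lt_pow₀ h2 h0))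
      omega
    · have h3 : R ^ (δ * m) ≤ R ^ (1 / 2 : ℝ) := by
        rw [Real.rpow_mul hR0.le, Real.rpow_natCast]
        exact (pow_le_pow_left₀ (by linarith) hle m).trans hm
      rw [Real.rpow_le_rpow_left_iff hR1] at h3
      have h4 : (m : ℝ) ≤ 1 / (2 * δ) := by
        rw [le_div_iff₀ (by positivity)]
        linarith
      exact_mod_cast h4.trans (Nat.le_ceil _)
  · push_cast
    linarith [Nat.ceil_lt_add_one (zero_le_one.trans h1)]

lemma lintegral_enorm_rpow_two_mul {f : Plane → ℂ} {q : ℝ} :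
    ∫⁻ x, ‖f x‖ₑ ^ (2 * q) = ∫⁻ x, (‖f x‖ₑ ^ 2) ^ q := by
  simp_rw [ENNReal.rpow_mul, ENNReal.rpow_two]

/-- The square function estimate. -/
theorem exists_squareFunction_bound (M : ℝ) {ε : ℝ} (hε : 0 < ε) : ∃ C : ℝ, 0 < C ∧
    ∀ {B : ℕ → ℝ} {α : ℝ} {p : ℝ≥0∞} {R : ℝ}, 1 / 2 ≤ α → α ≤ 1 → 2 ≤ p → 1 ≤ R →
      ∀ {P : CapPartition α R} {ψ : Fin P.n → Plane → ℝ}, IsCapPartitionOfUnity P M B ψ →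
      ∀ f : 𝓢(Plane, ℂ), tsupport (𝓕 (f : Plane → ℂ)) ⊆ parabolaNhd R →
        eLpNorm f p volume ≤ ENNReal.ofReal (C * R ^ ε * capConstant α p R) *
          eLpNorm (squareFunction ψ f) p volume := by
  obtain ⟨C, hCt, hC1, hC⟩ := exists_upper_steps (max M 0) (le_max_right _ _)
  set N := ⌈1 / (2 * (ε / 3))⌉₊ with hN
  set D : ℝ := (N + 1) * 36 ^ N * (C.toReal * 3 ^ 6) with hD
  have hD0 : 0 ≤ D := by positivity
  refine ⟨Real.sqrt D + 2, by positivity, ?_⟩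
  intro B α p R hα hα1 hp hR P ψ hψ f hf
  have hR0 : 0 < R := by linarith
  have hRε : 1 ≤ R ^ ε := Real.one_le_rpow hR hε.le
  obtain ⟨g, hg1, hg2, hg3⟩ := hψ.exists_pieces hR0 f
  have hfg := hψ.eq_capSum hg2 hf
  have hcap := capConstant_pos (α := α) (p := p) hR
  rcases eq_or_ne p ⊤ with rfl | hpt
  · -- for `p = ∞` the pointwise Cauchy–Schwarz inequality suffices
    have hcc : capConstant α ⊤ R = R ^ (α / 2) := by
      simp only [capConstant, le_top, if_true, ENNReal.inv_top, ENNReal.toReal_zero]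
      congr 1; ring
    refine eLpNorm_le_mul_eLpNorm_of_ae_le_mul (Filter.Eventually.of_forall fun x => ?_) _
    have h1 : ‖f x‖ ^ 2 ≤ P.n * ‖squareFunction ψ f x‖ ^ 2 := by
      have := enorm_capSum_sq_le (subset_refl (Finset.univ : Finset (Fin P.n))) g x
      rw [← hfg, ← enorm_squareFunction_sq hg1, Finset.card_univ, Fintype.card_fin] at this
      have h2 := ENNReal.toReal_mono (by finiteness) this
      simpa using h2
    have h2 : (P.n : ℝ) ≤ (2 * R ^ (α / 2)) ^ 2 := by
      have : (2 * R ^ (α / 2)) ^ 2 = 4 * R ^ α := by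
        rw [mul_pow, ← Real.rpow_natCast (R ^ (α / 2)), ← Real.rpow_mul hR0.le]
        norm_num
      rw [this]
      exact P.card_le hR0
    have h3 : ‖f x‖ ≤ 2 * R ^ (α / 2) * ‖squareFunction ψ f x‖ := by
      refine abs_le_of_sq_le_sq' ?_ (by positivity) |>.2
      rw [mul_pow]
      exact h1.trans (by gcongr)
    refine h3.trans ?_
    rw [hcc]
    gcongr
    nlinarith [Real.sqrt_nonneg D]
  · set q := p.toReal / 2 with hq
    have hp2 : 2 ≤ p.toReal := by
      simpa using ENNReal.toReal_mono hpt hp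
    have hq1 : 1 ≤ q := by rw [hq]; linarith
    have hq0 : 0 ≤ q := by linarith
    have hpq : p.toReal = 2 * q := by rw [hq]; ring
    have hp' : p = ENNReal.ofReal (2 * q) := by rw [← hpq, ENNReal.ofReal_toReal hpt]
    have hp0 : p ≠ 0 := (lt_of_lt_of_le (by norm_num) hp).ne'
    obtain ⟨K₀, m, hK₀, hm, hm', hmN, hK₀R⟩ := exists_steps (δ := ε / 3) (by positivity) hR
    have key := hC hα hα1 hR (P.isSeparated_center hR0) hg3 (P.neg_one_le_center hR0)
      (P.center_lt_one hR0) hK₀ hm hm' hq1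
    rw [← hfg] at key
    have hQ : ((m + 1) * 36 ^ m * (C * K₀ ^ 6) : ℝ≥0∞) ≤
        ENNReal.ofReal (Real.sqrt D * R ^ ε) ^ (2 : ℝ) := by
      have e1 : ((m + 1) * 36 ^ m * (C * K₀ ^ 6) : ℝ≥0∞) =
          ENNReal.ofReal ((m + 1) * 36 ^ m * (C.toReal * K₀ ^ 6)) := by
        rw [ENNReal.ofReal_mul (by positivity), ENNReal.ofReal_mul (by positivity),
          ENNReal.ofReal_mul (by positivity), ENNReal.ofReal_toReal hCt,
          ENNReal.ofReal_add (by positivity) zero_le_one, ENNReal.ofReal_natCast,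
          ENNReal.ofReal_one, ENNReal.ofReal_pow (by positivity),
          ENNReal.ofReal_pow (by positivity),
          ENNReal.ofReal_natCast, ENNReal.ofReal_ofNat]
      have e2 : (3 * R ^ (ε / 3)) ^ 6 = 3 ^ 6 * (R ^ ε) ^ 2 := by
        rw [mul_pow, ← Real.rpow_natCast (R ^ (ε / 3)), ← Real.rpow_mul hR0.le,
          ← Real.rpow_natCast (R ^ ε), ← Real.rpow_mul hR0.le]
        congr 2; push_cast; ring
      rw [e1, ENNReal.rpow_two, ← ENNReal.ofReal_pow (by positivity)]
      refine ENNReal.ofReal_le_ofReal ?_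
      rw [mul_pow, Real.sq_sqrt hD0]
      calc ((m : ℝ) + 1) * 36 ^ m * (C.toReal * K₀ ^ 6)
          ≤ (N + 1) * 36 ^ N * (C.toReal * (3 * R ^ (ε / 3)) ^ 6) := by
            gcongr
            norm_num
        _ = D * (R ^ ε) ^ 2 := by rw [e2, hD]; ring
    have hS : ∫⁻ x, sqSum Finset.univ g x ^ q =
        ∫⁻ x, ‖squareFunction ψ f x‖ₑ ^ (2 * q) := by
      simp_rw [← enorm_squareFunction_sq hg1, ENNReal.rpow_mul, ENNReal.rpow_two]
    rw [eLpNorm_eq_lintegral_rpow_enorm_toReal hp0 hpt,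
      eLpNorm_eq_lintegral_rpow_enorm_toReal hp0 hpt, hpq, lintegral_enorm_rpow_two_mul]
    rw [hS] at key
    have hcc : ENNReal.ofReal (R ^ capExponent α q) =
        ENNReal.ofReal (capConstant α p R) ^ (2 * q) := by
      rw [ENNReal.ofReal_rpow_of_pos hcap, hp', capConstant_rpow hR hq1]
    have h2q : 0 < 2 * q := by linarith
    calc (∫⁻ x, (‖f x‖ₑ ^ 2) ^ q) ^ (1 / (2 * q))
        ≤ ((ENNReal.ofReal (Real.sqrt D * R ^ ε) ^ (2 : ℝ)) ^ q *
            ENNReal.ofReal (capConstant α p R) ^ (2 * q) *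
            ∫⁻ x, ‖squareFunction ψ f x‖ₑ ^ (2 * q)) ^ (1 / (2 * q)) := by
          rw [← hcc]
          refine ENNReal.rpow_le_rpow (key.trans ?_) (by positivity)
          gcongr
      _ = ENNReal.ofReal (Real.sqrt D * R ^ ε * capConstant α p R) *
            (∫⁻ x, ‖squareFunction ψ f x‖ₑ ^ (2 * q)) ^ (1 / (2 * q)) := by
          rw [← ENNReal.rpow_mul, ← ENNReal.mul_rpow_of_nonneg _ _ h2q.le,
            ENNReal.mul_rpow_of_nonneg _ _ (by positivity), ← ENNReal.rpow_mul,
            mul_one_div_cancel h2q.ne', ENNReal.rpow_one, ← ENNReal.ofReal_mul (by positivity)]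
      _ ≤ _ := by
          gcongr
          linarith

/-! ### Strips around the parabola -/

/-- The vertical neighborhood of width `b` of the part of the parabola over `T`. -/
def parabolaStrip (T : Set ℝ) (b : ℝ) : Set Plane := {ξ | ξ 0 ∈ T ∧ |ξ 1 - ξ 0 ^ 2| ≤ b}

lemma measurableSet_parabolaStrip {T : Set ℝ} (hT : MeasurableSet T) (b : ℝ) :
    MeasurableSet (parabolaStrip T b) :=
  (hT.preimage (f := fun ξ : Plane => ξ 0) (by fun_prop)).inter
    (measurableSet_le (f := fun ξ : Plane => |ξ 1 - ξ 0 ^ 2|) (by fun_prop) measurable_const)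

lemma volume_plane {E : Set Plane} (hE : MeasurableSet E) :
    volume E = ∫⁻ s, volume {t : ℝ | (!₂[s, t] : Plane) ∈ E} := by
  have h := (PiLp.volume_preserving_toLp (Fin 2)).comp
    ((volume_preserving_finTwoArrow ℝ).symm)
  rw [← h.measure_preimage hE.nullMeasurableSet, Measure.volume_eq_prod,
    Measure.prod_apply (h.measurable hE)]
  rfl

lemma volume_parabolaStrip {T : Set ℝ} (hT : MeasurableSet T) {b : ℝ} :
    volume (parabolaStrip T b) = ENNReal.ofReal (2 * b) * volume T := by
  rw [volume_plane (measurableSet_parabolaStrip hT b)]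
  have h : ∀ s : ℝ, volume {t : ℝ | (!₂[s, t] : Plane) ∈ parabolaStrip T b} =
      T.indicator (fun _ => ENNReal.ofReal (2 * b)) s := by
    intro s
    by_cases hs : s ∈ T
    · have : {t : ℝ | (!₂[s, t] : Plane) ∈ parabolaStrip T b} =
          Set.Icc (s ^ 2 - b) (s ^ 2 + b) := by
        ext t
        change s ∈ T ∧ |t - s ^ 2| ≤ b ↔ _
        rw [abs_le, Set.mem_Icc]
        constructor
        · rintro ⟨_, h1, h2⟩
          constructor <;> linarith
        · rintro ⟨h1, h2⟩
          exact ⟨hs, by linarith, by linarith⟩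
      rw [this, Real.volume_Icc, Set.indicator_of_mem hs]
      congr 1; ring
    · simp [parabolaStrip, hs]
  simp_rw [h]
  rw [lintegral_indicator_const hT]

/-! ### A function with positive Fourier transform near the parabola -/

/-- A Schwartz function whose Fourier transform is a smooth version of the indicator function of
the part of the neighborhood of the parabola over `[-θ⁻¹, θ⁻¹]`. It is large on a box centered
at the origin, where its Fourier integral has no cancellation. -/
lemma exists_bump_near_parabola {R θ : ℝ} (hR : 1 ≤ R) (hθ : 1 ≤ θ) (hθR : θ ^ 2 ≤ R) :
    ∃ f : 𝓢(Plane, ℂ), (∀ ξ, ‖𝓕 f ξ‖ ≤ 1) ∧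
      (∀ ξ, 𝓕 f ξ ≠ 0 → ξ ∈ parabolaStrip (Set.Icc (-θ⁻¹) θ⁻¹) R⁻¹) ∧
      ∀ x : Plane, |x 0| ≤ θ / 12 → |x 1| ≤ θ ^ 2 / 24 → (2 * (θ * R))⁻¹ ≤ ‖f x‖ := by
  have hR0 : 0 < R := by linarith
  have hθ0 : 0 < θ := by linarith
  let χ : ContDiffBump (0 : ℝ) := ⟨1 / 2, 1, by norm_num, by norm_num⟩
  have hχ : ∀ s, χ s ≠ 0 → |s| ≤ 1 := by
    intro s hs
    have h4 : s ∈ Function.support χ := hs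
    rw [χ.support_eq] at h4
    simpa using (Metric.mem_ball.1 h4).le
  have hχ1 : ∀ s, |s| ≤ 1 / 2 → χ s = 1 := fun s hs =>
    χ.one_of_mem_closedBall (mem_closedBall_zero_iff.2 hs)
  let h : Plane → ℝ := fun ξ => χ (θ * ξ 0) * χ (R * (ξ 1 - ξ 0 ^ 2))
  have hsupp : ∀ ξ, h ξ ≠ 0 → ξ ∈ parabolaStrip (Set.Icc (-θ⁻¹) θ⁻¹) R⁻¹ := by
    intro ξ hξ
    have h1 := hχ _ (left_ne_zero_of_mul hξ)
    have h2 := hχ _ (right_ne_zero_of_mul hξ)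
    rw [abs_mul, abs_of_pos hθ0, ← le_div_iff₀' hθ0, one_div] at h1
    rw [abs_mul, abs_of_pos hR0, ← le_div_iff₀' hR0, one_div] at h2
    exact ⟨abs_le.1 h1, h2⟩
  have hnn : ∀ ξ, 0 ≤ h ξ := fun ξ => mul_nonneg χ.nonneg χ.nonneg
  have hle : ∀ ξ, h ξ ≤ 1 := fun ξ => mul_le_one₀ χ.le_one χ.nonneg χ.le_one
  have hbd : ∀ ξ, h ξ ≠ 0 → |ξ 0| ≤ θ⁻¹ ∧ |ξ 1| ≤ 2 * (θ ^ 2)⁻¹ := by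
    intro ξ hξ
    obtain ⟨h1, h2⟩ := hsupp ξ hξ
    have h1 : |ξ 0| ≤ θ⁻¹ := abs_le.2 h1
    refine ⟨h1, ?_⟩
    have h3 : R⁻¹ ≤ (θ ^ 2)⁻¹ := by gcongr
    have h4 : |ξ 0| ^ 2 ≤ (θ ^ 2)⁻¹ := by rw [← inv_pow]; gcongr
    calc |ξ 1| = |(ξ 1 - ξ 0 ^ 2) + ξ 0 ^ 2| := by ring_nf
      _ ≤ |ξ 1 - ξ 0 ^ 2| + |ξ 0 ^ 2| := abs_add_le _ _
      _ ≤ 2 * (θ ^ 2)⁻¹ := by rw [abs_pow]; linarith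
  have hsm : ContDiff ℝ ∞ h := by
    refine (χ.contDiff.comp ?_).mul (χ.contDiff.comp ?_) <;> fun_prop
  have hcs : HasCompactSupport h := by
    refine HasCompactSupport.of_support_subset_isCompact (isCompact_closedBall (0 : Plane) 3)
      fun ξ hξ => ?_
    obtain ⟨h1, h2⟩ := hbd ξ hξ
    have h3 : θ⁻¹ ≤ 1 := inv_le_one_of_one_le₀ hθ
    have h4 : (θ ^ 2)⁻¹ ≤ 1 := inv_le_one_of_one_le₀ (one_le_pow₀ hθ)
    rw [mem_closedBall_zero_iff]
    linarith [norm_le_abs_add_abs ξ]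
  have hc : HasCompactSupport fun ξ => ((h ξ : ℝ) : ℂ) :=
    hcs.comp_left (g := fun r : ℝ => (r : ℂ)) (by simp)
  have hs : ContDiff ℝ ∞ fun ξ => ((h ξ : ℝ) : ℂ) := Complex.ofRealCLM.contDiff.comp hsm
  let u : 𝓢(Plane, ℂ) := hc.toSchwartzMap hs
  have hu : ∀ ξ, u ξ = ((h ξ : ℝ) : ℂ) := fun ξ => rfl
  refine ⟨𝓕⁻ u, fun ξ => ?_, fun ξ hξ => ?_, fun x hx0 hx1 => ?_⟩
  · rw [FourierTransform.fourier_fourierInv_eq, hu, Complex.norm_real, Real.norm_of_nonneg (hnn ξ)]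
    exact hle ξ
  · rw [FourierTransform.fourier_fourierInv_eq, hu] at hξ
    exact hsupp ξ (by exact_mod_cast hξ)
  · have hint : Integrable h := hsm.continuous.integrable_of_hasCompactSupport hcs
    have hmass : (θ * R)⁻¹ ≤ ∫ ξ, h ξ := by
      set T := Set.Icc (-(2 * θ)⁻¹) (2 * θ)⁻¹ with hT
      have hv : volume (parabolaStrip T (2 * R)⁻¹) = ENNReal.ofReal (θ * R)⁻¹ := by
        rw [volume_parabolaStrip measurableSet_Icc, Real.volume_Icc,
          ← ENNReal.ofReal_mul (by positivity)]
        congr 1; field_simp; norm_num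
      have h1 : ENNReal.ofReal (θ * R)⁻¹ ≤ ENNReal.ofReal (∫ ξ, h ξ) := by
        rw [ofReal_integral_eq_lintegral_ofReal hint (Filter.Eventually.of_forall hnn), ← hv,
          ← lintegral_indicator_one (measurableSet_parabolaStrip measurableSet_Icc _)]
        refine lintegral_mono fun ξ => ?_
        by_cases hξ : ξ ∈ parabolaStrip T (2 * R)⁻¹
        · rw [Set.indicator_of_mem hξ]
          have e1 : χ (θ * ξ 0) = 1 := by
            refine hχ1 _ ?_
            rw [abs_mul, abs_of_pos hθ0]
            calc θ * |ξ 0| ≤ θ * (2 * θ)⁻¹ := by gcongr; exact abs_le.2 hξ.1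
              _ = 1 / 2 := by field_simp
          have e2 : χ (R * (ξ 1 - ξ 0 ^ 2)) = 1 := by
            refine hχ1 _ ?_
            rw [abs_mul, abs_of_pos hR0]
            calc R * |ξ 1 - ξ 0 ^ 2| ≤ R * (2 * R)⁻¹ := by gcongr; exact hξ.2
              _ = 1 / 2 := by field_simp
          simp [h, e1, e2]
        · rw [Set.indicator_of_notMem hξ]
          exact bot_le
      exact (ENNReal.ofReal_le_ofReal_iff (integral_nonneg hnn)).1 h1
    have hre : (𝓕⁻ u x).re = ∫ ξ, Real.cos (2 * Real.pi * inner ℝ ξ x) * h ξ := by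
      rw [fourierInv_coe, Real.fourierInv_eq', ← Complex.reCLM_apply,
        ← Complex.reCLM.integral_comp_comm]
      · refine integral_congr_ae (Filter.Eventually.of_forall fun ξ => ?_)
        simp only [Complex.reCLM_apply, hu, smul_eq_mul, Complex.re_mul_ofReal,
          Complex.exp_ofReal_mul_I_re]
      · refine (hint.ofReal (𝕜 := ℂ)).bdd_mul (c := 1) ?_ ?_
        · exact Continuous.aestronglyMeasurable (by fun_prop)
        · exact Filter.Eventually.of_forall fun ξ => (Complex.norm_exp_ofReal_mul_I _).le
    calc (2 * (θ * R))⁻¹ = 1 / 2 * (θ * R)⁻¹ := by rw [mul_inv]; norm_num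
      _ ≤ 1 / 2 * ∫ ξ, h ξ := by gcongr
      _ = ∫ ξ, 1 / 2 * h ξ := by rw [integral_const_mul]
      _ ≤ ∫ ξ, Real.cos (2 * Real.pi * inner ℝ ξ x) * h ξ := by
          refine integral_mono (hint.const_mul _) ?_ fun ξ => ?_
          · refine hint.bdd_mul (c := 1) ?_ ?_
            · exact Continuous.aestronglyMeasurable (by fun_prop)
            · exact Filter.Eventually.of_forall fun ξ => Real.abs_cos_le_one _
          · by_cases hξ : h ξ = 0
            · simp [hξ]
            · obtain ⟨h1, h2⟩ := hbd ξ hξ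
              refine mul_le_mul_of_nonneg_right ?_ (hnn ξ)
              have h3 : |inner ℝ ξ x| ≤ 1 / 6 := by
                rw [PiLp.inner_apply, Fin.sum_univ_two]
                simp only [RCLike.inner_apply, conj_trivial]
                calc |x 0 * ξ 0 + x 1 * ξ 1| ≤ |x 0| * |ξ 0| + |x 1| * |ξ 1| := by
                      rw [← abs_mul, ← abs_mul]; exact abs_add_le _ _
                  _ ≤ θ / 12 * θ⁻¹ + θ ^ 2 / 24 * (2 * (θ ^ 2)⁻¹) := by gcongr
                  _ = 1 / 6 := by field_simp; norm_num
              rw [← Real.cos_abs, ← Real.cos_pi_div_three]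
              refine Real.cos_le_cos_of_nonneg_of_le_pi (abs_nonneg _)
                (by linarith [Real.pi_pos]) ?_
              rw [abs_mul, abs_of_pos (by positivity : 0 < 2 * Real.pi)]
              calc 2 * Real.pi * |inner ℝ ξ x| ≤ 2 * Real.pi * (1 / 6) := by gcongr
                _ = Real.pi / 3 := by ring
      _ = (𝓕⁻ u x).re := hre.symm
      _ ≤ ‖𝓕⁻ u x‖ := Complex.re_le_norm _

lemma parabolaStrip_subset_parabolaNhd {T : Set ℝ} (hT : T ⊆ Set.Icc (-1) 1) {R : ℝ} :
    parabolaStrip T R⁻¹ ⊆ parabolaNhd R := by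
  rintro ξ ⟨h1, h2⟩
  refine Metric.mem_cthickening_of_dist_le ξ !₂[ξ 0, ξ 0 ^ 2] _ _
    ⟨by simpa using abs_le.2 (hT h1), by simp⟩ ?_
  rw [EuclideanSpace.dist_eq, Fin.sum_univ_two]
  simpa [Real.dist_eq, Real.sqrt_sq_eq_abs] using h2

lemma isClosed_parabolaStrip {T : Set ℝ} (hT : IsClosed T) (b : ℝ) :
    IsClosed (parabolaStrip T b) :=
  (hT.preimage (f := fun ξ : Plane => ξ 0) (by fun_prop)).inter
    (isClosed_le (f := fun ξ : Plane => |ξ 1 - ξ 0 ^ 2|) (by fun_prop) continuous_const)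

/-! ### Upper bounds for functions with Fourier transform spread along the parabola -/

lemma enorm_le_lintegral_fourier (g : 𝓢(Plane, ℂ)) (x : Plane) :
    ‖g x‖ₑ ≤ ∫⁻ ξ, ‖𝓕 g ξ‖ₑ := by
  have h : g x = 𝓕⁻ (𝓕 g) x := by rw [FourierTransform.fourierInv_fourier_eq]
  rw [h, fourierInv_coe, Real.fourierInv_eq']
  refine (enorm_integral_le_lintegral_enorm _).trans (lintegral_mono fun ξ => ?_)
  rw [enorm_smul, ← ofReal_norm (Complex.exp _), Complex.norm_exp_ofReal_mul_I]
  simp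

lemma lintegral_enorm_pow_le {h : Plane → ℂ} {b : ℝ} (hb : ∀ ξ, ‖h ξ‖ ≤ b) {E : Set Plane}
    (hE : ∀ ξ, h ξ ≠ 0 → ξ ∈ E) {r : ℕ} (hr : r ≠ 0) :
    ∫⁻ ξ, ‖h ξ‖ₑ ^ r ≤ ENNReal.ofReal b ^ r * volume E := by
  calc ∫⁻ ξ, ‖h ξ‖ₑ ^ r ≤ ∫⁻ ξ, E.indicator (fun _ => ENNReal.ofReal b ^ r) ξ := by
        refine lintegral_mono fun ξ => ?_
        by_cases hξ : h ξ = 0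
        · simp [hξ, hr]
        · rw [Set.indicator_of_mem (hE ξ hξ), ← ofReal_norm]
          gcongr
          exact hb ξ
    _ ≤ _ := lintegral_indicator_const_le _ _

lemma lintegral_enorm_fourier_schwartzMul_le (f g : 𝓢(Plane, ℂ)) :
    ∫⁻ ξ, ‖𝓕 (schwartzMul f g) ξ‖ₑ ≤ (∫⁻ ξ, ‖𝓕 f ξ‖ₑ) * ∫⁻ ξ, ‖𝓕 g ξ‖ₑ := by
  have hf := measurable_enorm_schwartz (𝓕 f)
  have hg := measurable_enorm_schwartz (𝓕 g)
  calc ∫⁻ ξ, ‖𝓕 (schwartzMul f g) ξ‖ₑ ≤ ∫⁻ ξ, ∫⁻ t, ‖𝓕 f t‖ₑ * ‖𝓕 g (ξ - t)‖ₑ := by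
        refine lintegral_mono fun ξ => ?_
        rw [fourier_schwartzMul]
        refine (enorm_integral_le_lintegral_enorm _).trans (lintegral_mono fun t => ?_)
        rw [enorm_mul]
    _ = ∫⁻ t, ∫⁻ ξ, ‖𝓕 f t‖ₑ * ‖𝓕 g (ξ - t)‖ₑ := by
        refine lintegral_lintegral_swap (Measurable.aemeasurable ?_)
        exact (hf.comp measurable_snd).mul (hg.comp (measurable_fst.sub measurable_snd))
    _ = ∫⁻ t, ‖𝓕 f t‖ₑ * ∫⁻ ξ, ‖𝓕 g ξ‖ₑ := by
        refine lintegral_congr fun t => ?_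
        rw [lintegral_const_mul' _ _ enorm_ne_top,
          lintegral_sub_right_eq_self (fun ξ => ‖𝓕 g ξ‖ₑ) t]
    _ = _ := lintegral_mul_const _ hf

/-- A bound for the `L²` norm of a product by the size of the intersections of the Fourier support
of one factor with the reflected translates of that of the other. -/
lemma lintegral_enorm_sq_mul_enorm_sq_le {f g : 𝓢(Plane, ℂ)} {b : ℝ} (hb : 0 ≤ b)
    (hf : ∀ ξ, ‖𝓕 f ξ‖ ≤ b) (hg : ∀ ξ, ‖𝓕 g ξ‖ ≤ b) {V : ℝ≥0∞}
    (hV : ∀ ξ, volume {t | 𝓕 f t ≠ 0 ∧ 𝓕 g (ξ - t) ≠ 0} ≤ V) :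
    ∫⁻ x, ‖f x‖ₑ ^ 2 * ‖g x‖ₑ ^ 2 ≤
      ENNReal.ofReal b ^ 2 * V * ((∫⁻ ξ, ‖𝓕 f ξ‖ₑ) * ∫⁻ ξ, ‖𝓕 g ξ‖ₑ) := by
  have hsup : ∀ ξ, ‖𝓕 (schwartzMul f g) ξ‖ₑ ≤ ENNReal.ofReal b ^ 2 * V := by
    intro ξ
    rw [fourier_schwartzMul]
    refine (enorm_integral_le_lintegral_enorm _).trans ?_
    have h1 := lintegral_enorm_pow_le (h := fun t => 𝓕 f t * 𝓕 g (ξ - t)) (b := b ^ 2)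
      (E := {t | 𝓕 f t ≠ 0 ∧ 𝓕 g (ξ - t) ≠ 0})
      (fun t => by
        rw [norm_mul, sq]
        exact mul_le_mul (hf _) (hg _) (norm_nonneg _) hb)
      (fun t ht => ⟨left_ne_zero_of_mul ht, right_ne_zero_of_mul ht⟩) one_ne_zero
    simp only [pow_one] at h1
    rw [ENNReal.ofReal_pow hb] at h1
    refine h1.trans ?_
    gcongr
    exact hV ξ
  calc ∫⁻ x, ‖f x‖ₑ ^ 2 * ‖g x‖ₑ ^ 2 = ∫⁻ x, ‖schwartzMul f g x‖ₑ ^ 2 := by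
        simp_rw [schwartzMul_apply, enorm_mul, mul_pow]
    _ = ∫⁻ ξ, ‖𝓕 (schwartzMul f g) ξ‖ₑ ^ 2 := (lintegral_enorm_sq_fourier _).symm
    _ ≤ ∫⁻ ξ, ENNReal.ofReal b ^ 2 * V * ‖𝓕 (schwartzMul f g) ξ‖ₑ := by
        refine lintegral_mono fun ξ => ?_
        rw [sq]
        gcongr
        exact hsup ξ
    _ = ENNReal.ofReal b ^ 2 * V * ∫⁻ ξ, ‖𝓕 (schwartzMul f g) ξ‖ₑ :=
        lintegral_const_mul _ (measurable_enorm_schwartz _)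
    _ ≤ _ := by
        gcongr
        exact lintegral_enorm_fourier_schwartzMul_le f g

/-- If `s` and `ξ₀ - s` are within `r` of two points at distance at least `4 r`, then
`s ^ 2 + (ξ₀ - s) ^ 2` determines `s` in a stable way. -/
lemma abs_sub_mul_le_of_sq_add_sq {s s' x d r τ y : ℝ} (h1 : |2 * s - x - d| ≤ 2 * r)
    (h2 : |2 * s' - x - d| ≤ 2 * r) (hd : 4 * r ≤ |d|) (h3 : |s ^ 2 + (x - s) ^ 2 - y| ≤ τ)
    (h4 : |s' ^ 2 + (x - s') ^ 2 - y| ≤ τ) : |s - s'| * |d| ≤ 2 * τ := by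
  have h5 : |d| ≤ |(2 * s - x) + (2 * s' - x)| := by
    have : |2 * d| ≤ |(2 * s - x) + (2 * s' - x)| + |2 * s - x - d| + |2 * s' - x - d| := by
      have e : 2 * d = ((2 * s - x) + (2 * s' - x)) - (2 * s - x - d) - (2 * s' - x - d) := by ring
      rw [e]
      exact (abs_sub _ _).trans (add_le_add_left (abs_sub _ _) _)
    rw [abs_mul, abs_two] at this
    linarith
  calc |s - s'| * |d| ≤ |s - s'| * |(2 * s - x) + (2 * s' - x)| := by gcongr
    _ = |(s ^ 2 + (x - s) ^ 2 - y) - (s' ^ 2 + (x - s') ^ 2 - y)| := by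
        rw [← abs_mul]; ring_nf
    _ ≤ 2 * τ := (abs_sub _ _).trans (by linarith)

/-- The intersection of a piece of a strip around the parabola with a reflected translate of
another. -/
lemma volume_inter_strip_le {c c' r R : ℝ} (hR : 0 < R) (hr : 0 < r) (hd : 4 * r ≤ |c - c'|)
    (ξ : Plane) :
    volume {t : Plane | t ∈ parabolaStrip (Set.Icc (c - r) (c + r)) R⁻¹ ∧
      ξ - t ∈ parabolaStrip (Set.Icc (c' - r) (c' + r)) R⁻¹} ≤
        ENNReal.ofReal (16 * (R ^ 2 * |c - c'|)⁻¹) := by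
  rcases Set.eq_empty_or_nonempty {t : Plane | t ∈ parabolaStrip (Set.Icc (c - r) (c + r)) R⁻¹ ∧
      ξ - t ∈ parabolaStrip (Set.Icc (c' - r) (c' + r)) R⁻¹} with h | ⟨t₀, ht₀, ht₀'⟩
  · rw [h, measure_empty]; exact bot_le
  · have hd0 : 0 < |c - c'| := by linarith
    have hq : ∀ t : Plane, t ∈ parabolaStrip (Set.Icc (c - r) (c + r)) R⁻¹ →
        ξ - t ∈ parabolaStrip (Set.Icc (c' - r) (c' + r)) R⁻¹ →
        |2 * t 0 - ξ 0 - (c - c')| ≤ 2 * r ∧ |t 0 ^ 2 + (ξ 0 - t 0) ^ 2 - ξ 1| ≤ 2 * R⁻¹ := by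
      rintro t ⟨⟨h1, h2⟩, h3⟩ ⟨⟨h4, h5⟩, h6⟩
      simp only [PiLp.sub_apply] at h4 h5 h6
      refine ⟨abs_le.2 ⟨by linarith, by linarith⟩, ?_⟩
      rw [abs_le] at h3 h6 ⊢
      exact ⟨by linarith [h3.2, h6.2], by linarith [h3.1, h6.1]⟩
    set δ := 4 * R⁻¹ / |c - c'| with hδ
    have hsub : {t : Plane | t ∈ parabolaStrip (Set.Icc (c - r) (c + r)) R⁻¹ ∧
        ξ - t ∈ parabolaStrip (Set.Icc (c' - r) (c' + r)) R⁻¹} ⊆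
          parabolaStrip (Set.Icc (t₀ 0 - δ) (t₀ 0 + δ)) R⁻¹ := by
      rintro t ⟨ht, ht'⟩
      refine ⟨?_, ht.2⟩
      obtain ⟨h1, h2⟩ := hq t ht ht'
      obtain ⟨h3, h4⟩ := hq t₀ ht₀ ht₀'
      have h5 := abs_sub_mul_le_of_sq_add_sq h1 h3 hd h2 h4
      have h6 : |t 0 - t₀ 0| ≤ δ := by
        rw [hδ, le_div_iff₀ hd0]
        linarith
      rw [abs_le] at h6
      exact ⟨by linarith, by linarith⟩
    refine (measure_mono hsub).trans ?_
    rw [volume_parabolaStrip measurableSet_Icc, Real.volume_Icc,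
      ← ENNReal.ofReal_mul (by positivity)]
    refine ENNReal.ofReal_le_ofReal (le_of_eq ?_)
    rw [hδ]
    field_simp
    ring

/-- A row sum of the matrix with entries `(1 + |i - j|)⁻¹` is at most logarithmic. -/
lemma sum_inv_one_add_abs_sub_le {n : ℕ} (i : Fin n) :
    ∑ j : Fin n, (1 + |((i : ℕ) : ℝ) - (j : ℕ)|)⁻¹ ≤ 2 * (1 + Real.log n) := by
  have hH : ∀ m ≤ n, ∑ k ∈ Finset.range m, ((k : ℝ) + 1)⁻¹ ≤ 1 + Real.log n := by
    intro m hm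
    refine (Finset.sum_le_sum_of_subset_of_nonneg (Finset.range_mono hm)
      fun _ _ _ => by positivity).trans ?_
    have := harmonic_le_one_add_log n
    rw [harmonic] at this
    push_cast at this
    exact this
  have hi := i.2
  rw [Fin.sum_univ_eq_sum_range (fun j : ℕ => (1 + |((i : ℕ) : ℝ) - (j : ℝ)|)⁻¹) n,
    ← Finset.sum_range_add_sum_Ico _ (Nat.succ_le_of_lt hi), two_mul]
  refine add_le_add ?_ ?_
  · rw [← Finset.sum_range_reflect]
    refine le_trans (Finset.sum_le_sum fun k hk => ?_) (hH (i + 1) hi)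
    have hk' : k ≤ i := Nat.lt_succ_iff.1 (Finset.mem_range.1 hk)
    have : ((i : ℕ) + 1 - 1 - k : ℕ) = (i : ℕ) - k := by omega
    simp only [Nat.succ_eq_add_one, this, Nat.cast_sub hk']
    rw [sub_sub_cancel, abs_of_nonneg (Nat.cast_nonneg k), add_comm]
  · rw [Finset.sum_Ico_eq_sum_range]
    refine le_trans (Finset.sum_le_sum fun k _ => ?_) (hH (n - (i + 1)) (Nat.sub_le _ _))
    refine inv_anti₀ (by positivity) ?_
    push_cast
    rw [abs_sub_comm, add_comm]
    refine add_le_add le_rfl (le_trans ?_ (le_abs_self _))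
    linarith

/-- Pieces, with constants `M` and `b`, of a function whose Fourier transform is bounded and
supported in the part of the neighborhood of the parabola over `[-θ⁻¹, θ⁻¹]`. The length of the
small caps is `K⁻¹`. -/
structure SpreadPieces {n : ℕ} (g : Fin n → 𝓢(Plane, ℂ)) (a : Fin n → ℝ) (K R θ M b : ℝ) :
    Prop where
  R_pos : 0 < R
  one_le_θ : 1 ≤ θ
  θ_le_K : θ ≤ K
  R_le : R ≤ K ^ 2
  one_le_M : 1 ≤ M
  b_pos : 0 < b
  n_le : n ≤ 4 * K
  sep : IsSeparated a K
  bound : ∀ i ξ, ‖𝓕 (g i) ξ‖ ≤ b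
  supp : ∀ i ξ, 𝓕 (g i) ξ ≠ 0 → ξ ∈ parabolaStrip (Set.Icc (a i - M / K) (a i + M / K)) R⁻¹
  supp_θ : ∀ i ξ, 𝓕 (g i) ξ ≠ 0 → ξ 0 ∈ Set.Icc (-θ⁻¹) θ⁻¹

namespace SpreadPieces

variable {n : ℕ} {g : Fin n → 𝓢(Plane, ℂ)} {a : Fin n → ℝ} {K R θ M b : ℝ}

lemma K_pos (h : SpreadPieces g a K R θ M b) : 0 < K := by
  linarith [h.one_le_θ, h.θ_le_K]

lemma lintegral_fourier_pow_le (h : SpreadPieces g a K R θ M b) (i : Fin n) {r : ℕ} (hr : r ≠ 0) :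
    ∫⁻ ξ, ‖𝓕 (g i) ξ‖ₑ ^ r ≤ ENNReal.ofReal (b ^ r * (4 * M / (K * R))) := by
  refine (lintegral_enorm_pow_le (h.bound i) (h.supp i) hr).trans (le_of_eq ?_)
  have hK := h.K_pos
  have hR := h.R_pos
  rw [volume_parabolaStrip measurableSet_Icc, Real.volume_Icc, ← ENNReal.ofReal_mul (by positivity),
    ← ENNReal.ofReal_pow h.b_pos.le, ← ENNReal.ofReal_mul (pow_nonneg h.b_pos.le _)]
  congr 2
  field_simp
  ring

/-- The number of nonzero pieces is at most about `K / θ`. -/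
lemma sqSum_le (h : SpreadPieces g a K R θ M b) : ∃ J : Finset (Fin n),
    (J.card : ℝ) ≤ (4 * M + 5) * (K / θ) ∧ ∀ x, sqSum Finset.univ g x = sqSum J g x := by
  classical
  have hK := h.K_pos
  have hM := h.one_le_M
  have hθ : 0 < θ := by linarith [h.one_le_θ]
  refine ⟨Finset.univ.filter fun i => ∃ ξ, 𝓕 (g i) ξ ≠ 0, ?_, fun x => ?_⟩
  · have hnear : ∀ i, (∃ ξ, 𝓕 (g i) ξ ≠ 0) → |a i| ≤ θ⁻¹ + M / K := by
      rintro i ⟨ξ, hξ⟩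
      obtain ⟨h1, h2⟩ := (h.supp i ξ hξ).1
      obtain ⟨h3, h4⟩ := h.supp_θ i ξ hξ
      exact abs_le.2 ⟨by linarith, by linarith⟩
    have hc := h.sep.card_le hK (d := 2 * (θ⁻¹ + M / K)) (by positivity)
      (S := Finset.univ.filter fun i => ∃ ξ, 𝓕 (g i) ξ ≠ 0) fun i hi j hj => by
        have h1 := hnear i (Finset.mem_filter.1 hi).2
        have h2 := hnear j (Finset.mem_filter.1 hj).2
        exact (abs_sub _ _).trans (by linarith)
    refine hc.trans ?_
    have h1 : 1 ≤ K / θ := by rw [one_le_div hθ]; exact h.θ_le_K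
    calc 2 * K * (2 * (θ⁻¹ + M / K)) + 1 = 4 * (K / θ) + (4 * M + 1) * 1 := by field_simp; ring
      _ ≤ 4 * (K / θ) + (4 * M + 1) * (K / θ) := by gcongr
      _ = _ := by ring
  · unfold sqSum
    rw [Finset.sum_filter_of_ne]
    intro i _ hi
    by_contra! h0
    apply hi
    have : ‖g i x‖ₑ ≤ 0 := (enorm_le_lintegral_fourier (g i) x).trans (by simp [h0])
    simp [nonpos_iff_eq_zero.1 this]

lemma sqSum_sup_le (h : SpreadPieces g a K R θ M b) (x : Plane) :
    sqSum Finset.univ g x ≤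
      ENNReal.ofReal ((4 * M + 5) * (16 * b ^ 2 * M ^ 2) * (θ * K * R ^ 2)⁻¹) := by
  have hK := h.K_pos
  have hR := h.R_pos
  have hM := h.one_le_M
  have hb := h.b_pos
  have hθ : 0 < θ := by linarith [h.one_le_θ]
  obtain ⟨J, hJ, hJ'⟩ := h.sqSum_le
  rw [hJ']
  have h1 : ∀ i, ‖g i x‖ₑ ^ 2 ≤ ENNReal.ofReal ((b * (4 * M / (K * R))) ^ 2) := fun i => by
    have := h.lintegral_fourier_pow_le i one_ne_zero
    simp only [pow_one] at this
    rw [ENNReal.ofReal_pow (by positivity)]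
    gcongr
    exact (enorm_le_lintegral_fourier _ _).trans this
  calc sqSum J g x ≤ ∑ i ∈ J, ENNReal.ofReal ((b * (4 * M / (K * R))) ^ 2) :=
        Finset.sum_le_sum fun i _ => h1 i
    _ = ENNReal.ofReal (J.card * (b * (4 * M / (K * R))) ^ 2) := by
        rw [Finset.sum_const, nsmul_eq_mul, ENNReal.ofReal_mul (Nat.cast_nonneg _),
          ENNReal.ofReal_natCast]
    _ ≤ ENNReal.ofReal ((4 * M + 5) * (K / θ) * (b * (4 * M / (K * R))) ^ 2) := by gcongr
    _ = _ := by
        congr 1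
        field_simp
        ring

lemma lintegral_sqSum_le (h : SpreadPieces g a K R θ M b) :
    ∫⁻ x, sqSum Finset.univ g x ≤
      ENNReal.ofReal ((4 * M + 5) * (4 * b ^ 2 * M) * (θ * R)⁻¹) := by
  have hK := h.K_pos
  have hR := h.R_pos
  have hM := h.one_le_M
  have hb := h.b_pos
  have hθ : 0 < θ := by linarith [h.one_le_θ]
  obtain ⟨J, hJ, hJ'⟩ := h.sqSum_le
  simp_rw [hJ']
  calc ∫⁻ x, sqSum J g x = ∑ i ∈ J, ∫⁻ x, ‖g i x‖ₑ ^ 2 := by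
        unfold sqSum
        rw [lintegral_finsetSum]
        exact fun j _ => (measurable_enorm_schwartz _).pow_const _
    _ ≤ ∑ i ∈ J, ENNReal.ofReal (b ^ 2 * (4 * M / (K * R))) := by
        refine Finset.sum_le_sum fun i _ => ?_
        rw [← lintegral_enorm_sq_fourier]
        exact h.lintegral_fourier_pow_le i two_ne_zero
    _ = ENNReal.ofReal (J.card * (b ^ 2 * (4 * M / (K * R)))) := by
        rw [Finset.sum_const, nsmul_eq_mul, ENNReal.ofReal_mul (Nat.cast_nonneg _),
          ENNReal.ofReal_natCast]
    _ ≤ ENNReal.ofReal ((4 * M + 5) * (K / θ) * (b ^ 2 * (4 * M / (K * R)))) := by gcongr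
    _ = _ := by
        congr 1
        field_simp

/-- The constant in the bilinear estimate for two pieces. -/
noncomputable def pairConstant (M : ℝ) : ℝ := 64 + 4 * M * (8 * M + 1)

/-- The Fourier supports of two pieces intersect reflected translates of one another in small
sets, the more so the further apart the pieces are. -/
lemma volume_inter_le (h : SpreadPieces g a K R θ M b) (i j : Fin n) (ξ : Plane) :
    volume {t | 𝓕 (g i) t ≠ 0 ∧ 𝓕 (g j) (ξ - t) ≠ 0} ≤
      ENNReal.ofReal (pairConstant M * (K / R ^ 2) * (1 + |((i : ℕ) : ℝ) - (j : ℕ)|)⁻¹) := by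
  have hK := h.K_pos
  have hR := h.R_pos
  have hM := h.one_le_M
  set w := |((i : ℕ) : ℝ) - (j : ℕ)| with hw
  have hw0 : 0 ≤ w := abs_nonneg _
  have hwd : w ≤ 2 * K * |a i - a j| := by
    rw [hw, abs_le']
    refine ⟨h.sep i j, ?_⟩
    rw [neg_sub, abs_sub_comm]
    exact h.sep j i
  rcases le_or_gt (4 * (M / K)) |a i - a j| with hfar | hnear
  · have hd0 : 0 < |a i - a j| := lt_of_lt_of_le (by positivity) hfar
    have hne : i ≠ j := by
      rintro rfl
      simp at hd0
    have hw1 : 1 ≤ w := by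
      have : (1 : ℤ) ≤ |((i : ℕ) : ℤ) - (j : ℕ)| :=
        Int.one_le_abs (sub_ne_zero.2 (by exact_mod_cast Fin.val_ne_of_ne hne))
      rw [hw]
      exact_mod_cast this
    refine (measure_mono ?_).trans
      ((volume_inter_strip_le (c := a i) (c' := a j) hR (by positivity) hfar ξ).trans ?_)
    · exact fun t ht => ⟨h.supp i t ht.1, h.supp j _ ht.2⟩
    · refine ENNReal.ofReal_le_ofReal ?_
      have h1 : |a i - a j|⁻¹ ≤ 4 * K * (1 + w)⁻¹ := by
        rw [inv_le_iff_one_le_mul₀ hd0]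
        calc (1 : ℝ) = (1 + w) * (1 + w)⁻¹ := by field_simp
          _ ≤ (2 * w) * (1 + w)⁻¹ := by gcongr; linarith
          _ ≤ (2 * (2 * K * |a i - a j|)) * (1 + w)⁻¹ := by gcongr
          _ = _ := by ring
      calc 16 * (R ^ 2 * |a i - a j|)⁻¹ = 16 * (R ^ 2)⁻¹ * |a i - a j|⁻¹ := by rw [mul_inv]; ring
        _ ≤ 16 * (R ^ 2)⁻¹ * (4 * K * (1 + w)⁻¹) := by gcongr
        _ = 64 * (K / R ^ 2) * (1 + w)⁻¹ := by ring
        _ ≤ _ := by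
            gcongr
            unfold pairConstant
            nlinarith
  · have hw8 : w ≤ 8 * M := by
      calc w ≤ 2 * K * |a i - a j| := hwd
        _ ≤ 2 * K * (4 * (M / K)) := by gcongr
        _ = 8 * M := by field_simp; ring
    refine (measure_mono (t := parabolaStrip (Set.Icc (a i - M / K) (a i + M / K)) R⁻¹)
      fun t ht => h.supp i t ht.1).trans ?_
    rw [volume_parabolaStrip measurableSet_Icc, Real.volume_Icc,
      ← ENNReal.ofReal_mul (by positivity)]
    refine ENNReal.ofReal_le_ofReal ?_
    calc 2 * R⁻¹ * (a i + M / K - (a i - M / K)) = 4 * M * (R * K)⁻¹ := by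
          field_simp; ring
      _ ≤ 4 * M * (K / R ^ 2) := by
          gcongr
          rw [le_div_iff₀ (by positivity), inv_mul_le_iff₀ (by positivity)]
          nlinarith [h.R_le]
      _ = 4 * M * (1 + w) * (K / R ^ 2) * (1 + w)⁻¹ := by field_simp
      _ ≤ _ := by
          gcongr
          unfold pairConstant
          nlinarith

lemma lintegral_mul_le (h : SpreadPieces g a K R θ M b) (i j : Fin n) :
    ∫⁻ x, ‖g i x‖ₑ ^ 2 * ‖g j x‖ₑ ^ 2 ≤ ENNReal.ofReal (16 * b ^ 4 * M ^ 2 * pairConstant M *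
      (K * R ^ 4)⁻¹ * (1 + |((i : ℕ) : ℝ) - (j : ℕ)|)⁻¹) := by
  have hK := h.K_pos
  have hR := h.R_pos
  have hM := h.one_le_M
  have hb := h.b_pos
  have hP : 0 < pairConstant M := by unfold pairConstant; positivity
  have hi := h.lintegral_fourier_pow_le i one_ne_zero
  have hj := h.lintegral_fourier_pow_le j one_ne_zero
  simp only [pow_one] at hi hj
  refine (lintegral_enorm_sq_mul_enorm_sq_le hb.le (h.bound i) (h.bound j)
    (h.volume_inter_le i j)).trans ?_
  calc _ ≤ ENNReal.ofReal b ^ 2 * ENNReal.ofReal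
        (pairConstant M * (K / R ^ 2) * (1 + |((i : ℕ) : ℝ) - (j : ℕ)|)⁻¹) *
        (ENNReal.ofReal (b * (4 * M / (K * R))) * ENNReal.ofReal (b * (4 * M / (K * R)))) := by
        gcongr
    _ = _ := by
        rw [← ENNReal.ofReal_pow hb.le, ← ENNReal.ofReal_mul (by positivity),
          ← ENNReal.ofReal_mul (by positivity), ← ENNReal.ofReal_mul (by positivity)]
        congr 1
        field_simp
        ring

lemma lintegral_sqSum_sq_le (h : SpreadPieces g a K R θ M b) :
    ∫⁻ x, sqSum Finset.univ g x ^ 2 ≤ ENNReal.ofReal (16 * b ^ 4 * M ^ 2 * pairConstant M *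
      (8 * (1 + Real.log (4 * K))) * (R ^ 4)⁻¹) := by
  have hK := h.K_pos
  have hR := h.R_pos
  have hM := h.one_le_M
  have hb := h.b_pos
  have hP : 0 < pairConstant M := by unfold pairConstant; positivity
  have hK4 : 1 ≤ 4 * K := by linarith [h.one_le_θ, h.θ_le_K]
  have hlog : 0 ≤ Real.log (4 * K) := Real.log_nonneg hK4
  have hsum : ∑ i : Fin n, ∑ j : Fin n, (1 + |((i : ℕ) : ℝ) - (j : ℕ)|)⁻¹ ≤
      4 * K * (2 * (1 + Real.log (4 * K))) := by
    calc _ ≤ ∑ _i : Fin n, 2 * (1 + Real.log (4 * K)) := by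
          refine Finset.sum_le_sum fun i _ => (sum_inv_one_add_abs_sub_le i).trans ?_
          have hn : 0 < (n : ℝ) := by exact_mod_cast i.pos
          have := Real.log_le_log hn h.n_le
          linarith
      _ = n * (2 * (1 + Real.log (4 * K))) := by simp
      _ ≤ _ := by
          gcongr
          exact h.n_le
  calc ∫⁻ x, sqSum Finset.univ g x ^ 2
      = ∑ i, ∑ j, ∫⁻ x, ‖g i x‖ₑ ^ 2 * ‖g j x‖ₑ ^ 2 := by
        unfold sqSum
        simp_rw [sq (Finset.sum _ _), Finset.sum_mul_sum]
        have hm : ∀ i j, Measurable fun x => ‖g i x‖ₑ ^ 2 * ‖g j x‖ₑ ^ 2 := fun i j =>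
          ((measurable_enorm_schwartz _).pow_const _).mul
            ((measurable_enorm_schwartz _).pow_const _)
        rw [lintegral_finsetSum _ fun i _ => Finset.measurable_fun_sum _ fun j _ => hm i j]
        exact Finset.sum_congr rfl fun i _ => lintegral_finsetSum _ fun j _ => hm i j
    _ ≤ ∑ i : Fin n, ∑ j : Fin n, ENNReal.ofReal (16 * b ^ 4 * M ^ 2 * pairConstant M *
          (K * R ^ 4)⁻¹ * (1 + |((i : ℕ) : ℝ) - (j : ℕ)|)⁻¹) :=
        Finset.sum_le_sum fun i _ => Finset.sum_le_sum fun j _ => h.lintegral_mul_le i j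
    _ = ENNReal.ofReal (16 * b ^ 4 * M ^ 2 * pairConstant M * (K * R ^ 4)⁻¹ *
          ∑ i : Fin n, ∑ j : Fin n, (1 + |((i : ℕ) : ℝ) - (j : ℕ)|)⁻¹) := by
        rw [Finset.mul_sum, ENNReal.ofReal_sum_of_nonneg fun i _ => by positivity]
        refine Finset.sum_congr rfl fun i _ => ?_
        rw [Finset.mul_sum, ENNReal.ofReal_sum_of_nonneg fun j _ => by positivity]
    _ ≤ ENNReal.ofReal (16 * b ^ 4 * M ^ 2 * pairConstant M * (K * R ^ 4)⁻¹ *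
          (4 * K * (2 * (1 + Real.log (4 * K))))) := by gcongr
    _ = _ := by
        congr 1
        field_simp
        ring

end SpreadPieces

/-! ### Sharpness -/

/-- Interpolation between a bound for the supremum and an integral bound. -/
lemma eLpNorm_le_of_sup_of_lintegral {S : Plane → ℝ} {A E k : ℝ} {p : ℝ≥0∞} (hk : 0 < k)
    (hp : ENNReal.ofReal (2 * k) ≤ p) (hA : 0 < A) (hE : 0 < E)
    (h1 : ∀ x, ‖S x‖ₑ ^ 2 ≤ ENNReal.ofReal A)
    (h2 : ∫⁻ x, (‖S x‖ₑ ^ 2) ^ k ≤ ENNReal.ofReal E) :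
    eLpNorm S p volume ≤
      ENNReal.ofReal (A ^ (1 / 2 - k * (p⁻¹).toReal) * E ^ (p⁻¹).toReal) := by
  have hsq : ∀ z : ℝ≥0∞, (z ^ 2) ^ (1 / 2 : ℝ) = z := fun z => by
    rw [← ENNReal.rpow_natCast, ← ENNReal.rpow_mul]
    norm_num
  rcases eq_or_ne p ⊤ with rfl | hpt
  · simp only [ENNReal.inv_top, ENNReal.toReal_zero, mul_zero, sub_zero, Real.rpow_zero, mul_one]
    rw [eLpNorm_exponent_top]
    refine eLpNormEssSup_le_of_ae_enorm_bound (Filter.Eventually.of_forall fun x => ?_)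
    rw [← hsq ‖S x‖ₑ, ← ENNReal.ofReal_rpow_of_pos hA]
    gcongr
    exact h1 x
  · set P := p.toReal with hP
    have hkP : 2 * k ≤ P := (ENNReal.ofReal_le_iff_le_toReal hpt).1 hp
    have hP0 : 0 < P := by linarith
    have hp0 : p ≠ 0 := by
      rintro rfl
      simp [hP] at hP0
    rw [eLpNorm_eq_lintegral_rpow_enorm_toReal hp0 hpt, ENNReal.toReal_inv, ← hP]
    have hint : ∫⁻ x, ‖S x‖ₑ ^ P ≤ ENNReal.ofReal A ^ (P / 2 - k) * ENNReal.ofReal E := by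
      calc ∫⁻ x, ‖S x‖ₑ ^ P ≤ ∫⁻ x, ENNReal.ofReal A ^ (P / 2 - k) * (‖S x‖ₑ ^ 2) ^ k := by
            refine lintegral_mono fun x => ?_
            have e : ‖S x‖ₑ ^ P = (‖S x‖ₑ ^ 2) ^ (P / 2 - k) * (‖S x‖ₑ ^ 2) ^ k := by
              rw [← ENNReal.rpow_add_of_nonneg _ _ (by linarith) hk.le, ← ENNReal.rpow_natCast,
                ← ENNReal.rpow_mul]
              congr 1; push_cast; ring
            rw [e]
            have : 0 ≤ P / 2 - k := by linarith
            gcongr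
            exact h1 x
        _ = ENNReal.ofReal A ^ (P / 2 - k) * ∫⁻ x, (‖S x‖ₑ ^ 2) ^ k :=
            lintegral_const_mul' _ _
              (ENNReal.rpow_ne_top_of_nonneg (by linarith) ENNReal.ofReal_ne_top)
        _ ≤ _ := by gcongr
    calc (∫⁻ x, ‖S x‖ₑ ^ P) ^ (1 / P)
        ≤ (ENNReal.ofReal A ^ (P / 2 - k) * ENNReal.ofReal E) ^ (1 / P) := by gcongr
      _ = _ := by
          rw [ENNReal.mul_rpow_of_nonneg _ _ (by positivity), ← ENNReal.rpow_mul,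
            ENNReal.ofReal_rpow_of_pos hA, ENNReal.ofReal_rpow_of_pos hE,
            ← ENNReal.ofReal_mul (by positivity)]
          congr 3
          · field_simp
          · rw [one_div]

lemma le_eLpNorm_of_le_on {f : Plane → ℂ} {E : Set Plane} (hE : MeasurableSet E) {b V : ℝ}
    (hb : 0 ≤ b) (hV : 0 < V) (hvol : volume E = ENNReal.ofReal V) (h : ∀ x ∈ E, b ≤ ‖f x‖)
    {p : ℝ≥0∞} (hp : p ≠ 0) :
    ENNReal.ofReal (b * V ^ (p⁻¹).toReal) ≤ eLpNorm f p volume := by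
  have h1 := eLpNorm_indicator_const' (c := b) (p := p) hE
    (by rw [hvol]; exact (ENNReal.ofReal_pos.2 hV).ne') hp
  have h2 : eLpNorm (E.indicator fun _ => b) p volume ≤ eLpNorm f p volume := by
    refine eLpNorm_mono fun x => ?_
    by_cases hx : x ∈ E
    · rw [Set.indicator_of_mem hx, Real.norm_of_nonneg hb]
      exact h x hx
    · rw [Set.indicator_of_notMem hx, norm_zero]
      exact norm_nonneg _
  rw [h1, hvol, Real.enorm_of_nonneg hb, one_div, ← ENNReal.toReal_inv,
    ENNReal.ofReal_rpow_of_pos hV, ← ENNReal.ofReal_mul hb] at h2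
  exact h2

lemma measurableSet_box (u v : ℝ) : MeasurableSet {x : Plane | |x 0| ≤ u ∧ |x 1| ≤ v} :=
  (measurableSet_le (f := fun x : Plane => |x 0|) (by fun_prop) measurable_const).inter
    (measurableSet_le (f := fun x : Plane => |x 1|) (by fun_prop) measurable_const)

lemma volume_box {u v : ℝ} (hv : 0 ≤ v) :
    volume {x : Plane | |x 0| ≤ u ∧ |x 1| ≤ v} = ENNReal.ofReal (2 * u * (2 * v)) := by
  rw [volume_plane (measurableSet_box u v)]
  have h : ∀ s : ℝ, volume {t : ℝ | (!₂[s, t] : Plane) ∈ {x : Plane | |x 0| ≤ u ∧ |x 1| ≤ v}} =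
      (Set.Icc (-u) u).indicator (fun _ => ENNReal.ofReal (2 * v)) s := by
    intro s
    by_cases hs : s ∈ Set.Icc (-u) u
    · have : {t : ℝ | (!₂[s, t] : Plane) ∈ {x : Plane | |x 0| ≤ u ∧ |x 1| ≤ v}} =
          Set.Icc (-v) v := by
        ext t
        change |s| ≤ u ∧ |t| ≤ v ↔ _
        rw [and_iff_right (abs_le.2 hs), abs_le, Set.mem_Icc]
      rw [this, Real.volume_Icc, Set.indicator_of_mem hs]
      congr 1; ring
    · have : {t : ℝ | (!₂[s, t] : Plane) ∈ {x : Plane | |x 0| ≤ u ∧ |x 1| ≤ v}} = ∅ := by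
        ext t
        change |s| ≤ u ∧ |t| ≤ v ↔ False
        exact iff_false_intro fun h => hs (abs_le.1 h.1)
      rw [this, measure_empty, Set.indicator_of_notMem hs]
  simp_rw [h]
  rw [lintegral_indicator_const measurableSet_Icc, Real.volume_Icc,
    ← ENNReal.ofReal_mul (by positivity)]
  congr 1; ring

lemma mul_rpow_rpow_le {C R e t : ℝ} (hC : 1 ≤ C) (hR : 0 < R) (ht1 : t ≤ 1) :
    (C * R ^ e) ^ t ≤ C * R ^ (e * t) := by
  rw [Real.mul_rpow (by linarith) (by positivity), ← Real.rpow_mul hR.le]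
  gcongr
  calc C ^ t ≤ C ^ (1 : ℝ) := Real.rpow_le_rpow_of_exponent_le hC ht1
    _ = C := Real.rpow_one C

/-- Of the bumps `ψ i` only their supports and the bound for their size matter here. Enlarging the
constants `M` and `B 0` to at least `1` keeps them positive. -/
lemma IsCapPartitionOfUnity.exists_spreadPieces {α R θ M : ℝ} {B : ℕ → ℝ} {P : CapPartition α R}
    {ψ : Fin P.n → Plane → ℝ} (h : IsCapPartitionOfUnity P M B ψ) (hα : 1 / 2 ≤ α) (hR : 1 ≤ R)
    (hθ : 1 ≤ θ) (hθR : θ ^ 2 ≤ R) {f : 𝓢(Plane, ℂ)} (hf : ∀ ξ, ‖𝓕 f ξ‖ ≤ 1)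
    (hsupp : ∀ ξ, 𝓕 f ξ ≠ 0 → ξ ∈ parabolaStrip (Set.Icc (-θ⁻¹) θ⁻¹) R⁻¹) :
    ∃ g : Fin P.n → 𝓢(Plane, ℂ), (∀ i, ⇑(g i) = capPiece (ψ i) f) ∧
      SpreadPieces g P.center (R ^ α) R θ (max M 1) (max (B 0) 1) := by
  have hR0 : 0 < R := by linarith
  have hK : 0 < R ^ α := Real.rpow_pos_of_pos hR0 α
  have hRK : R ≤ (R ^ α) ^ 2 := by
    rw [← Real.rpow_natCast (R ^ α), ← Real.rpow_mul hR0.le]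
    calc R = R ^ (1 : ℝ) := (Real.rpow_one R).symm
      _ ≤ R ^ (α * (2 : ℕ)) := Real.rpow_le_rpow_of_exponent_le hR (by push_cast; linarith)
  obtain ⟨g, hg1, hg2, -⟩ := h.exists_pieces hR0 f
  have hne : ∀ i ξ, 𝓕 (g i) ξ ≠ 0 → ψ i ξ ≠ 0 ∧ 𝓕 f ξ ≠ 0 := by
    intro i ξ hξ
    rw [hg2] at hξ
    exact ⟨by exact_mod_cast left_ne_zero_of_mul hξ, right_ne_zero_of_mul hξ⟩
  refine ⟨g, hg1, hR0, hθ, abs_le_of_sq_le_sq' (hθR.trans hRK) hK.le |>.2, hRK, le_max_right _ _,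
    by positivity, P.card_le hR0, P.isSeparated_center hR0, fun i ξ => ?_, fun i ξ hξ => ?_,
    fun i ξ hξ => (hsupp ξ (hne i ξ hξ).2).1⟩
  · rw [hg2, norm_mul, Complex.norm_real, Real.norm_eq_abs]
    calc |ψ i ξ| * ‖𝓕 (f : Plane → ℂ) ξ‖ ≤ max (B 0) 1 * 1 := by
          gcongr
          · exact ((h.adapted i).abs_le hR0 ξ).trans (le_max_left _ _)
          · exact hf ξ
      _ = _ := mul_one _
  · refine ⟨?_, (hsupp ξ (hne i ξ hξ).2).2⟩
    have h1 := ((h.adapted i).abs_sub_le hR0 (hne i ξ hξ).1).1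
    have h2 : M * (R ^ α)⁻¹ ≤ max M 1 / R ^ α := by
      rw [div_eq_mul_inv]
      gcongr
      exact le_max_left _ _
    have h3 := abs_le.1 (h1.trans h2)
    exact ⟨by linarith, by linarith⟩

/-- Reduction of an inequality between norms to one between real bounds for them; the equation
`z = y` is for the value of `capConstant`. -/
lemma ofReal_mul_eLpNorm_le {c x y z u v : ℝ} {S F : ℝ≥0∞} (hS : S ≤ ENNReal.ofReal u)
    (hF : ENNReal.ofReal v ≤ F) (hc : 0 ≤ c * x * y) (h : c * x * y * u ≤ v) (hz : z = y) :
    ENNReal.ofReal (c * x * z) * S ≤ F := by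
  subst hz
  calc ENNReal.ofReal (c * x * z) * S ≤ ENNReal.ofReal (c * x * z) * ENNReal.ofReal u := by gcongr
    _ = ENNReal.ofReal (c * x * z * u) := (ENNReal.ofReal_mul hc).symm
    _ ≤ ENNReal.ofReal v := ENNReal.ofReal_le_ofReal h
    _ ≤ F := hF

/-- The lower bound for the norm of the example, with its dependence on `θ` made explicit; the box
on which the example is large has measure `θ ^ 3 / 72`. -/
lemma lower_constant {θ R s : ℝ} (hs1 : s ≤ 1) (hθ : 0 < θ) (hR : 0 < R) :
    (θ * R)⁻¹ * θ ^ (3 * s) / 144 ≤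
      (2 * (θ * R))⁻¹ * (2 * (θ / 12) * (2 * (θ ^ 2 / 24))) ^ s := by
  have e : 2 * (θ / 12) * (2 * (θ ^ 2 / 24)) = 1 / 72 * θ ^ (3 : ℝ) := by
    rw [show (3 : ℝ) = (3 : ℕ) by norm_num, Real.rpow_natCast]; ring
  rw [e, Real.mul_rpow (by norm_num) (by positivity), ← Real.rpow_mul hθ.le, mul_inv 2]
  have h72 : (1 / 72 : ℝ) ≤ (1 / 72 : ℝ) ^ s := by
    calc (1 / 72 : ℝ) = (1 / 72 : ℝ) ^ (1 : ℝ) := (Real.rpow_one _).symm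
      _ ≤ _ := Real.rpow_le_rpow_of_exponent_ge (by norm_num) (by norm_num) hs1
  calc (θ * R)⁻¹ * θ ^ (3 * s) / 144 = 2⁻¹ * (θ * R)⁻¹ * (1 / 72 * θ ^ (3 * s)) := by ring
    _ ≤ _ := by gcongr

/-- Sharpness of the square function estimate. For large exponents the extremal functions have
frequencies along the whole parabola, for small exponents along a single arc of length about
`R ^ (-1 / 2)`. -/
theorem exists_sharpness_constant (M : ℝ) (B : ℕ → ℝ) {ε : ℝ} (hε : 0 < ε) : ∃ c : ℝ, 0 < c ∧
    ∀ (α : ℝ) (p : ℝ≥0∞) (R : ℝ), 1 / 2 ≤ α → α ≤ 1 → 2 ≤ p → 1 ≤ R →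
      ∃ f : 𝓢(Plane, ℂ), f ≠ 0 ∧ tsupport (𝓕 (f : Plane → ℂ)) ⊆ parabolaNhd R ∧
        ∀ (P : CapPartition α R) (ψ : Fin P.n → Plane → ℝ), IsCapPartitionOfUnity P M B ψ →
          ENNReal.ofReal (c * R ^ (-ε) * capConstant α p R) *
              eLpNorm (squareFunction ψ f) p volume ≤ eLpNorm f p volume := by
  obtain ⟨M', hM'⟩ : ∃ M', M' = max M 1 := ⟨_, rfl⟩
  obtain ⟨b, hb⟩ : ∃ b, b = max (B 0) 1 := ⟨_, rfl⟩
  have hM1 : 1 ≤ M' := hM' ▸ le_max_right _ _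
  have hb1 : 1 ≤ b := hb ▸ le_max_right _ _
  have hM2 : 1 ≤ M' ^ 2 := one_le_pow₀ hM1
  have hb2 : 1 ≤ b ^ 2 := one_le_pow₀ hb1
  have hb4 : 1 ≤ b ^ 4 := one_le_pow₀ hb1
  set C₁ := (4 * M' + 5) * (16 * b ^ 2 * M' ^ 2) with hC₁
  set C₂ := (4 * M' + 5) * (4 * b ^ 2 * M') with hC₂
  set C₃ := 16 * b ^ 4 * M' ^ 2 * SpreadPieces.pairConstant M' * 8 with hC₃
  set L := 1 + 4 ^ ε / ε with hL
  have hL1 : 1 ≤ L := by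
    have : 0 < 4 ^ ε / ε := by positivity
    linarith
  have h1C₁ : 1 ≤ C₁ := one_le_mul_of_one_le_of_one_le (by linarith)
    (one_le_mul_of_one_le_of_one_le (by linarith) hM2)
  have h1C₂ : 1 ≤ C₂ := one_le_mul_of_one_le_of_one_le (by linarith)
    (one_le_mul_of_one_le_of_one_le (by linarith) hM1)
  have h1P : 1 ≤ SpreadPieces.pairConstant M' := by
    unfold SpreadPieces.pairConstant
    nlinarith
  have h1C₃ : 1 ≤ C₃ := one_le_mul_of_one_le_of_one_le (one_le_mul_of_one_le_of_one_le
    (one_le_mul_of_one_le_of_one_le (by linarith) hM2) h1P) (by norm_num)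
  refine ⟨(144 * (C₁ * C₂ * (C₃ * L)))⁻¹, by positivity, ?_⟩
  intro α p R hα hα1 hp hR
  have hR0 : 0 < R := by linarith
  have hp0 : p ≠ 0 := (lt_of_lt_of_le (by norm_num) hp).ne'
  set s := (p⁻¹).toReal with hs
  have hs0 : 0 ≤ s := ENNReal.toReal_nonneg
  have hs2 : s ≤ 1 / 2 := by
    have := ENNReal.toReal_mono (by simp) (ENNReal.inv_le_inv.2 hp)
    simpa [hs] using this
  have hRε : 1 ≤ R ^ ε := Real.one_le_rpow hR hε.le
  -- the two examples differ in the length `θ⁻¹` of the arc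
  obtain ⟨θ, hθdef⟩ : ∃ θ : ℝ, θ = if ENNReal.ofReal (4 * α + 2) ≤ p then 1 else R ^ (1 / 2 : ℝ) :=
    ⟨_, rfl⟩
  have hθ1 : 1 ≤ θ := by
    rw [hθdef]
    split_ifs
    · exact le_rfl
    · exact Real.one_le_rpow hR (by norm_num)
  have hθR : θ ^ 2 ≤ R := by
    rw [hθdef]
    split_ifs
    · linarith
    · rw [← Real.rpow_natCast, ← Real.rpow_mul hR0.le]
      norm_num
  have hθ0 : 0 < θ := by linarith
  obtain ⟨f, hf1, hf2, hf3⟩ := exists_bump_near_parabola hR hθ1 hθR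
  have hbpos : 0 < (2 * (θ * R))⁻¹ := by positivity
  refine ⟨f, ?_, ?_, ?_⟩
  · rintro rfl
    have := hf3 0 (by simp; positivity) (by simp; positivity)
    simp only [zero_apply, norm_zero] at this
    linarith
  · refine (closure_minimal (fun ξ hξ => hf2 ξ hξ)
      (isClosed_parabolaStrip isClosed_Icc _)).trans (parabolaStrip_subset_parabolaNhd ?_)
    have := inv_le_one_of_one_le₀ hθ1
    exact Set.Icc_subset_Icc (by linarith) this
  · intro P ψ hψ
    obtain ⟨g, hg1, hg⟩ := hψ.exists_spreadPieces hα hR hθ1 hθR hf1 hf2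
    rw [← hM', ← hb] at hg
    have hK : 0 < R ^ α := Real.rpow_pos_of_pos hR0 α
    have hlow := le_eLpNorm_of_le_on (f := f) (measurableSet_box (θ / 12) (θ ^ 2 / 24)) hbpos.le
      (by positivity) (volume_box (by positivity))
      (fun x hx => hf3 x hx.1 hx.2) hp0
    have hlow' := (ENNReal.ofReal_le_ofReal
      (lower_constant (by linarith) hθ0 hR0)).trans hlow
    have hsup : ∀ x, ‖squareFunction ψ f x‖ₑ ^ 2 ≤ ENNReal.ofReal (C₁ * (θ * R ^ α * R ^ 2)⁻¹) :=
      fun x => (enorm_squareFunction_sq hg1 x).trans_le (hg.sqSum_sup_le x)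
    have hR2 : R ^ (2 : ℕ) = R ^ (2 : ℝ) := by rw [Real.rpow_two]
    have hRinv : R⁻¹ = R ^ (-1 : ℝ) := by rw [Real.rpow_neg_one]
    by_cases hcase : ENNReal.ofReal (4 * α + 2) ≤ p
    · have hθ : θ = 1 := by rw [hθdef, if_pos hcase]
      have hs4 : s ≤ 1 / 4 := by
        have h4 : (4 : ℝ≥0∞) ≤ p := by
          refine le_trans ?_ hcase
          rw [show (4 : ℝ≥0∞) = ENNReal.ofReal 4 by simp]
          exact ENNReal.ofReal_le_ofReal (by linarith)
        have := ENNReal.toReal_mono (by simp) (ENNReal.inv_le_inv.2 h4)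
        simpa [hs] using this
      have hp4 : ENNReal.ofReal (2 * 2) ≤ p :=
        le_trans (ENNReal.ofReal_le_ofReal (by linarith)) hcase
      have hlogL : 1 + Real.log (4 * R ^ α) ≤ L * R ^ ε := by
        have h1 := Real.log_le_rpow_div (x := 4 * R ^ α) (by positivity) hε
        have h2 : (4 * R ^ α) ^ ε ≤ 4 ^ ε * R ^ ε := by
          rw [← Real.mul_rpow (by norm_num) hR0.le]
          have : R ^ α ≤ R ^ (1 : ℝ) := Real.rpow_le_rpow_of_exponent_le hR hα1
          rw [Real.rpow_one] at this
          gcongr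
        calc 1 + Real.log (4 * R ^ α) ≤ 1 * R ^ ε + 4 ^ ε * R ^ ε / ε := by
              rw [one_mul]
              exact add_le_add hRε (h1.trans (by gcongr))
          _ = L * R ^ ε := by rw [hL]; ring
      have hA : C₁ * (θ * R ^ α * R ^ 2)⁻¹ = C₁ * R ^ (-(α + 2)) := by
        rw [hθ, one_mul, hR2, ← Real.rpow_add hR0, ← Real.rpow_neg hR0.le]
      have hE : ∫⁻ x, (‖squareFunction ψ f x‖ₑ ^ 2) ^ (2 : ℝ) ≤
          ENNReal.ofReal (C₃ * L * R ^ ε * R ^ (-4 : ℝ)) := by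
        simp_rw [enorm_squareFunction_sq hg1, ENNReal.rpow_two]
        refine hg.lintegral_sqSum_sq_le.trans (ENNReal.ofReal_le_ofReal ?_)
        have e4 : (R ^ 4)⁻¹ = R ^ (-4 : ℝ) := by
          rw [Real.rpow_neg hR0.le]
          norm_cast
        rw [e4]
        calc 16 * b ^ 4 * M' ^ 2 * SpreadPieces.pairConstant M' *
              (8 * (1 + Real.log (4 * R ^ α))) * R ^ (-4 : ℝ)
            = C₃ * (1 + Real.log (4 * R ^ α)) * R ^ (-4 : ℝ) := by rw [hC₃]; ring
          _ ≤ C₃ * (L * R ^ ε) * R ^ (-4 : ℝ) := by gcongr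
          _ = _ := by ring
      rw [hA] at hsup
      have hup := eLpNorm_le_of_sup_of_lintegral two_pos hp4 (by positivity) (by positivity) hsup hE
      refine ofReal_mul_eLpNorm_le (y := R ^ (α * (1 / 2 - 2 * s))) hup hlow' (by positivity) ?_
        (by unfold capConstant; rw [if_pos hcase])
      have hD : 1 ≤ C₃ * L * R ^ ε := one_le_mul_of_one_le_of_one_le
        (one_le_mul_of_one_le_of_one_le h1C₃ hL1) hRε
      have hu : (C₁ * R ^ (-(α + 2))) ^ (1 / 2 - 2 * s) * (C₃ * L * R ^ ε * R ^ (-4 : ℝ)) ^ s ≤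
          (C₁ * R ^ (-(α + 2) * (1 / 2 - 2 * s))) * (C₃ * L * R ^ ε * R ^ (-4 * s)) := by
        gcongr
        · exact mul_rpow_rpow_le h1C₁ hR0 (by linarith)
        · exact mul_rpow_rpow_le hD hR0 (by linarith)
      rw [hθ, one_mul, Real.one_rpow, mul_one]
      have hexp : R ^ (-ε) * R ^ (α * (1 / 2 - 2 * s)) *
          (R ^ (-(α + 2) * (1 / 2 - 2 * s)) * (R ^ ε * R ^ (-4 * s))) = R⁻¹ := by
        rw [hRinv]
        simp only [← Real.rpow_add hR0]
        congr 1; ring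
      calc _ ≤ (144 * (C₁ * C₂ * (C₃ * L)))⁻¹ * R ^ (-ε) * R ^ (α * (1 / 2 - 2 * s)) *
            ((C₁ * R ^ (-(α + 2) * (1 / 2 - 2 * s))) * (C₃ * L * R ^ ε * R ^ (-4 * s))) := by
            gcongr
        _ = (144 * (C₁ * C₂ * (C₃ * L)))⁻¹ * (C₁ * C₃ * L) *
            (R ^ (-ε) * R ^ (α * (1 / 2 - 2 * s)) *
              (R ^ (-(α + 2) * (1 / 2 - 2 * s)) * (R ^ ε * R ^ (-4 * s)))) := by ring
        _ = (144 * C₂)⁻¹ * R⁻¹ := by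
            rw [hexp]
            field_simp
        _ ≤ 144⁻¹ * R⁻¹ := by
            gcongr
            linarith
        _ = _ := by ring
    · have hθ : θ = R ^ (1 / 2 : ℝ) := by rw [hθdef, if_neg hcase]
      have hA : C₁ * (θ * R ^ α * R ^ 2)⁻¹ = C₁ * R ^ (-(1 / 2 + α + 2)) := by
        rw [hθ, hR2, ← Real.rpow_add hR0, ← Real.rpow_add hR0, ← Real.rpow_neg hR0.le]
      have hθR' : (θ * R)⁻¹ = R ^ (-(1 / 2 + 1) : ℝ) := by
        rw [hθ, Real.rpow_neg hR0.le, Real.rpow_add hR0, Real.rpow_one]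
      have hE : ∫⁻ x, (‖squareFunction ψ f x‖ₑ ^ 2) ^ (1 : ℝ) ≤
          ENNReal.ofReal (C₂ * R ^ (-(1 / 2 + 1) : ℝ)) := by
        simp_rw [enorm_squareFunction_sq hg1, ENNReal.rpow_one]
        rw [← hθR']
        exact hg.lintegral_sqSum_le
      rw [hA] at hsup
      have hup := eLpNorm_le_of_sup_of_lintegral (k := 1) one_pos (by simpa using hp)
        (by positivity) (by positivity) hsup hE
      rw [one_mul, ← hs] at hup
      refine ofReal_mul_eLpNorm_le (y := R ^ ((α - 1 / 2) * (1 / 2 - s))) hup hlow' (by positivity)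
        ?_ (by unfold capConstant; rw [if_neg hcase])
      have hu : (C₁ * R ^ (-(1 / 2 + α + 2))) ^ (1 / 2 - s) *
            (C₂ * R ^ (-(1 / 2 + 1) : ℝ)) ^ s ≤
          (C₁ * R ^ (-(1 / 2 + α + 2) * (1 / 2 - s))) * (C₂ * R ^ (-(1 / 2 + 1) * s)) := by
        gcongr
        · exact mul_rpow_rpow_le h1C₁ hR0 (by linarith)
        · exact mul_rpow_rpow_le h1C₂ hR0 (by linarith)
      have hexp : R ^ ((α - 1 / 2) * (1 / 2 - s)) *
          (R ^ (-(1 / 2 + α + 2) * (1 / 2 - s)) * R ^ (-(1 / 2 + 1) * s)) =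
          (θ * R)⁻¹ * θ ^ (3 * s) := by
        rw [hθR', hθ, ← Real.rpow_mul hR0.le]
        simp only [← Real.rpow_add hR0]
        congr 1; ring
      have hRneg : R ^ (-ε) ≤ 1 := Real.rpow_le_one_of_one_le_of_nonpos hR (by linarith)
      calc _ ≤ (144 * (C₁ * C₂ * (C₃ * L)))⁻¹ * 1 * R ^ ((α - 1 / 2) * (1 / 2 - s)) *
            ((C₁ * R ^ (-(1 / 2 + α + 2) * (1 / 2 - s))) * (C₂ * R ^ (-(1 / 2 + 1) * s))) := by
            gcongr
        _ = (144 * (C₁ * C₂ * (C₃ * L)))⁻¹ * (C₁ * C₂) * (R ^ ((α - 1 / 2) * (1 / 2 - s)) *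
            (R ^ (-(1 / 2 + α + 2) * (1 / 2 - s)) * R ^ (-(1 / 2 + 1) * s))) := by ring
        _ = (144 * (C₃ * L))⁻¹ * ((θ * R)⁻¹ * θ ^ (3 * s)) := by
            rw [hexp]
            field_simp
        _ ≤ 144⁻¹ * ((θ * R)⁻¹ * θ ^ (3 * s)) := by
            have : 1 ≤ C₃ * L := one_le_mul_of_one_le_of_one_le h1C₃ hL1
            gcongr
            linarith
        _ = _ := by ring

end SmallCap

theorem theorem1 (M : ℝ) (B : ℕ → ℝ) (ε : ℝ) (hε : 0 < ε) :
    (∃ C : ℝ, 0 < C ∧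
      ∀ (α : ℝ) (p : ℝ≥0∞) (R : ℝ), 1 / 2 ≤ α → α ≤ 1 → 2 ≤ p → 1 ≤ R →
      ∀ (P : SmallCap.CapPartition α R) (ψ : Fin P.n → SmallCap.Plane → ℝ),
        SmallCap.IsCapPartitionOfUnity P M B ψ →
      ∀ f : 𝓢(SmallCap.Plane, ℂ),
        tsupport (𝓕 (f : SmallCap.Plane → ℂ)) ⊆ SmallCap.parabolaNhd R →
        eLpNorm f p volume ≤
          ENNReal.ofReal (C * R ^ ε * SmallCap.capConstant α p R) *
            eLpNorm (SmallCap.squareFunction ψ f) p volume) ∧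
    (∃ c : ℝ, 0 < c ∧
      ∀ (α : ℝ) (p : ℝ≥0∞) (R : ℝ), 1 / 2 ≤ α → α ≤ 1 → 2 ≤ p → 1 ≤ R →
      ∃ f : 𝓢(SmallCap.Plane, ℂ), f ≠ 0 ∧
        tsupport (𝓕 (f : SmallCap.Plane → ℂ)) ⊆ SmallCap.parabolaNhd R ∧
        ∀ (P : SmallCap.CapPartition α R) (ψ : Fin P.n → SmallCap.Plane → ℝ),
          SmallCap.IsCapPartitionOfUnity P M B ψ →
          ENNReal.ofReal (c * R ^ (-ε) * SmallCap.capConstant α p R) *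
              eLpNorm (SmallCap.squareFunction ψ f) p volume ≤
            eLpNorm f p volume) := by
  obtain ⟨C, hC, hupper⟩ := SmallCap.exists_squareFunction_bound M hε
  exact ⟨⟨C, hC, fun α p R hα hα1 hp hR P ψ hψ f hf => hupper hα hα1 hp hR hψ f hf⟩,
    SmallCap.exists_sharpness_constant M B hε⟩
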